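/- An étale groupoid means a locally compact Hausdorff topological groupoid $G$ whose domain map $d\colon G\to G^{(0)}$ is a local homeomorphism; effectiveness and second countability are not assumed. Write $\mathrm{Iso}(G)=\{\alpha\in G : d(\alpha)=r(\alpha)\}$, let $\mathrm{Iso}(G)^{\circ}$ be its interior in $G$, and let $G/\mathrm{Iso}(G)^{\circ}$ be the quotient groupoid, with the quotient topology, of $G$ by the relation $\alpha\sim\beta \iff d(\alpha)=d(\beta)$ and $\alpha\beta^{-1}\in\mathrm{Iso}(G)^{\circ}$. Let $C^*_r(G)$ be the reduced C*-algebra of $G$, and $C_0(G^{(0)})\subset C^*_r(G)$ the closure of the set of functions in $C_c(G)$ that vanish off $G^{(0)}$. Let $G$ and $H$ be étale groupoids such that $\mathrm{Iso}(H)^{\circ}$ is closed in $H$, and let $Q\colon H\to H/\mathrm{Iso}(H)^{\circ}$ be the quotient map. Let $$\varphi_Q\colon C_c(H)\to C_c(H/\mathrm{Iso}(H)^{\circ}),\qquad \varphi_Q(f)(\delta)=\sum_{\alpha\in Q^{-1}(\delta)}f(\alpha).$$ (1) Assume that $\varphi_Q$ extends to a $*$-homomorphism $C^*_r(H)\to C^*_r(H/\mathrm{Iso}(H)^{\circ})$.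 If there is a surjective $*$-homomorphism $\varphi\colon C^*_r(G)\to C^*_r(H)$ that restricts to an isomorphism from $C_0(G^{(0)})$ onto $C_0(H^{(0)})$, then $G/\mathrm{Iso}(G)^{\circ}$ and $H/\mathrm{Iso}(H)^{\circ}$ are isomorphic as étale groupoids, i.e. there is a groupoid isomorphism between them that is a homeomorphism. (2) The assumption that $\varphi_Q$ extends holds if $H$ is (topologically) amenable, that is, if for every compact $K\subset H$ and every $\varepsilon>0$ there is a continuous function $m\colon H\to[0,\infty)$ with $\sum_{r(\gamma)=x}m(\gamma)=1$ for all $x\in H^{(0)}$ and $\sum_{r(\beta)=r(\alpha)}|m(\alpha^{-1}\beta)-m(\beta)|<\varepsilon$ for all $\alpha\in K$. -/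

import Mathlib

open Topology Set

/-- A groupoid, given by its set of arrows `G`: the unit space is the subset of fixed points of the
domain map, and the product is defined on the pairs `(α, β)` with `d α = r β`. -/
class ArrowGroupoid (G : Type*) where
  dom : G → G
  rng : G → G
  comp : (α β : G) → dom α = rng β → G
  inv : G → G
  dom_dom : ∀ α, dom (dom α) = dom α
  rng_dom : ∀ α, rng (dom α) = dom α
  dom_rng : ∀ α, dom (rng α) = rng α
  rng_rng : ∀ α, rng (rng α) = rng α
  comp_dom : ∀ α, comp α (dom α) (rng_dom α).symm = α
  rng_comp_self : ∀ α, comp (rng α) α (dom_rng α) = α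
  dom_comp : ∀ α β h, dom (comp α β h) = dom β
  rng_comp : ∀ α β h, rng (comp α β h) = rng α
  comp_assoc : ∀ α β γ (h₁ : dom α = rng β) (h₂ : dom β = rng γ),
    comp (comp α β h₁) γ ((dom_comp α β h₁).trans h₂)
      = comp α (comp β γ h₂) (h₁.trans (rng_comp β γ h₂).symm)
  dom_inv : ∀ α, dom (inv α) = rng α
  rng_inv : ∀ α, rng (inv α) = dom α
  inv_comp : ∀ α, comp (inv α) α (dom_inv α) = dom α
  comp_inv : ∀ α, comp α (inv α) (rng_inv α).symm = rng α

namespace ArrowGroupoid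

section Algebra

variable {G : Type*} [ArrowGroupoid G]

/-- The unit space `G⁽⁰⁾`. -/
def units (G : Type*) [ArrowGroupoid G] : Set G := {x | dom x = x}

theorem dom_mem_units (α : G) : dom α ∈ units G := dom_dom α

/-- The isotropy `Iso(G)`. -/
def iso (G : Type*) [ArrowGroupoid G] : Set G := {α | dom α = rng α}

theorem rng_of_unit {x : G} (hx : dom x = x) : rng x = x := by
  rw [← hx, rng_dom]

theorem comp_congr {α α' β β' : G} (h : dom α = rng β) (ha : α = α') (hb : β = β') :
    comp α β h = comp α' β' (by rw [← ha, ← hb, h]) := by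
  subst ha; subst hb; rfl

theorem unit_comp {x α : G} (hx : dom x = x) (h : dom x = rng α) : comp x α h = α := by
  have : x = rng α := hx.symm.trans h
  rw [comp_congr h this rfl, rng_comp_self]

theorem comp_unit {x α : G} (hx : dom x = x) (h : dom α = rng x) : comp α x h = α := by
  have : x = dom α := by rw [h, rng_of_unit hx]
  rw [comp_congr h rfl this, comp_dom]

theorem comp_inv_cancel {α β : G} (h : dom α = dom β) :
    comp (comp α (inv β) (h.trans (rng_inv β).symm)) β ((dom_comp _ _ _).trans (dom_inv β)) = α := by
  rw [comp_assoc _ _ _ _ (dom_inv β), comp_congr _ rfl (inv_comp β)]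
  exact comp_unit (dom_dom β) _

theorem comp_comp_inv {α β : G} (h : dom α = rng β) :
    comp (comp α β h) (inv β) ((dom_comp _ _ _).trans (rng_inv β).symm) = α := by
  rw [comp_assoc _ _ _ _ (rng_inv β).symm, comp_congr _ rfl (comp_inv β)]
  exact comp_unit (dom_rng β) _

theorem inv_comp_comp {α β : G} (h : dom α = rng β) :
    comp (inv α) (comp α β h) ((dom_inv α).trans (rng_comp _ _ _).symm) = β := by
  rw [← comp_assoc _ _ _ (dom_inv α) h, comp_congr _ (inv_comp α) rfl]
  exact unit_comp (dom_dom α) _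

theorem comp_right_cancel {α α' β : G} (h : dom α = rng β) (h' : dom α' = rng β)
    (e : comp α β h = comp α' β h') : α = α' := by
  rw [← comp_comp_inv h, comp_congr _ e rfl, comp_comp_inv h']

theorem inv_inv (α : G) : inv (inv α) = α := by
  refine comp_right_cancel (β := inv α) (dom_inv _) (rng_inv α).symm ?_
  rw [inv_comp, comp_inv, dom_inv]

theorem inv_unit {x : G} (hx : dom x = x) : inv x = x := by
  have h := comp_inv x
  rw [unit_comp hx] at h
  rw [h, rng_of_unit hx]

theorem inv_comp_rev {α β : G} (h : dom α = rng β) :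
    inv (comp α β h) = comp (inv β) (inv α) (by rw [dom_inv, rng_inv, h]) := by
  refine comp_right_cancel (β := comp α β h) (dom_inv _)
    (by rw [dom_comp, dom_inv, rng_comp]) ?_
  rw [inv_comp, comp_assoc _ _ _ _ (by rw [dom_inv, rng_comp]), comp_congr _ rfl (inv_comp_comp h),
    inv_comp, dom_comp]

/-- The product `U V` of two sets of arrows. -/
def setMul (U V : Set G) : Set G := {γ | ∃ α ∈ U, ∃ β ∈ V, ∃ h : dom α = rng β, comp α β h = γ}

end Algebra

end ArrowGroupoid

open ArrowGroupoid

/-- An étale groupoid: multiplication and inversion are continuous, and the domain map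
`d : G → G⁽⁰⁾` is a local homeomorphism. Local compactness and the Hausdorff property are separate
hypotheses. -/
class EtaleGroupoid (G : Type*) [TopologicalSpace G] extends ArrowGroupoid G where
  continuous_comp : Continuous fun p : {p : G × G // dom p.1 = rng p.2} => comp p.1.1 p.1.2 p.2
  continuous_inv : Continuous (inv : G → G)
  isLocalHomeomorph_dom : IsLocalHomeomorph fun α : G => (⟨dom α, dom_mem_units α⟩ : units G)

namespace EtaleGroupoid

section Topology

variable {G : Type*} [TopologicalSpace G] [EtaleGroupoid G]

theorem continuous_dom : Continuous (dom : G → G) :=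
  continuous_subtype_val.comp (isLocalHomeomorph_dom (G := G)).continuous

theorem continuous_rng : Continuous (rng : G → G) := by
  have : (rng : G → G) = fun α => dom (inv α) := funext fun α => (dom_inv α).symm
  rw [this]
  exact continuous_dom.comp continuous_inv

theorem exists_injOn_dom (α : G) : ∃ U : Set G, IsOpen U ∧ α ∈ U ∧ InjOn dom U := by
  obtain ⟨e, he, hf⟩ := isLocalHomeomorph_dom (G := G) α
  refine ⟨e.source, e.open_source, he, fun a ha b hb hab => e.injOn ha hb ?_⟩
  rw [← hf]
  exact Subtype.ext hab

theorem isOpen_units : IsOpen (units G) := by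
  rw [isOpen_iff_mem_nhds]
  intro x hx
  obtain ⟨U, hU, hxU, hinj⟩ := exists_injOn_dom x
  have h1 : ∀ᶠ y in 𝓝 x, y ∈ U := hU.mem_nhds hxU
  have h2 : ∀ᶠ y in 𝓝 x, dom y ∈ U := by
    refine continuous_dom.continuousAt.eventually (hU.mem_nhds ?_)
    rwa [show dom x = x from hx]
  filter_upwards [h1, h2] with y hy hy'
  exact hinj hy' hy (dom_dom y)

theorem isOpenMap_dom : IsOpenMap (dom : G → G) :=
  isOpen_units.isOpenMap_subtype_val.comp (isLocalHomeomorph_dom (G := G)).isOpenMap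

theorem isOpen_image_inv {U : Set G} (hU : IsOpen U) : IsOpen (inv ⁻¹' U : Set G) :=
  hU.preimage continuous_inv

theorem exists_injOn_rng (α : G) : ∃ U : Set G, IsOpen U ∧ α ∈ U ∧ InjOn rng U := by
  obtain ⟨U, hU, hα, hinj⟩ := exists_injOn_dom (inv α)
  refine ⟨inv ⁻¹' U, isOpen_image_inv hU, hα, fun a ha b hb hab => ?_⟩
  have := hinj ha hb (by rw [dom_inv, dom_inv, hab])
  rw [← ArrowGroupoid.inv_inv a, this, ArrowGroupoid.inv_inv]

/-- Continuity of the multiplication, in terms of neighbourhoods. -/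
theorem exists_open_comp {α β : G} (h : dom α = rng β) {W : Set G} (hW : IsOpen W)
    (hm : comp α β h ∈ W) : ∃ A B : Set G, IsOpen A ∧ IsOpen B ∧ α ∈ A ∧ β ∈ B ∧
      ∀ a ∈ A, ∀ b ∈ B, ∀ h' : dom a = rng b, comp a b h' ∈ W := by
  have := (hW.preimage (continuous_comp (G := G)))
  rw [isOpen_induced_iff] at this
  obtain ⟨O, hO, hpre⟩ := this
  have hmem : (α, β) ∈ O := by
    have : (⟨(α, β), h⟩ : {p : G × G // dom p.1 = rng p.2}) ∈ Subtype.val ⁻¹' O := by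
      rw [hpre]; exact hm
    exact this
  obtain ⟨A, B, hA, hB, ha, hb, hAB⟩ := isOpen_prod_iff.1 hO α β hmem
  refine ⟨A, B, hA, hB, ha, hb, fun a ha b hb h' => ?_⟩
  have : (⟨(a, b), h'⟩ : {p : G × G // dom p.1 = rng p.2}) ∈ Subtype.val ⁻¹' O :=
    hAB (mk_mem_prod ha hb)
  rw [hpre] at this
  exact this

theorem isOpen_setMul {U V : Set G} (hU : IsOpen U) (hV : IsOpen V) : IsOpen (setMul U V) := by
  rw [isOpen_iff_mem_nhds]
  rintro _ ⟨α, hα, β, hβ, h, rfl⟩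
  have hmem : comp (comp α β h) (inv β) ((dom_comp _ _ _).trans (rng_inv β).symm) ∈ U := by
    rwa [comp_comp_inv]
  obtain ⟨A, B, hA, hB, ha, hb, hAB⟩ := exists_open_comp _ hU hmem
  have hB' : IsOpen (V ∩ inv ⁻¹' B) := hV.inter (isOpen_image_inv hB)
  have hO : IsOpen (A ∩ dom ⁻¹' (dom '' (V ∩ inv ⁻¹' B))) :=
    hA.inter ((isOpenMap_dom _ hB').preimage continuous_dom)
  refine Filter.mem_of_superset (hO.mem_nhds ⟨ha, β, ⟨hβ, hb⟩, (dom_comp _ _ _).symm⟩) ?_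
  rintro γ ⟨hγ, δ, ⟨hδ, hδ'⟩, hd⟩
  exact ⟨_, hAB γ hγ (inv δ) hδ' (hd.symm.trans (rng_inv δ).symm), δ, hδ, _,
    comp_inv_cancel hd.symm⟩

/-- `Iso(G)°`, the interior of the isotropy. -/
def isoInt (G : Type*) [TopologicalSpace G] [EtaleGroupoid G] : Set G := interior (iso G)

theorem isOpen_isoInt : IsOpen (isoInt G) := isOpen_interior

theorem dom_eq_rng_of_mem {α : G} (h : α ∈ isoInt G) : dom α = rng α := by
  have h' : α ∈ iso G := interior_subset (s := iso G) h
  exact h'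

theorem units_subset_isoInt : units G ⊆ isoInt G :=
  interior_maximal (fun x hx => (show dom x = x from hx).trans (rng_of_unit hx).symm) isOpen_units

theorem comp_mem_isoInt {α β : G} (hα : α ∈ isoInt G) (hβ : β ∈ isoInt G) (h : dom α = rng β) :
    comp α β h ∈ isoInt G := by
  refine interior_maximal ?_ (isOpen_setMul (isOpen_isoInt (G := G)) (isOpen_isoInt (G := G)))
    ⟨α, hα, β, hβ, h, rfl⟩
  rintro _ ⟨a, ha, b, hb, h', rfl⟩
  change dom _ = rng _
  rw [dom_comp, rng_comp, ← dom_eq_rng_of_mem ha, h', dom_eq_rng_of_mem hb]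

theorem inv_mem_isoInt {α : G} (hα : α ∈ isoInt G) : inv α ∈ isoInt G := by
  refine interior_maximal ?_ (isOpen_image_inv (isOpen_isoInt (G := G)))
    (show inv (inv α) ∈ isoInt G by rwa [ArrowGroupoid.inv_inv])
  intro a ha
  have := dom_eq_rng_of_mem (show inv a ∈ isoInt G from ha)
  rw [dom_inv, rng_inv] at this
  exact this.symm

theorem conj_mem_isoInt {α ν : G} (hν : ν ∈ isoInt G) (h : dom α = rng ν) :
    comp (comp α ν h) (inv α)
      (by rw [dom_comp, rng_inv, h]; exact dom_eq_rng_of_mem hν) ∈ isoInt G := by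
  obtain ⟨U, hU, hα, hinj⟩ := exists_injOn_dom α
  refine interior_maximal ?_ (isOpen_setMul (isOpen_setMul hU (isOpen_isoInt (G := G)))
    (isOpen_image_inv hU))
    ⟨_, ⟨α, hα, ν, hν, h, rfl⟩, inv α, by
      change inv (inv α) ∈ U; rwa [ArrowGroupoid.inv_inv], _, rfl⟩
  rintro _ ⟨_, ⟨a, ha, n, hn, h1, rfl⟩, b, hb, h2, rfl⟩
  change dom _ = rng _
  have : a = inv b := by
    refine hinj ha hb ?_
    rw [dom_inv, ← h2, dom_comp, dom_eq_rng_of_mem hn, h1]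
  rw [dom_comp, rng_comp, rng_comp, this, rng_inv]

/-- The equivalence relation `α ∼ β ↔ d(α) = d(β)` and `α β⁻¹ ∈ Iso(G)°`. -/
def isoSetoid (G : Type*) [TopologicalSpace G] [EtaleGroupoid G] : Setoid G where
  r α β := ∃ h : dom α = dom β, comp α (inv β) (h.trans (rng_inv β).symm) ∈ isoInt G
  iseqv :=
    { refl := fun α => ⟨rfl, by
        rw [comp_inv]; exact units_subset_isoInt (dom_rng α)⟩
      symm := by
        rintro α β ⟨h, hm⟩
        refine ⟨h.symm, ?_⟩
        have := inv_mem_isoInt hm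
        rwa [inv_comp_rev, comp_congr _ (ArrowGroupoid.inv_inv β) rfl] at this
      trans := by
        rintro α β γ ⟨h, hm⟩ ⟨h', hm'⟩
        refine ⟨h.trans h', ?_⟩
        have := comp_mem_isoInt hm hm' (by rw [dom_comp, rng_comp, dom_inv])
        rwa [← comp_assoc _ _ _ (by rw [dom_comp, dom_inv]) (h'.trans (rng_inv γ).symm),
          comp_congr _ (comp_inv_cancel h) rfl] at this }

/-- The quotient `G / Iso(G)°`, with the quotient topology. -/
def IsoQuotient (G : Type*) [TopologicalSpace G] [EtaleGroupoid G] : Type _ :=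
  Quotient (isoSetoid G)

instance : TopologicalSpace (IsoQuotient G) :=
  inferInstanceAs (TopologicalSpace (Quotient (isoSetoid G)))

/-- The quotient map `Q : G → G / Iso(G)°`. -/
def IsoQuotient.mk (α : G) : IsoQuotient G := Quotient.mk (isoSetoid G) α

namespace IsoQuotient

theorem mk_surjective : Function.Surjective (mk : G → IsoQuotient G) :=
  Quotient.mk_surjective (s := isoSetoid G)

theorem continuous_mk : Continuous (mk : G → IsoQuotient G) :=
  continuous_quotient_mk' (s := isoSetoid G)

theorem mk_eq {α β : G} : mk α = mk β ↔
    ∃ h : dom α = dom β, comp α (inv β) (h.trans (rng_inv β).symm) ∈ isoInt G :=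
  Quotient.eq (r := isoSetoid G)

theorem mk_eq_iff {α β : G} : mk α = mk β ↔
    ∃ ν ∈ isoInt G, ∃ h : dom ν = rng β, comp ν β h = α := by
  rw [mk_eq]
  constructor
  · rintro ⟨h, hm⟩
    exact ⟨_, hm, _, comp_inv_cancel h⟩
  · rintro ⟨ν, hν, h, rfl⟩
    exact ⟨dom_comp _ _ _, by rwa [comp_comp_inv]⟩

theorem dom_eq_of_mk_eq {α β : G} (h : mk α = mk β) : dom α = dom β := (mk_eq.1 h).1

theorem rng_eq_of_mk_eq {α β : G} (h : mk α = mk β) : rng α = rng β := by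
  obtain ⟨ν, hν, h1, rfl⟩ := mk_eq_iff.1 h
  rw [rng_comp, ← dom_eq_rng_of_mem hν, h1]

theorem mk_dom_inj {α β : G} (h : mk (dom α) = mk (dom β)) : dom α = dom β := by
  have := dom_eq_of_mk_eq h
  rwa [dom_dom, dom_dom] at this

theorem isOpenMap_mk : IsOpenMap (mk : G → IsoQuotient G) := by
  intro U hU
  have hpre : (mk ⁻¹' (mk '' U) : Set G) = setMul (isoInt G) U := by
    ext γ
    constructor
    · rintro ⟨u, hu, h⟩
      obtain ⟨ν, hν, h', e⟩ := mk_eq_iff.1 h.symm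
      exact ⟨ν, hν, u, hu, h', e⟩
    · rintro ⟨ν, hν, u, hu, h', e⟩
      exact ⟨u, hu, (mk_eq_iff.2 ⟨ν, hν, h', e⟩).symm⟩
  have : IsOpen (mk ⁻¹' (mk '' U) : Set G) := by
    rw [hpre]; exact isOpen_setMul isOpen_isoInt hU
  exact isOpen_coinduced.2 this

/-- The domain map of the quotient: `d([α]) = [d(α)]`. -/
def qdom (a : IsoQuotient G) : IsoQuotient G :=
  Quotient.lift (s := isoSetoid G) (fun α : G => mk (dom α))
    (fun _ _ h => congrArg mk (dom_eq_of_mk_eq (Quotient.sound (s := isoSetoid G) h))) a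

/-- The range map of the quotient: `r([α]) = [r(α)]`. -/
def qrng (a : IsoQuotient G) : IsoQuotient G :=
  Quotient.lift (s := isoSetoid G) (fun α : G => mk (rng α))
    (fun _ _ h => congrArg mk (rng_eq_of_mk_eq (Quotient.sound (s := isoSetoid G) h))) a

theorem mk_inv_eq {α β : G} (h : mk α = mk β) : mk (inv α) = mk (inv β) := by
  obtain ⟨ν, hν, h1, rfl⟩ := mk_eq_iff.1 h
  rw [inv_comp_rev, mk_eq]
  have h2 : dom (comp (inv β) (inv ν) (by rw [dom_inv, rng_inv, h1])) = dom (inv β) := by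
    rw [dom_comp, dom_inv, dom_inv, ← dom_eq_rng_of_mem hν, h1]
  exact ⟨h2, conj_mem_isoInt (inv_mem_isoInt hν) (by rw [dom_inv, rng_inv, h1])⟩

/-- Inversion in the quotient: `[α]⁻¹ = [α⁻¹]`. -/
def qinv (a : IsoQuotient G) : IsoQuotient G :=
  Quotient.lift (s := isoSetoid G) (fun α : G => mk (inv α))
    (fun _ _ h => mk_inv_eq (Quotient.sound (s := isoSetoid G) h)) a

theorem qdom_mk (α : G) : qdom (mk α) = mk (dom α) := rfl

theorem qrng_mk (α : G) : qrng (mk α) = mk (rng α) := rfl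

theorem composable_of_mk {α β : G} (h : qdom (mk α) = qrng (mk β)) : dom α = rng β := by
  have := dom_eq_of_mk_eq (show mk (dom α) = mk (rng β) from h)
  rwa [dom_dom, dom_rng] at this

theorem out_eq_mk (a : IsoQuotient G) : mk (Quotient.out (s := isoSetoid G) a) = a :=
  Quotient.out_eq (s := isoSetoid G) a

theorem out_composable {a b : IsoQuotient G} (h : qdom a = qrng b) :
    dom (Quotient.out (s := isoSetoid G) a) = rng (Quotient.out (s := isoSetoid G) b) := by
  apply composable_of_mk
  rw [out_eq_mk, out_eq_mk, h]

/-- The product of the quotient, `[α][β] = [αβ]`; see `qcomp_mk` for the independence of the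
representatives. -/
noncomputable def qcomp (a b : IsoQuotient G) (h : qdom a = qrng b) : IsoQuotient G :=
  mk (comp (Quotient.out (s := isoSetoid G) a) (Quotient.out (s := isoSetoid G) b)
    (out_composable h))

theorem mk_comp_eq {α α' β β' : G} (ha : mk α = mk α') (hb : mk β = mk β') (h : dom α = rng β)
    (h' : dom α' = rng β') : mk (comp α β h) = mk (comp α' β' h') := by
  obtain ⟨ν, hν, h1, rfl⟩ := mk_eq_iff.1 ha
  obtain ⟨μ, hμ, h2, rfl⟩ := mk_eq_iff.1 hb
  rw [mk_eq_iff]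
  have h3 : dom α' = rng μ := by rw [h', ← h2, dom_eq_rng_of_mem hμ]
  have hc := conj_mem_isoInt (α := α') hμ h3
  have h4 : dom (comp α' μ h3) = rng (inv α') := by
    rw [dom_comp, rng_inv, h3, dom_eq_rng_of_mem hμ]
  have h5 : dom (comp (comp α' μ h3) (inv α') h4) = rng (comp α' β' h') := by
    rw [dom_comp, dom_inv, rng_comp]
  have h6 : dom ν = rng (comp (comp α' μ h3) (inv α') h4) := by
    rw [rng_comp, rng_comp, h1]
  refine ⟨_, comp_mem_isoInt hν hc h6, by rw [dom_comp]; exact h5, ?_⟩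
  rw [comp_assoc _ _ _ h6 h5]
  have e : comp (comp (comp α' μ h3) (inv α') h4) (comp α' β' h') h5
      = comp α' (comp μ β' h2) (by rw [rng_comp, h3]) := by
    rw [comp_assoc _ _ _ h4 (by rw [dom_inv, rng_comp]), comp_congr _ rfl (inv_comp_comp h'),
      comp_assoc _ _ _ h3 h2]
  rw [comp_congr _ rfl e]
  exact (comp_assoc _ _ _ _ _).symm

theorem qcomp_mk {α β : G} (h : dom α = rng β) (h' : qdom (mk α) = qrng (mk β)) :
    qcomp (mk α) (mk β) h' = mk (comp α β h) :=
  mk_comp_eq (out_eq_mk _) (out_eq_mk _) _ _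

noncomputable instance : ArrowGroupoid (IsoQuotient G) where
  dom := qdom
  rng := qrng
  comp := qcomp
  inv := qinv
  dom_dom a := by
    obtain ⟨α, rfl⟩ := mk_surjective a
    exact congrArg mk (dom_dom α)
  rng_dom a := by
    obtain ⟨α, rfl⟩ := mk_surjective a
    exact congrArg mk (rng_dom α)
  dom_rng a := by
    obtain ⟨α, rfl⟩ := mk_surjective a
    exact congrArg mk (dom_rng α)
  rng_rng a := by
    obtain ⟨α, rfl⟩ := mk_surjective a
    exact congrArg mk (rng_rng α)
  comp_dom a := by
    obtain ⟨α, rfl⟩ := mk_surjective a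
    exact (qcomp_mk (rng_dom α).symm _).trans (congrArg mk (comp_dom α))
  rng_comp_self a := by
    obtain ⟨α, rfl⟩ := mk_surjective a
    exact (qcomp_mk (dom_rng α) _).trans (congrArg mk (rng_comp_self α))
  dom_comp a b h := by
    obtain ⟨α, rfl⟩ := mk_surjective a
    obtain ⟨β, rfl⟩ := mk_surjective b
    rw [qcomp_mk (composable_of_mk h)]
    exact congrArg mk (dom_comp _ _ _)
  rng_comp a b h := by
    obtain ⟨α, rfl⟩ := mk_surjective a
    obtain ⟨β, rfl⟩ := mk_surjective b
    rw [qcomp_mk (composable_of_mk h)]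
    exact congrArg mk (rng_comp _ _ _)
  comp_assoc a b c h₁ h₂ := by
    obtain ⟨α, rfl⟩ := mk_surjective a
    obtain ⟨β, rfl⟩ := mk_surjective b
    obtain ⟨γ, rfl⟩ := mk_surjective c
    have k₁ := composable_of_mk h₁
    have k₂ := composable_of_mk h₂
    simp only [qcomp_mk k₁, qcomp_mk k₂]
    rw [qcomp_mk ((dom_comp _ _ _).trans k₂), qcomp_mk (k₁.trans (rng_comp _ _ _).symm),
      comp_assoc _ _ _ k₁ k₂]
  dom_inv a := by
    obtain ⟨α, rfl⟩ := mk_surjective a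
    exact congrArg mk (dom_inv α)
  rng_inv a := by
    obtain ⟨α, rfl⟩ := mk_surjective a
    exact congrArg mk (rng_inv α)
  inv_comp a := by
    obtain ⟨α, rfl⟩ := mk_surjective a
    exact (qcomp_mk (dom_inv α) _).trans (congrArg mk (inv_comp α))
  comp_inv a := by
    obtain ⟨α, rfl⟩ := mk_surjective a
    exact (qcomp_mk (rng_inv α).symm _).trans (congrArg mk (comp_inv α))

theorem dom_mk (α : G) : dom (mk α) = mk (dom α) := rfl

theorem rng_mk (α : G) : rng (mk α) = mk (rng α) := rfl

theorem inv_mk (α : G) : inv (mk α) = mk (inv α) := rfl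

theorem comp_mk {α β : G} (h : dom α = rng β) (h' : dom (mk α) = rng (mk β)) :
    comp (mk α) (mk β) h' = mk (comp α β h) := qcomp_mk h h'

theorem continuous_qdom : Continuous (dom : IsoQuotient G → IsoQuotient G) :=
  Continuous.quotient_lift (s := isoSetoid G) (f := fun α : G => mk (dom α))
    (continuous_mk.comp continuous_dom) _

theorem isOpenMap_qdom : IsOpenMap (dom : IsoQuotient G → IsoQuotient G) := by
  intro V hV
  have : (dom '' V : Set (IsoQuotient G)) = mk '' (dom '' (mk ⁻¹' V : Set G)) := by
    ext c
    constructor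
    · rintro ⟨a, ha, rfl⟩
      obtain ⟨α, rfl⟩ := mk_surjective a
      exact ⟨dom α, ⟨α, ha, rfl⟩, rfl⟩
    · rintro ⟨_, ⟨α, ha, rfl⟩, rfl⟩
      exact ⟨mk α, ha, rfl⟩
  rw [this]
  exact isOpenMap_mk _ (isOpenMap_dom _ (hV.preimage continuous_mk))

noncomputable instance : EtaleGroupoid (IsoQuotient G) where
  continuous_comp := by
    rw [continuous_def]
    intro W hW
    rw [isOpen_iff_mem_nhds]
    rintro ⟨⟨a, b⟩, h⟩ hm
    obtain ⟨α, rfl⟩ := mk_surjective a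
    obtain ⟨β, rfl⟩ := mk_surjective b
    have k := composable_of_mk h
    have hm' : comp α β k ∈ (mk ⁻¹' W : Set G) := by
      have : comp (mk α) (mk β) h ∈ W := hm
      rwa [comp_mk k] at this
    obtain ⟨A, B, hA, hB, ha, hb, hAB⟩ := exists_open_comp k (hW.preimage continuous_mk) hm'
    have hO : IsOpen ((mk '' A) ×ˢ (mk '' B) : Set (IsoQuotient G × IsoQuotient G)) :=
      (isOpenMap_mk _ hA).prod (isOpenMap_mk _ hB)
    refine Filter.mem_of_superset ((hO.preimage continuous_subtype_val).mem_nhds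
      ⟨⟨α, ha, rfl⟩, ⟨β, hb, rfl⟩⟩) ?_
    rintro ⟨⟨a', b'⟩, h'⟩ ⟨⟨α', ha', e1⟩, ⟨β', hb', e2⟩⟩
    dsimp only at e1 e2
    subst e1 e2
    have k' := composable_of_mk h'
    change comp (mk α') (mk β') h' ∈ W
    rw [comp_mk k']
    exact hAB _ ha' _ hb' k'
  continuous_inv :=
    Continuous.quotient_lift (s := isoSetoid G) (f := fun α : G => mk (inv α))
      (continuous_mk.comp continuous_inv) _
  isLocalHomeomorph_dom := by
    rw [isLocalHomeomorph_iff_isOpenEmbedding_restrict]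
    intro a
    obtain ⟨α, rfl⟩ := mk_surjective a
    obtain ⟨U, hU, hα, hinj⟩ := exists_injOn_dom α
    refine ⟨mk '' U, (isOpenMap_mk _ hU).mem_nhds ⟨α, hα, rfl⟩, ?_⟩
    refine IsOpenEmbedding.of_continuous_injective_isOpenMap ?_ ?_ ?_
    · exact (continuous_qdom.subtype_mk _).comp continuous_subtype_val
    · rintro ⟨_, u, hu, rfl⟩ ⟨_, v, hv, rfl⟩ huv
      have h1 : mk (dom u) = mk (dom v) := congrArg Subtype.val huv
      have : u = v := hinj hu hv (mk_dom_inj h1)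
      subst this
      rfl
    · exact (isOpenMap_qdom.subtype_mk _).comp (isOpenMap_mk _ hU).isOpenMap_subtype_val

theorem t2Space (hG : IsClosed (isoInt G)) [T2Space G] : T2Space (IsoQuotient G) := by
  have hq : IsOpenQuotientMap (mk : G → IsoQuotient G) :=
    ⟨mk_surjective, continuous_mk, isOpenMap_mk⟩
  rw [t2Space_iff_of_isOpenQuotientMap hq]
  have hD : IsClosed {p : G × G | dom p.1 = rng (inv p.2)} :=
    isClosed_eq (continuous_dom.comp continuous_fst)
      (continuous_rng.comp (continuous_inv.comp continuous_snd))
  have hc : Continuous fun p : {p : G × G | dom p.1 = rng (inv p.2)} =>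
      comp p.1.1 (inv p.1.2) p.2 :=
    (continuous_comp (G := G)).comp
      (((continuous_fst.comp continuous_subtype_val).prodMk
        (continuous_inv.comp (continuous_snd.comp continuous_subtype_val))).subtype_mk
          (fun p => p.2))
  have := hD.isClosedEmbedding_subtypeVal.isClosedMap _ (hG.preimage hc)
  convert this using 1
  ext ⟨α, β⟩
  constructor
  · intro h
    obtain ⟨h1, h2⟩ := mk_eq.1 (show mk α = mk β from h)
    exact ⟨⟨(α, β), h1.trans (rng_inv β).symm⟩, h2, rfl⟩
  · rintro ⟨⟨⟨a, b⟩, h⟩, h2, e⟩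
    dsimp only at e
    cases e
    exact mk_eq.2 ⟨h.trans (rng_inv β), h2⟩

theorem isLocalHomeomorph_mk : IsLocalHomeomorph (mk : G → IsoQuotient G) := by
  rw [isLocalHomeomorph_iff_isOpenEmbedding_restrict]
  intro α
  obtain ⟨U, hU, hα, hinj⟩ := exists_injOn_dom α
  refine ⟨U, hU.mem_nhds hα, ?_⟩
  refine IsOpenEmbedding.of_continuous_injective_isOpenMap
    (continuous_mk.comp continuous_subtype_val) ?_ (isOpenMap_mk.comp hU.isOpenMap_subtype_val)
  rintro ⟨u, hu⟩ ⟨v, hv⟩ huv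
  exact Subtype.ext (hinj hu hv (dom_eq_of_mk_eq huv))

end IsoQuotient

end Topology

section FibreSum

variable {X Y : Type*} [TopologicalSpace X] [TopologicalSpace Y]

theorem finite_fibre_inter {p : X → Y} (hp : IsLocalHomeomorph p) [T2Space Y] {K : Set X}
    (hK : IsCompact K) (y : Y) : (K ∩ p ⁻¹' {y}).Finite := by
  have hc : IsCompact (K ∩ p ⁻¹' {y}) := hK.inter_right (isClosed_singleton.preimage hp.continuous)
  refine hc.finite (isDiscrete_iff_discreteTopology.2 ?_)
  rw [discreteTopology_subtype_iff']
  rintro x ⟨hx, hxy⟩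
  obtain ⟨e, he, rfl⟩ := hp x
  refine ⟨e.source, e.open_source, ?_⟩
  ext z
  constructor
  · rintro ⟨hz, -, hzy⟩
    exact e.injOn hz he ((show e z = y from hzy).trans (show e x = y from hxy).symm)
  · rintro rfl
    exact ⟨he, hx, hxy⟩

theorem continuous_fibreSum {p : X → Y} (hp : IsLocalHomeomorph p) [T2Space X] [T2Space Y]
    {f : X → ℂ} (hf : Continuous f) (hs : HasCompactSupport f) :
    Continuous fun y : Y => ∑ᶠ x : {x : X // p x = y}, f x.1 := by
  classical
  rw [continuous_iff_continuousAt]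
  intro y
  set S := tsupport f ∩ p ⁻¹' {y} with hS
  have hfin : S.Finite := finite_fibre_inter hp hs y
  choose e he hep using hp
  obtain ⟨U, hU, hdisj⟩ := hfin.t2_separation
  set V : X → Set X := fun x => (e x).source ∩ U x with hV
  have hVo : ∀ x, IsOpen (V x) := fun x => (e x).open_source.inter (hU x).2
  have hxV : ∀ x, x ∈ V x := fun x => ⟨he x, (hU x).1⟩
  have hK' : IsCompact (tsupport f \ ⋃ x ∈ S, V x) :=
    IsCompact.diff hs (isOpen_biUnion fun x _ => hVo x)
  have hpc : Continuous p := by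
    rw [continuous_iff_continuousAt]
    intro x
    rw [hep x]
    exact (e x).continuousAt (he x)
  have hC : IsClosed (p '' (tsupport f \ ⋃ x ∈ S, V x)) := (hK'.image hpc).isClosed
  have hy : y ∉ p '' (tsupport f \ ⋃ x ∈ S, V x) := by
    rintro ⟨x, ⟨hx, hx'⟩, hxy⟩
    exact hx' (mem_biUnion (show x ∈ S from ⟨hx, hxy⟩) (hxV x))
  have hpS : ∀ x ∈ S, e x x = y := fun x hx => by rw [← hep x]; exact hx.2
  have hyt : ∀ x ∈ S, y ∈ (e x).target := fun x hx => by
    rw [← hpS x hx]; exact (e x).map_source (he x)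
  have hsy : ∀ x ∈ S, (e x).symm y = x := fun x hx => by
    rw [← hpS x hx]; exact (e x).left_inv (he x)
  have hcs : ∀ x ∈ S, ContinuousAt (e x).symm y := fun x hx =>
    (e x).symm.continuousAt (hyt x hx)
  have hev : ∀ᶠ z in 𝓝 y, z ∉ p '' (tsupport f \ ⋃ x ∈ S, V x) ∧
      ∀ x ∈ S, z ∈ (e x).target ∧ (e x).symm z ∈ V x := by
    refine Filter.Eventually.and (hC.isOpen_compl.mem_nhds hy) ?_
    rw [Filter.eventually_all_finite hfin]
    intro x hx
    refine Filter.Eventually.and ((e x).open_target.mem_nhds (hyt x hx)) ?_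
    refine (hcs x hx).eventually ((hVo x).mem_nhds ?_)
    rw [hsy x hx]
    exact hxV x
  have heq : (fun z => ∑ x ∈ hfin.toFinset, f ((e x).symm z)) =ᶠ[𝓝 y]
      fun z => ∑ᶠ x : {x : X // p x = z}, f x.1 := by
    filter_upwards [hev] with z hz
    obtain ⟨hz1, hz2⟩ := hz
    have hfz : ∀ x ∈ S, p ((e x).symm z) = z := fun x hx => by
      rw [hep x]; exact (e x).right_inv (hz2 x hx).1
    have key : (∑ᶠ x : {x : X // p x = z}, f x.1)
        = ∑ w ∈ hfin.toFinset.image (fun x => (e x).symm z), f w := by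
      refine (finsum_set_coe_eq_finsum_mem {x | p x = z}).trans ?_
      refine finsum_mem_eq_sum_of_inter_support_eq f ?_
      ext w
      simp only [mem_inter_iff, mem_ofPred_eq, Finset.coe_image, mem_image, Finite.mem_toFinset,
        Finset.mem_coe, Function.mem_support]
      constructor
      · rintro ⟨hw, hw0⟩
        refine ⟨?_, hw0⟩
        have hwt : w ∈ tsupport f := subset_tsupport f hw0
        by_contra hcon
        refine hz1 ⟨w, ⟨hwt, fun hmem => ?_⟩, hw⟩
        obtain ⟨x, hx, hwx⟩ := mem_iUnion₂.1 hmem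
        refine hcon ⟨x, hx, ?_⟩
        rw [← hw, hep x]
        exact (e x).left_inv hwx.1
      · rintro ⟨⟨x, hx, rfl⟩, hw0⟩
        exact ⟨hfz x hx, hw0⟩
    rw [key, Finset.sum_image]
    intro a ha b hb hab
    have ha' : a ∈ S := hfin.mem_toFinset.1 ha
    have hb' : b ∈ S := hfin.mem_toFinset.1 hb
    by_contra hne
    have hab' : (e a).symm z = (e b).symm z := hab
    exact (disjoint_left.1 (hdisj ha' hb' hne)) (hz2 a ha').2.2 (hab' ▸ (hz2 b hb').2.2)
  refine ContinuousAt.congr ?_ heq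
  refine tendsto_finsetSum _ fun x hx => ?_
  exact hf.continuousAt.comp (hcs x (hfin.mem_toFinset.1 hx))

theorem hasCompactSupport_fibreSum {p : X → Y} (hp : Continuous p) [T2Space Y]
    {f : X → ℂ} (hs : HasCompactSupport f) :
    HasCompactSupport fun y : Y => ∑ᶠ x : {x : X // p x = y}, f x.1 := by
  refine HasCompactSupport.intro (IsCompact.image hs hp) fun y hy => ?_
  refine finsum_eq_zero_of_forall_eq_zero fun x => ?_
  by_contra h
  exact hy ⟨x.1, subset_tsupport f h, x.2⟩

end FibreSum

section QuotientSum

variable {G : Type*} [TopologicalSpace G] [EtaleGroupoid G]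

/-- The map `φ_Q : C_c(G) → C_c(G / Iso(G)°)`, `φ_Q(f)(δ) = ∑_{Q(α) = δ} f(α)`. -/
noncomputable def quotientSum [T2Space G] (hG : IsClosed (isoInt G))
    (f : CompactlySupportedContinuousMap G ℂ) :
    CompactlySupportedContinuousMap (IsoQuotient G) ℂ where
  toFun δ := ∑ᶠ α : {α : G // IsoQuotient.mk α = δ}, f α.1
  continuous_toFun :=
    haveI := IsoQuotient.t2Space hG
    continuous_fibreSum IsoQuotient.isLocalHomeomorph_mk f.continuous f.hasCompactSupport
  hasCompactSupport' :=
    haveI := IsoQuotient.t2Space hG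
    hasCompactSupport_fibreSum IsoQuotient.continuous_mk f.hasCompactSupport

end QuotientSum

section Schur

/-- The Hilbert space `ℓ²(X)`. -/
abbrev Ell2 (X : Type*) : Type _ := lp (fun _ : X => ℂ) 2

theorem schur_bound {X : Type*} (k : X → X → ℂ) (n : ℕ) (C : ℝ) (hC : ∀ x y, ‖k x y‖ ≤ C)
    (hr : ∀ x, ∀ F : Finset X, (∀ y ∈ F, k x y ≠ 0) → F.card ≤ n)
    (hc : ∀ y, ∀ F : Finset X, (∀ x ∈ F, k x y ≠ 0) → F.card ≤ n) (ξ : Ell2 X) (S : Finset X) :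
    ∑ x ∈ S, ‖∑ᶠ y, k x y * ξ y‖ ^ 2 ≤ (n * C * ‖ξ‖) ^ 2 := by
  classical
  have hfin : ∀ x, {y | k x y ≠ 0}.Finite := fun x => by
    by_contra h
    obtain ⟨F, hF, hcard⟩ := Set.Infinite.exists_subset_card_eq h (n + 1)
    have := hr x F fun y hy => hF hy
    omega
  set R : X → Finset X := fun x => (hfin x).toFinset with hR
  have h0 : ∀ T : Finset X, ∑ y ∈ T, ‖ξ y‖ ^ 2 ≤ ‖ξ‖ ^ 2 := fun T => by
    have := lp.sum_rpow_le_norm_rpow (p := 2) (by norm_num) ξ T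
    simpa using this
  have h1 : ∀ x, ‖∑ᶠ y, k x y * ξ y‖ ^ 2 ≤ n * C ^ 2 * ∑ y ∈ R x, ‖ξ y‖ ^ 2 := fun x => by
    have e : ∑ᶠ y, k x y * ξ y = ∑ y ∈ R x, k x y * ξ y := by
      refine finsum_eq_sum_of_support_subset _ fun y hy => ?_
      simp only [hR, Finite.coe_toFinset, mem_ofPred_eq]
      exact left_ne_zero_of_mul hy
    have hcard : ((R x).card : ℝ) ≤ n := by
      exact_mod_cast hr x (R x) fun y hy => (hfin x).mem_toFinset.1 hy
    calc ‖∑ᶠ y, k x y * ξ y‖ ^ 2 ≤ (∑ y ∈ R x, ‖k x y * ξ y‖) ^ 2 := by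
          rw [e]; gcongr; exact norm_sum_le _ _
      _ ≤ (R x).card * ∑ y ∈ R x, ‖k x y * ξ y‖ ^ 2 := sq_sum_le_card_mul_sum_sq
      _ ≤ n * ∑ y ∈ R x, C ^ 2 * ‖ξ y‖ ^ 2 := by
          gcongr with y hy
          rw [norm_mul, mul_pow]
          gcongr
          exact hC x y
      _ = n * C ^ 2 * ∑ y ∈ R x, ‖ξ y‖ ^ 2 := by rw [← Finset.mul_sum]; ring
  set T := S.biUnion R with hT
  calc ∑ x ∈ S, ‖∑ᶠ y, k x y * ξ y‖ ^ 2
      ≤ ∑ x ∈ S, n * C ^ 2 * ∑ y ∈ R x, ‖ξ y‖ ^ 2 := Finset.sum_le_sum fun x _ => h1 x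
    _ = n * C ^ 2 * ∑ x ∈ S, ∑ y ∈ T with y ∈ R x, ‖ξ y‖ ^ 2 := by
        rw [← Finset.mul_sum]
        congr 1
        refine Finset.sum_congr rfl fun x hx => Finset.sum_congr ?_ fun _ _ => rfl
        ext y
        simp only [Finset.mem_filter, hT, Finset.mem_biUnion]
        exact ⟨fun h => ⟨⟨x, hx, h⟩, h⟩, fun h => h.2⟩
    _ = n * C ^ 2 * ∑ y ∈ T, ∑ x ∈ S with y ∈ R x, ‖ξ y‖ ^ 2 := by
        congr 1
        simp only [Finset.sum_filter]
        exact Finset.sum_comm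
    _ ≤ n * C ^ 2 * ∑ y ∈ T, n * ‖ξ y‖ ^ 2 := by
        gcongr with y hy
        rw [Finset.sum_const, nsmul_eq_mul]
        gcongr
        exact hc y _ fun x hx => (hfin x).mem_toFinset.1 (Finset.mem_filter.1 hx).2
    _ = (n * C) ^ 2 * ∑ y ∈ T, ‖ξ y‖ ^ 2 := by rw [← Finset.mul_sum]; ring
    _ ≤ (n * C) ^ 2 * ‖ξ‖ ^ 2 := by gcongr; exact h0 T
    _ = (n * C * ‖ξ‖) ^ 2 := by ring

end Schur

section ReducedAlgebra

theorem exists_card_le_of_injOn {G : Type*} [TopologicalSpace G] {p : G → G} (hp : ∀ α, ∃ U : Set G, IsOpen U ∧ α ∈ U ∧ InjOn p U)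
    {K : Set G} (hK : IsCompact K) : ∃ n : ℕ, ∀ F : Finset G, (∀ a ∈ F, a ∈ K) →
      (∀ a ∈ F, ∀ b ∈ F, p a = p b) → F.card ≤ n := by
  classical
  choose U hU hα hinj using hp
  obtain ⟨t, -, ht⟩ := hK.elim_nhds_subcover U fun α _ => (hU α).mem_nhds (hα α)
  refine ⟨t.card, fun F hF hp => ?_⟩
  have : ∀ a ∈ F, ∃ x ∈ t, a ∈ U x := fun a ha => by
    simpa using ht (hF a ha)
  choose! g hg hgU using this
  refine Finset.card_le_card_of_injOn g hg fun a ha b hb hab => ?_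
  exact hinj (g a) (hgU a ha) (hab ▸ hgU b hb) (hp a ha b hb)

variable {G : Type*} [TopologicalSpace G] [EtaleGroupoid G]

open scoped Classical in
/-- The matrix `(γ, β) ↦ f(γ β⁻¹)` if `d(γ) = d(β)`, and `0` otherwise. -/
noncomputable def convKernel (f : G → ℂ) (γ β : G) : ℂ :=
  if h : dom γ = dom β then f (comp γ (inv β) (h.trans (rng_inv β).symm)) else 0

theorem exists_convKernel_bounds (f : CompactlySupportedContinuousMap G ℂ) :
    ∃ (n : ℕ) (C : ℝ), 0 ≤ C ∧ (∀ γ β : G, ‖convKernel f γ β‖ ≤ C) ∧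
      (∀ γ, ∀ F : Finset G, (∀ β ∈ F, convKernel f γ β ≠ 0) → F.card ≤ n) ∧
      (∀ β, ∀ F : Finset G, (∀ γ ∈ F, convKernel f γ β ≠ 0) → F.card ≤ n) := by
  classical
  obtain ⟨C, hC⟩ := f.hasCompactSupport.exists_bound_of_continuous f.continuous
  have hK : IsCompact (tsupport f) := f.hasCompactSupport
  obtain ⟨n₁, h₁⟩ := exists_card_le_of_injOn exists_injOn_dom hK
  obtain ⟨n₂, h₂⟩ := exists_card_le_of_injOn exists_injOn_rng hK
  refine ⟨max n₁ n₂, max C 0, le_max_right _ _, fun γ β => ?_, fun γ F hF => ?_,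
    fun β F hF => ?_⟩
  · unfold convKernel
    split_ifs
    · exact (hC _).trans (le_max_left _ _)
    · simp
  · have hd : ∀ β ∈ F, ∃ h : dom γ = dom β,
        f (comp γ (inv β) (h.trans (rng_inv β).symm)) ≠ 0 := fun β hβ => by
      have := hF β hβ
      unfold convKernel at this
      split_ifs at this with h
      exacts [⟨h, this⟩, absurd rfl this]
    choose h h0 using hd
    refine le_trans ?_ (le_max_right n₁ n₂)
    let g : {β // β ∈ F} → G := fun β => comp γ (inv β.1) ((h β.1 β.2).trans (rng_inv β.1).symm)
    have hg : Function.Injective g := fun β β' e => by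
      have e1 : comp (inv γ) (g β) ((dom_inv _).trans (rng_comp _ _ _).symm) = inv β.1 :=
        inv_comp_comp _
      have e2 : comp (inv γ) (g β') ((dom_inv _).trans (rng_comp _ _ _).symm) = inv β'.1 :=
        inv_comp_comp _
      have : inv β.1 = inv β'.1 := by rw [← e1, ← e2]; exact comp_congr _ rfl e
      apply Subtype.ext
      rw [← ArrowGroupoid.inv_inv β.1, this, ArrowGroupoid.inv_inv]
    rw [← Finset.card_attach, ← Finset.card_image_of_injective _ hg]
    refine h₂ _ (fun a ha => ?_) fun a ha b hb => ?_
    · obtain ⟨β, -, rfl⟩ := Finset.mem_image.1 ha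
      exact subset_tsupport f (h0 β.1 β.2)
    · obtain ⟨β, -, rfl⟩ := Finset.mem_image.1 ha
      obtain ⟨β', -, rfl⟩ := Finset.mem_image.1 hb
      simp only [g, rng_comp]
  · have hd : ∀ γ ∈ F, ∃ h : dom γ = dom β,
        f (comp γ (inv β) (h.trans (rng_inv β).symm)) ≠ 0 := fun γ hγ => by
      have := hF γ hγ
      unfold convKernel at this
      split_ifs at this with h
      exacts [⟨h, this⟩, absurd rfl this]
    choose h h0 using hd
    refine le_trans ?_ (le_max_left n₁ n₂)
    let g : {γ // γ ∈ F} → G := fun γ => comp γ.1 (inv β) ((h γ.1 γ.2).trans (rng_inv β).symm)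
    have hg : Function.Injective g := fun γ γ' e =>
      Subtype.ext (comp_right_cancel _ _ e)
    rw [← Finset.card_attach, ← Finset.card_image_of_injective _ hg]
    refine h₁ _ (fun a ha => ?_) fun a ha b hb => ?_
    · obtain ⟨γ, -, rfl⟩ := Finset.mem_image.1 ha
      exact subset_tsupport f (h0 γ.1 γ.2)
    · obtain ⟨γ, -, rfl⟩ := Finset.mem_image.1 ha
      obtain ⟨γ', -, rfl⟩ := Finset.mem_image.1 hb
      simp only [g, dom_comp]

theorem finite_support_convKernel (f : CompactlySupportedContinuousMap G ℂ) (γ : G) (ξ : G → ℂ) :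
    (Function.support fun β => convKernel f γ β * ξ β).Finite := by
  obtain ⟨n, C, -, -, hr, -⟩ := exists_convKernel_bounds f
  by_contra h
  obtain ⟨F, hF, hcard⟩ := Set.Infinite.exists_subset_card_eq h (n + 1)
  have := hr γ F fun β hβ => left_ne_zero_of_mul (hF hβ)
  omega

theorem memℓp_conv (f : CompactlySupportedContinuousMap G ℂ) (ξ : Ell2 G) :
    Memℓp (fun γ : G => ∑ᶠ β, convKernel f γ β * ξ β) 2 := by
  obtain ⟨n, C, -, hC, hr, hc⟩ := exists_convKernel_bounds f
  refine memℓp_gen' (C := (n * C * ‖ξ‖) ^ 2) fun S => ?_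
  simpa using schur_bound _ n C hC hr hc ξ S

/-- The left regular representation of `C_c(G)` on `ℓ²(G) = ⨁ₓ ℓ²(G_x)`, the direct sum over
`x ∈ G⁽⁰⁾` of the representations `λ_x`:
`(λ(f) ξ)(γ) = ∑_{d(β) = d(γ)} f(γ β⁻¹) ξ(β)`, that is `λ(f) δ_β = ∑_{d(α) = r(β)} f(α) δ_{αβ}`.
In particular `‖λ(f)‖ = supₓ ‖λ_x(f)‖` is the reduced norm of `f`. -/
noncomputable def regRep (f : CompactlySupportedContinuousMap G ℂ) : Ell2 G →L[ℂ] Ell2 G :=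
  LinearMap.mkContinuousOfExistsBound
    { toFun := fun ξ => ⟨fun γ => ∑ᶠ β, convKernel f γ β * ξ β, memℓp_conv f ξ⟩
      map_add' := fun ξ η => by
        ext γ
        change ∑ᶠ β, convKernel f γ β * (ξ β + η β)
          = (∑ᶠ β, convKernel f γ β * ξ β) + ∑ᶠ β, convKernel f γ β * η β
        rw [← finsum_add_distrib (finite_support_convKernel f γ ξ)
          (finite_support_convKernel f γ η)]
        simp only [mul_add]
      map_smul' := fun c ξ => by
        ext γ
        change ∑ᶠ β, convKernel f γ β * (c * ξ β) = c * ∑ᶠ β, convKernel f γ β * ξ β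
        rw [mul_finsum]
        exact finsum_congr fun β => by ring }
    (by
      obtain ⟨n, C, hC0, hC, hr, hc⟩ := exists_convKernel_bounds f
      refine ⟨n * C, fun ξ => ?_⟩
      refine lp.norm_le_of_forall_sum_le (by norm_num) (by positivity) fun S => ?_
      simpa using schur_bound _ n C hC hr hc ξ S)

theorem regRep_apply (f : CompactlySupportedContinuousMap G ℂ) (ξ : Ell2 G) (γ : G) :
    regRep f ξ γ = ∑ᶠ β, convKernel f γ β * ξ β := rfl

/-- The reduced C*-algebra `C*_r(G)`: the C*-algebra of operators on `ℓ²(G) = ⨁ₓ ℓ²(G_x)`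
generated by the image of `C_c(G)` under the left regular representation. As this image is a
*-algebra, this is its norm closure, i.e. the completion of `C_c(G)` in the reduced norm. -/
noncomputable def reducedAlgebra (G : Type*) [TopologicalSpace G] [EtaleGroupoid G] :
    NonUnitalStarSubalgebra ℂ (Ell2 G →L[ℂ] Ell2 G) :=
  (NonUnitalStarAlgebra.adjoin ℂ
    (range (regRep : CompactlySupportedContinuousMap G ℂ → _))).topologicalClosure

/-- The canonical map `C_c(G) → C*_r(G)`. -/
noncomputable def ofCc (f : CompactlySupportedContinuousMap G ℂ) : reducedAlgebra G :=
  ⟨regRep f, subset_closure (NonUnitalStarAlgebra.subset_adjoin ℂ _ ⟨f, rfl⟩)⟩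

/-- `C_0(G⁽⁰⁾)` as a subset of `C*_r(G)`: the closure of `C_c(G⁽⁰⁾)`, the functions in `C_c(G)`
that vanish off the unit space. -/
noncomputable def diagonal (G : Type*) [TopologicalSpace G] [EtaleGroupoid G] :
    Set (reducedAlgebra G) :=
  closure (ofCc '' {f | ∀ γ, γ ∉ units G → f γ = 0})

/-- The map `φ_Q : C_c(G) → C_c(G / Iso(G)°)` extends to a *-homomorphism
`C*_r(G) → C*_r(G / Iso(G)°)`. -/
def QuotientSumExtends [T2Space G] (hG : IsClosed (isoInt G)) : Prop :=
  ∃ ψ : reducedAlgebra G →⋆ₙₐ[ℂ] reducedAlgebra (IsoQuotient G),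
    ∀ f : CompactlySupportedContinuousMap G ℂ, ψ (ofCc f) = ofCc (quotientSum hG f)

/-- Topological amenability: for every compact `K ⊆ G` and `ε > 0` there is a continuous system
`(m_x)` of probability measures on the (discrete) fibres `r⁻¹(x)`, given by a continuous density
`m : G → [0, ∞)`, with `‖α · m_{d(α)} - m_{r(α)}‖₁ < ε` for all `α ∈ K`. -/
def IsAmenable (G : Type*) [TopologicalSpace G] [EtaleGroupoid G] : Prop :=
  ∀ K : Set G, IsCompact K → ∀ ε : ℝ, 0 < ε → ∃ m : G → ℝ, Continuous m ∧ (∀ γ, 0 ≤ m γ) ∧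
    (∀ x ∈ units G, HasSum (fun γ : {γ : G // rng γ = x} => m γ.1) 1) ∧
    ∀ α ∈ K, ∑' β : {β : G // rng α = rng β},
      |m (comp (inv α) β.1 ((dom_inv α).trans β.2)) - m β.1| < ε

end ReducedAlgebra

/-- An isomorphism of étale groupoids: a homeomorphism that preserves domains, ranges and
products. -/
structure Iso (G H : Type*) [TopologicalSpace G] [EtaleGroupoid G] [TopologicalSpace H]
    [EtaleGroupoid H] extends G ≃ₜ H where
  map_dom : ∀ α, toFun (dom α) = dom (toFun α)
  map_rng : ∀ α, toFun (rng α) = rng (toFun α)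
  map_comp : ∀ α β (h : dom α = rng β), toFun (comp α β h) =
    comp (toFun α) (toFun β) ((map_dom α).symm.trans ((congrArg toFun h).trans (map_rng β)))

end EtaleGroupoid

/-! Part (1). An arrow `γ` of an étale groupoid acts near `d(γ)` by the germ of a partial
homeomorphism of the unit space. Two arrows have the same germ exactly when they agree modulo the
interior of the isotropy (`mk_eq_iff_germRel`), so the quotient is the groupoid of germs, and it
suffices to match germs of `G` with germs of `H`. By Gelfand duality, `φ` on the diagonals is
composition with a homeomorphism `h` from the units of `H` to those of `G`
(`exists_homeomorph_units`). If `n` is supported in a bisection and `d` is in the diagonal, then `n*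
d n` is in the diagonal. Evaluating its image under `φ` at a unit `x` gives `∑ d(h(r(η))) |φ(n)(η)|²
= ∑ d(r(γ)) |n(γ)|²`, with `d(η) = x` on the left and `d(γ) = h(x)` on the right
(`hasSum_column_of_isBisectional`). The right side has at most one nonzero term. Varying `d ≥ 0`
shows that wherever `φ(n)(η) ≠ 0`, the arrow of the bisection over `h(d(η))` exists and has range
`h(r(η))`. Hence the open sets `{n ≠ 0}` and `{φ(n) ≠ 0}` act by the same germs
(`germRel_of_coef_ne_zero`). Every `γ` has a partner because the two sums are equal. Every `η` has
one because `φ` is surjective and bisectional functions span `C_c(G)`. `nonempty_iso_of_germRel`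
concludes. Part (2). Write `Q` for the quotient groupoid. For each arrow `ε` of `Q`, the map `ξ ↦ (β
↦ ξ([β]ε))` intertwines convolution by `φ_Q(f)` with convolution by `f`, but it does not take values
in `ℓ²`. Weighting by the square root of a density `m` gives an isometry of `ℓ²(Q)` into a sum of
copies of `ℓ²(G)`. Its failure to intertwine is controlled by the non-invariance of `m`
(`exists_enorm_intertwiningDefect_sq_le`), so amenability makes it tend to `0`. Asymptotic
intertwining is stable under algebraic operations, adjoints and norm limits, and it determines the
second operator from the first. It is therefore the graph of a *-homomorphism
(`exists_starHom_of_starAsympIntertwines`). -/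

namespace EtaleGroupoid

/-- Shortcut for instance search. -/
noncomputable local instance {G : Type*} [TopologicalSpace G] [EtaleGroupoid G] :
    Module ℂ (reducedAlgebra G) :=
  (reducedAlgebra G).instModule

/-- Shortcut for instance search. -/
noncomputable local instance {G : Type*} [TopologicalSpace G] [EtaleGroupoid G] :
    SMul ℂ (reducedAlgebra G) :=
  DistribMulAction.toDistribSMul.toSMul

/-! ### Matrix entries of operators on `ℓ²(X)`. -/

section BasisVec

variable {X : Type*}

open scoped Classical in
/-- The standard basis vector `δ_x` of `ℓ²(X)`. -/
noncomputable def basisVec (x : X) : Ell2 X := lp.single 2 x 1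

open scoped Classical in
theorem basisVec_apply (x y : X) : basisVec x y = if y = x then 1 else 0 := by
  rw [basisVec, lp.single_apply, Pi.single_apply]

theorem norm_basisVec (x : X) : ‖basisVec x‖ = 1 := by
  classical
  rw [basisVec, lp.norm_single (by norm_num)]
  simp

theorem inner_basisVec_left (x : X) (ξ : Ell2 X) : inner ℂ (basisVec x) ξ = ξ x := by
  classical
  have := lp.inner_single_left (𝕜 := ℂ) (G := fun _ : X => ℂ) x (1 : ℂ) ξ
  rw [basisVec]
  convert this using 1
  simp

theorem norm_coord_le (ξ : Ell2 X) (x : X) : ‖ξ x‖ ≤ ‖ξ‖ :=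
  lp.norm_apply_le_norm (by norm_num) ξ x

theorem ext_basisVec {T S : Ell2 X →L[ℂ] Ell2 X}
    (h : ∀ x y, T (basisVec x) y = S (basisVec x) y) : T = S := by
  classical
  refine lp.ext_continuousLinearMap (by norm_num) fun x => ?_
  ext y
  have := h x y
  rw [basisVec] at this
  convert this using 1 <;> simp

theorem star_apply_basisVec (T : Ell2 X →L[ℂ] Ell2 X) (x y : X) :
    (star T) (basisVec x) y = star (T (basisVec y) x) := by
  rw [← inner_basisVec_left, ContinuousLinearMap.star_eq_adjoint,
    ContinuousLinearMap.adjoint_inner_right, ← inner_basisVec_left, ← inner_conj_symm]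
  rfl

end BasisVec

/-! ### The convolution *-algebra `C_c(G)` and its regular representation. -/

section Convolution

theorem comp_left_cancel {G : Type*} [ArrowGroupoid G] {α β β' : G} (h : dom α = rng β)
    (h' : dom α = rng β') (e : comp α β h = comp α β' h') : β = β' := by
  rw [← inv_comp_comp h, comp_congr _ rfl e, inv_comp_comp]

variable {G : Type*} [TopologicalSpace G] [EtaleGroupoid G]

theorem convKernel_of_eq (f : G → ℂ) {γ β : G} (h : dom γ = dom β) :
    convKernel f γ β = f (comp γ (inv β) (h.trans (rng_inv β).symm)) := dif_pos h

theorem convKernel_of_ne (f : G → ℂ) {γ β : G} (h : dom γ ≠ dom β) :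
    convKernel f γ β = 0 := dif_neg h

theorem dom_eq_of_convKernel_ne_zero {f : G → ℂ} {γ β : G} (h : convKernel f γ β ≠ 0) :
    dom γ = dom β := by
  by_contra h'
  exact h (convKernel_of_ne f h')

/-- The column of a unit recovers `f` from its operator, which motivates the definition of `coef`.
-/
theorem convKernel_dom (f : G → ℂ) (γ : G) : convKernel f γ (dom γ) = f γ := by
  rw [convKernel_of_eq f (dom_dom γ).symm]
  congr 1
  rw [comp_congr _ rfl (inv_unit (dom_dom γ)), comp_dom]

theorem regRep_basisVec (f : CompactlySupportedContinuousMap G ℂ) (β γ : G) :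
    regRep f (basisVec β) γ = convKernel f γ β := by
  classical
  rw [regRep_apply, finsum_eq_single _ β, basisVec_apply, if_pos rfl, mul_one]
  intro ζ h
  rw [basisVec_apply, if_neg h, mul_zero]

theorem regRep_add (f g : CompactlySupportedContinuousMap G ℂ) :
    regRep (f + g) = regRep f + regRep g := by
  refine ext_basisVec fun β γ => ?_
  rw [add_apply, lp.coeFn_add, Pi.add_apply]
  simp only [regRep_basisVec, convKernel, CompactlySupportedContinuousMap.add_apply]
  split_ifs <;> simp

theorem regRep_smul (c : ℂ) (f : CompactlySupportedContinuousMap G ℂ) :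
    regRep (c • f) = c • regRep f := by
  refine ext_basisVec fun β γ => ?_
  rw [smul_apply, lp.coeFn_smul, Pi.smul_apply]
  simp only [regRep_basisVec, convKernel, CompactlySupportedContinuousMap.smul_apply]
  split_ifs <;> simp

theorem regRep_zero : regRep (0 : CompactlySupportedContinuousMap G ℂ) = 0 := by
  simpa using regRep_smul 0 (0 : CompactlySupportedContinuousMap G ℂ)

theorem regRep_sum {ι : Type*} (s : Finset ι) (f : ι → CompactlySupportedContinuousMap G ℂ) :
    regRep (∑ i ∈ s, f i) = ∑ i ∈ s, regRep (f i) := by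
  classical
  induction s using Finset.induction_on with
  | empty => simp [regRep_zero]
  | insert i s hi ih => rw [Finset.sum_insert hi, Finset.sum_insert hi, regRep_add, ih]

/-- The inversion as a homeomorphism. -/
def invHomeomorph (G : Type*) [TopologicalSpace G] [EtaleGroupoid G] : G ≃ₜ G where
  toFun := inv
  invFun := inv
  left_inv := ArrowGroupoid.inv_inv
  right_inv := ArrowGroupoid.inv_inv
  continuous_toFun := continuous_inv
  continuous_invFun := continuous_inv

/-- The involution `f*(γ) = conj (f(γ⁻¹))` of `C_c(G)`. -/
noncomputable def ccStar (f : CompactlySupportedContinuousMap G ℂ) :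
    CompactlySupportedContinuousMap G ℂ where
  toFun γ := star (f (inv γ))
  continuous_toFun := (f.continuous.comp continuous_inv).star
  hasCompactSupport' := by
    have := f.hasCompactSupport.comp_homeomorph (invHomeomorph G)
    exact this.comp_left (g := star) (star_zero ℂ)

theorem ccStar_apply (f : CompactlySupportedContinuousMap G ℂ) (γ : G) :
    ccStar f γ = star (f (inv γ)) := rfl

theorem star_regRep (f : CompactlySupportedContinuousMap G ℂ) :
    star (regRep f) = regRep (ccStar f) := by
  refine ext_basisVec fun β γ => ?_
  rw [star_apply_basisVec, regRep_basisVec, regRep_basisVec]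
  by_cases h : dom γ = dom β
  · rw [convKernel_of_eq _ h, convKernel_of_eq _ h.symm, ccStar_apply, inv_comp_rev,
      comp_congr _ (ArrowGroupoid.inv_inv β) rfl]
  · rw [convKernel_of_ne _ h, convKernel_of_ne _ (Ne.symm h), star_zero]

variable (G) in
/-- The set of composable pairs. -/
abbrev Composable : Type _ := {p : G × G // dom p.1 = rng p.2}

/-- The multiplication on composable pairs. -/
def mulMap (p : Composable G) : G := comp p.1.1 p.1.2 p.2

theorem isOpenMap_mulMap : IsOpenMap (mulMap : Composable G → G) := by
  intro W hW
  obtain ⟨O, hO, rfl⟩ := isOpen_induced_iff.1 hW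
  rw [isOpen_iff_mem_nhds]
  rintro _ ⟨⟨⟨α, β⟩, h⟩, hm, rfl⟩
  obtain ⟨A, B, hA, hB, ha, hb, hAB⟩ := isOpen_prod_iff.1 hO α β hm
  refine Filter.mem_of_superset ((isOpen_setMul hA hB).mem_nhds ⟨α, ha, β, hb, h, rfl⟩) ?_
  rintro _ ⟨a, ha, b, hb, h, rfl⟩
  exact ⟨⟨(a, b), h⟩, hAB (mk_mem_prod ha hb), rfl⟩

/-- If `α` is confined to a set on which `r` is injective, then `αβ` determines `α` through `r(αβ) =
r(α)`, and `β` by cancellation. Convolution is thus a fibre sum along a local homeomorphism, and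
`continuous_fibreSum` applies to it. -/
theorem isLocalHomeomorph_mulMap : IsLocalHomeomorph (mulMap : Composable G → G) := by
  rw [isLocalHomeomorph_iff_isOpenEmbedding_restrict]
  rintro ⟨⟨α, β⟩, h⟩
  obtain ⟨U, hU, hα, hinj⟩ := exists_injOn_rng α
  have hO : IsOpen {p : Composable G | p.1.1 ∈ U} :=
    hU.preimage (continuous_fst.comp continuous_subtype_val)
  refine ⟨{p | p.1.1 ∈ U}, hO.mem_nhds hα, ?_⟩
  refine IsOpenEmbedding.of_continuous_injective_isOpenMap
    (continuous_comp.comp continuous_subtype_val) ?_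
    (isOpenMap_mulMap.comp hO.isOpenMap_subtype_val)
  rintro ⟨⟨⟨a, b⟩, h⟩, ha⟩ ⟨⟨⟨a', b'⟩, h'⟩, ha'⟩ e
  have e : comp a b h = comp a' b' h' := e
  obtain rfl : a = a' := hinj ha ha' (by rw [← rng_comp a b h, e, rng_comp])
  obtain rfl : b = b' := by
    exact comp_left_cancel h h' e
  rfl

/-- The function `(α, β) ↦ f(α) g(β)` on composable pairs. -/
noncomputable def tensorFun (f g : G → ℂ) (p : Composable G) : ℂ := f p.1.1 * g p.1.2

theorem hasCompactSupport_tensorFun [T2Space G] (f g : CompactlySupportedContinuousMap G ℂ) :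
    HasCompactSupport (tensorFun f g) := by
  have hD : IsClosed {p : G × G | dom p.1 = rng p.2} :=
    isClosed_eq (continuous_dom.comp continuous_fst) (continuous_rng.comp continuous_snd)
  have hK : IsCompact ((Subtype.val : Composable G → G × G) ⁻¹' (tsupport f ×ˢ tsupport g)) :=
    hD.isClosedEmbedding_subtypeVal.isCompact_preimage
      (IsCompact.prod f.hasCompactSupport g.hasCompactSupport)
  refine HasCompactSupport.intro hK fun p hp => ?_
  by_contra h
  exact hp ⟨subset_tsupport _ (left_ne_zero_of_mul h), subset_tsupport _ (right_ne_zero_of_mul h)⟩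

/-- The convolution product of `C_c(G)`. -/
noncomputable def ccConv [T2Space G] (f g : CompactlySupportedContinuousMap G ℂ) :
    CompactlySupportedContinuousMap G ℂ where
  toFun γ := ∑ᶠ p : {p : Composable G // mulMap p = γ}, tensorFun f g p.1
  continuous_toFun := continuous_fibreSum isLocalHomeomorph_mulMap
    ((f.continuous.comp (continuous_fst.comp continuous_subtype_val)).mul
      (g.continuous.comp (continuous_snd.comp continuous_subtype_val)))
    (hasCompactSupport_tensorFun f g)
  hasCompactSupport' :=
    hasCompactSupport_fibreSum continuous_comp (hasCompactSupport_tensorFun f g)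

theorem ccConv_apply [T2Space G] (f g : CompactlySupportedContinuousMap G ℂ) (γ : G) :
    ccConv f g γ = ∑ᶠ p : {p : Composable G // mulMap p = γ}, tensorFun f g p.1 := rfl

theorem comp_inv_comp_cancel {γ ζ β : G} (h : dom γ = dom ζ) (h' : dom ζ = dom β) :
    comp (comp γ (inv ζ) (h.trans (rng_inv ζ).symm))
      (comp ζ (inv β) (h'.trans (rng_inv β).symm)) (by rw [dom_comp, rng_comp, dom_inv])
      = comp γ (inv β) ((h.trans h').trans (rng_inv β).symm) := by
  rw [← comp_assoc _ _ _ (by rw [dom_comp, dom_inv]) (h'.trans (rng_inv β).symm),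
    comp_congr _ (comp_inv_cancel h) rfl]

/-- The arrows `ζ` with `d(ζ) = d(γ)` parametrize the factorizations of `γ β⁻¹`. -/
def factorEquiv {γ β : G} (h : dom γ = dom β) :
    {ζ : G // dom γ = dom ζ} ≃
      {p : Composable G // mulMap p = comp γ (inv β) (h.trans (rng_inv β).symm)} where
  toFun ζ := ⟨⟨(comp γ (inv ζ.1) (ζ.2.trans (rng_inv _).symm),
    comp ζ.1 (inv β) ((ζ.2.symm.trans h).trans (rng_inv _).symm)),
      by rw [dom_comp, rng_comp, dom_inv]⟩, comp_inv_comp_cancel ζ.2 (ζ.2.symm.trans h)⟩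
  invFun p := ⟨comp p.1.1.2 β (by
      have := congrArg dom p.2
      rwa [mulMap, dom_comp, dom_comp, dom_inv] at this), by rw [dom_comp, h]⟩
  left_inv ζ := Subtype.ext (comp_inv_cancel (ζ.2.symm.trans h))
  right_inv := by
    rintro ⟨⟨⟨α, δ⟩, hc⟩, hp⟩
    have hd : dom δ = rng β := by
      have := congrArg dom hp
      rwa [mulMap, dom_comp, dom_comp, dom_inv] at this
    have e2 : comp (comp δ β hd) (inv β) (by rw [dom_comp, rng_inv]) = δ := comp_comp_inv hd
    have hc' : dom α = rng δ := hc
    have hp' : comp α δ hc' = comp γ (inv β) (h.trans (rng_inv β).symm) := hp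
    have e3 : comp (comp γ (inv (comp δ β hd)) (by rw [rng_inv, dom_comp, h])) δ
        (by rw [dom_comp, dom_inv, rng_comp]) = comp α δ hc' := by
      rw [hp', ← comp_inv_comp_cancel (γ := γ) (ζ := comp δ β hd) (β := β)
        (by rw [dom_comp, h]) (dom_comp _ _ _)]
      exact comp_congr _ rfl e2.symm
    exact Subtype.ext (Subtype.ext (Prod.ext (comp_right_cancel _ _ e3) e2))

/-- The middle index `ζ` of the matrix product corresponds to the factorization `γβ⁻¹ =
(γζ⁻¹)(ζβ⁻¹)`, by `factorEquiv`. -/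
theorem convKernel_ccConv [T2Space G] (f g : CompactlySupportedContinuousMap G ℂ) (γ β : G) :
    convKernel (ccConv f g) γ β = ∑ᶠ ζ, convKernel f γ ζ * convKernel g ζ β := by
  by_cases h : dom γ = dom β
  · rw [convKernel_of_eq _ h, ccConv_apply,
      ← finsum_comp_equiv (factorEquiv h)]
    have hsupp : (Function.support fun ζ => convKernel f γ ζ * convKernel g ζ β)
        ⊆ {ζ | dom γ = dom ζ} := fun ζ hζ =>
      dom_eq_of_convKernel_ne_zero (left_ne_zero_of_mul hζ)
    rw [← Set.indicator_eq_self.2 hsupp, ← finsum_mem_def, ← finsum_set_coe_eq_finsum_mem]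
    refine finsum_congr fun ζ => ?_
    have hζ : dom γ = dom ζ.1 := ζ.2
    rw [convKernel_of_eq _ hζ, convKernel_of_eq _ (hζ.symm.trans h)]
    rfl
  · rw [convKernel_of_ne _ h, finsum_eq_zero_of_forall_eq_zero]
    intro ζ
    by_contra h'
    exact h ((dom_eq_of_convKernel_ne_zero (left_ne_zero_of_mul h')).trans
      (dom_eq_of_convKernel_ne_zero (right_ne_zero_of_mul h')))

theorem regRep_ccConv [T2Space G] (f g : CompactlySupportedContinuousMap G ℂ) :
    regRep (ccConv f g) = regRep f * regRep g := by
  refine ext_basisVec fun β γ => ?_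
  rw [mul_apply_eq_comp, regRep_apply f, regRep_basisVec, convKernel_ccConv]
  exact finsum_congr fun ζ => by rw [regRep_basisVec]

end Convolution

/-! ### Elements of `C*_r(G)` as continuous functions on `G`. -/

section Coefficients

variable {G : Type*} [TopologicalSpace G] [EtaleGroupoid G]

/-- The image of `C_c(G)` is already a *-algebra, through `ccConv` and `ccStar`, so generating a
*-algebra adds nothing before the closure. -/
theorem coe_reducedAlgebra [T2Space G] :
    (reducedAlgebra G : Set (Ell2 G →L[ℂ] Ell2 G)) =
      closure (range (regRep : CompactlySupportedContinuousMap G ℂ → _)) := by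
  have h : (NonUnitalStarAlgebra.adjoin ℂ
      (range (regRep : CompactlySupportedContinuousMap G ℂ → _)) : Set (Ell2 G →L[ℂ] Ell2 G))
      = range (regRep : CompactlySupportedContinuousMap G ℂ → _) := by
    refine Subset.antisymm (fun a ha => ?_) (NonUnitalStarAlgebra.subset_adjoin ℂ _)
    induction ha using NonUnitalStarAlgebra.adjoin_induction with
    | mem x hx => exact hx
    | add x y _ _ hx hy =>
      obtain ⟨f, rfl⟩ := hx
      obtain ⟨g, rfl⟩ := hy
      exact ⟨f + g, regRep_add f g⟩
    | zero => exact ⟨0, regRep_zero⟩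
    | mul x y _ _ hx hy =>
      obtain ⟨f, rfl⟩ := hx
      obtain ⟨g, rfl⟩ := hy
      exact ⟨ccConv f g, regRep_ccConv f g⟩
    | smul c x _ hx =>
      obtain ⟨f, rfl⟩ := hx
      exact ⟨c • f, regRep_smul c f⟩
    | star x _ hx =>
      obtain ⟨f, rfl⟩ := hx
      exact ⟨ccStar f, (star_regRep f).symm⟩
  rw [← h]
  rfl

theorem isClosed_reducedAlgebra :
    IsClosed (reducedAlgebra G : Set (Ell2 G →L[ℂ] Ell2 G)) :=
  NonUnitalStarSubalgebra.isClosed_topologicalClosure _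

/-- Closedness, supplied to instance search, makes both subalgebras C*-algebras, and *-homomorphisms
of C*-algebras are contractive. -/
theorem norm_starHom_apply_le {H : Type*} [TopologicalSpace H] [EtaleGroupoid H]
    (φ : reducedAlgebra G →⋆ₙₐ[ℂ] reducedAlgebra H) (a : reducedAlgebra G) : ‖φ a‖ ≤ ‖a‖ := by
  have := isClosed_reducedAlgebra (G := G)
  have := isClosed_reducedAlgebra (G := H)
  exact NonUnitalStarAlgHom.norm_apply_le φ a

theorem dense_range_ofCc [T2Space G] (a : reducedAlgebra G) :
    a ∈ closure (range (ofCc (G := G))) := by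
  rw [closure_subtype]
  have h : (a : Ell2 G →L[ℂ] Ell2 G) ∈ (reducedAlgebra G : Set _) := a.2
  rw [coe_reducedAlgebra] at h
  rwa [← range_comp]

theorem ofCc_add (f g : CompactlySupportedContinuousMap G ℂ) : ofCc (f + g) = ofCc f + ofCc g :=
  Subtype.ext (regRep_add f g)

theorem ofCc_smul (c : ℂ) (f : CompactlySupportedContinuousMap G ℂ) :
    ofCc (c • f) = c • ofCc f :=
  Subtype.ext (regRep_smul c f)

theorem ofCc_sum {ι : Type*} (s : Finset ι) (f : ι → CompactlySupportedContinuousMap G ℂ) :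
    ofCc (∑ i ∈ s, f i) = ∑ i ∈ s, ofCc (f i) := by
  apply Subtype.ext
  rw [AddSubmonoidClass.coe_finsetSum]
  exact regRep_sum s f

theorem star_ofCc (f : CompactlySupportedContinuousMap G ℂ) :
    star (ofCc f) = ofCc (ccStar f) :=
  Subtype.ext (star_regRep f)

theorem ofCc_mul [T2Space G] (f g : CompactlySupportedContinuousMap G ℂ) :
    ofCc f * ofCc g = ofCc (ccConv f g) :=
  Subtype.ext (regRep_ccConv f g).symm

/-- The column `a δ_β` of an element of the reduced algebra. -/
noncomputable def column (a : reducedAlgebra G) (β : G) : Ell2 G := a.1 (basisVec β)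

/-- The function on `G` defined by an element of the reduced algebra. -/
noncomputable def coef (a : reducedAlgebra G) (γ : G) : ℂ := column a (dom γ) γ

theorem norm_column_le (a : reducedAlgebra G) (β γ : G) : ‖column a β γ‖ ≤ ‖a‖ := by
  refine (norm_coord_le _ _).trans ((a.1.le_opNorm _).trans ?_)
  rw [norm_basisVec, mul_one]
  rfl

theorem norm_coef_le (a : reducedAlgebra G) (γ : G) : ‖coef a γ‖ ≤ ‖a‖ := norm_column_le _ _ _

theorem column_sub (a b : reducedAlgebra G) (β γ : G) :
    column (a - b) β γ = column a β γ - column b β γ := rfl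

theorem coef_add (a b : reducedAlgebra G) (γ : G) : coef (a + b) γ = coef a γ + coef b γ := rfl

theorem coef_sub (a b : reducedAlgebra G) (γ : G) : coef (a - b) γ = coef a γ - coef b γ := rfl

theorem coef_smul (c : ℂ) (a : reducedAlgebra G) (γ : G) : coef (c • a) γ = c * coef a γ := rfl

theorem coef_zero (γ : G) : coef (0 : reducedAlgebra G) γ = 0 := rfl

theorem coef_sum {ι : Type*} (s : Finset ι) (a : ι → reducedAlgebra G) (γ : G) :
    coef (∑ i ∈ s, a i) γ = ∑ i ∈ s, coef (a i) γ := by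
  classical
  induction s using Finset.induction_on with
  | empty => exact coef_zero γ
  | insert i s hi ih => rw [Finset.sum_insert hi, Finset.sum_insert hi, coef_add, ih]

theorem continuous_column (β γ : G) : Continuous fun a : reducedAlgebra G => column a β γ := by
  have : LipschitzWith 1 fun a : reducedAlgebra G => column a β γ := by
    refine LipschitzWith.of_dist_le_mul fun a b => ?_
    rw [dist_eq_norm, dist_eq_norm, ← column_sub, NNReal.coe_one, one_mul]
    exact norm_column_le _ _ _
  exact this.continuous

theorem continuous_coef_left (γ : G) : Continuous fun a : reducedAlgebra G => coef a γ :=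
  continuous_column _ _

theorem column_ofCc (f : CompactlySupportedContinuousMap G ℂ) (β γ : G) :
    column (ofCc f) β γ = convKernel f γ β := regRep_basisVec f β γ

theorem coef_ofCc (f : CompactlySupportedContinuousMap G ℂ) (γ : G) : coef (ofCc f) γ = f γ := by
  rw [coef, column_ofCc, convKernel_dom]

/-- A closed condition on `C*_r(G)` holds if it holds on `C_c(G)`. -/
theorem reducedAlgebra_induction [T2Space G] {p : reducedAlgebra G → Prop}
    (hp : IsClosed {a | p a}) (h : ∀ f, p (ofCc f)) (a : reducedAlgebra G) : p a :=
  closure_minimal (by rintro _ ⟨f, rfl⟩; exact h f) hp (dense_range_ofCc a)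

/-- Both sides are continuous in `a` and agree on `C_c(G)`. The whole matrix of `a` is therefore
determined by the function `coef a`, whence `ext_coef`. -/
theorem column_eq_convKernel [T2Space G] (a : reducedAlgebra G) (β γ : G) :
    column a β γ = convKernel (coef a) γ β := by
  induction a using reducedAlgebra_induction with
  | hp =>
    refine isClosed_eq (continuous_column β γ) ?_
    by_cases h : dom γ = dom β
    · simp only [convKernel_of_eq _ h]
      exact continuous_coef_left _
    · simp only [convKernel_of_ne _ h]
      exact continuous_const
  | h f =>
    rw [column_ofCc]
    congr 1
    exact funext fun γ => (coef_ofCc f γ).symm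

/-- The sup norm of `coef` is at most the operator norm, so `coef a` is a uniform limit of functions
in `C_c(G)`. -/
theorem continuous_coef [T2Space G] (a : reducedAlgebra G) : Continuous (coef a) := by
  rw [continuous_iff_continuousAt]
  intro γ
  rw [Metric.continuousAt_iff']
  intro ε hε
  obtain ⟨_, ⟨f, rfl⟩, hf⟩ := Metric.mem_closure_iff.1 (dense_range_ofCc a) (ε / 3) (by positivity)
  have h1 : ∀ γ, dist (coef a γ) (f γ) < ε / 3 := fun γ => by
    rw [← coef_ofCc f, dist_eq_norm, ← coef_sub]
    refine (norm_coef_le _ _).trans_lt ?_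
    rwa [← dist_eq_norm]
  filter_upwards [Metric.continuousAt_iff'.1 f.continuous.continuousAt (ε / 3) (by positivity)]
    with ζ hζ
  calc dist (coef a ζ) (coef a γ)
      ≤ dist (coef a ζ) (f ζ) + dist (f ζ) (f γ) + dist (f γ) (coef a γ) := dist_triangle4 _ _ _ _
    _ < ε / 3 + ε / 3 + ε / 3 := by
        have := h1 γ
        rw [dist_comm] at this
        gcongr
        exacts [h1 ζ, hζ]
    _ = ε := by ring

theorem ext_column {a b : reducedAlgebra G} (h : ∀ β γ, column a β γ = column b β γ) : a = b :=
  Subtype.ext (ext_basisVec h)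

theorem ext_coef [T2Space G] {a b : reducedAlgebra G} (h : ∀ γ, coef a γ = coef b γ) : a = b :=
  ext_column fun β γ => by rw [column_eq_convKernel, column_eq_convKernel, funext h]

theorem column_of_unit [T2Space G] (a : reducedAlgebra G) {x η : G} (h : dom η = x) :
    column a x η = coef a η := by
  rw [coef, h]

theorem column_of_ne [T2Space G] (a : reducedAlgebra G) {x η : G} (hx : dom x = x)
    (h : dom η ≠ x) : column a x η = 0 := by
  rw [column_eq_convKernel, convKernel_of_ne]
  rwa [hx]

end Coefficients

/-! ### The diagonal subalgebra and its normalizers. -/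

section Diagonal

variable {G : Type*} [TopologicalSpace G] [EtaleGroupoid G]

/-- The functions in `C_c(G)` that vanish off the unit space. -/
def VanishesOffUnits (f : G → ℂ) : Prop := ∀ γ, γ ∉ units G → f γ = 0

theorem ofCc_mem_diagonal {f : CompactlySupportedContinuousMap G ℂ} (hf : VanishesOffUnits f) :
    ofCc f ∈ diagonal G := subset_closure ⟨f, hf, rfl⟩

theorem diagonal_induction {p : reducedAlgebra G → Prop} (hp : IsClosed {a | p a})
    (h : ∀ f : CompactlySupportedContinuousMap G ℂ, VanishesOffUnits f → p (ofCc f))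
    {a : reducedAlgebra G}
    (ha : a ∈ diagonal G) : p a :=
  closure_minimal (by rintro _ ⟨f, hf, rfl⟩; exact h f hf) hp ha

theorem coef_eq_zero_of_notMem_units {e : reducedAlgebra G} (he : e ∈ diagonal G) {γ : G}
    (hγ : γ ∉ units G) : coef e γ = 0 := by
  refine diagonal_induction (isClosed_eq (continuous_coef_left γ) continuous_const)
    (fun f hf => ?_) he
  rw [coef_ofCc, hf γ hγ]

theorem ext_diagonal [T2Space G] {a b : reducedAlgebra G} (ha : a ∈ diagonal G)
    (hb : b ∈ diagonal G) (h : ∀ x ∈ units G, coef a x = coef b x) : a = b := by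
  refine ext_coef fun γ => ?_
  by_cases hγ : γ ∈ units G
  · exact h γ hγ
  · rw [coef_eq_zero_of_notMem_units ha hγ, coef_eq_zero_of_notMem_units hb hγ]

theorem eq_of_comp_inv_mem_units {γ β : G} (h : dom γ = dom β)
    (hu : comp γ (inv β) (h.trans (rng_inv β).symm) ∈ units G) : γ = β := by
  rw [← comp_inv_cancel h]
  exact unit_comp hu _

/-- The arrow `γβ⁻¹` is a unit only if `β = γ`, so the kernel is a diagonal matrix with entries
`f(γγ⁻¹) = f(r(γ))`. -/
theorem ofCc_apply_of_vanishesOffUnits {f : CompactlySupportedContinuousMap G ℂ}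
    (hf : VanishesOffUnits f) (ξ : Ell2 G) (γ : G) : (ofCc f).1 ξ γ = f (rng γ) * ξ γ := by
  change regRep f ξ γ = _
  rw [regRep_apply, finsum_eq_single _ γ, convKernel_of_eq _ rfl, comp_inv]
  intro β hβ
  rw [mul_eq_zero]
  left
  by_contra h
  have hd := dom_eq_of_convKernel_ne_zero h
  rw [convKernel_of_eq _ hd] at h
  refine hβ (eq_of_comp_inv_mem_units hd ?_).symm
  by_contra h'
  exact h (hf _ h')

theorem continuous_apply_coord (ξ : Ell2 G) (γ : G) :
    Continuous fun a : reducedAlgebra G => a.1 ξ γ := by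
  have h : Continuous fun η : Ell2 G => η γ := by
    have : LipschitzWith 1 fun η : Ell2 G => η γ := by
      refine LipschitzWith.of_dist_le_mul fun a b => ?_
      rw [dist_eq_norm, dist_eq_norm, NNReal.coe_one, one_mul]
      exact norm_coord_le (a - b) γ
    exact this.continuous
  exact h.comp ((ContinuousLinearMap.apply ℂ (Ell2 G) ξ).continuous.comp continuous_subtype_val)

theorem apply_of_mem_diagonal {e : reducedAlgebra G} (he : e ∈ diagonal G) (ξ : Ell2 G) (γ : G) :
    e.1 ξ γ = coef e (rng γ) * ξ γ := by
  refine diagonal_induction (p := fun e => e.1 ξ γ = coef e (rng γ) * ξ γ)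
    (isClosed_eq (continuous_apply_coord ξ γ)
      ((continuous_coef_left _).mul continuous_const)) (fun f hf => ?_) he
  rw [coef_ofCc]
  exact ofCc_apply_of_vanishesOffUnits hf ξ γ

theorem coef_mul_of_mem_diagonal {e : reducedAlgebra G} (he : e ∈ diagonal G)
    (b : reducedAlgebra G) (γ : G) : coef (e * b) γ = coef e (rng γ) * coef b γ :=
  apply_of_mem_diagonal he _ γ

/-- The coefficients of `b* e b` for a diagonal element `e`. -/
theorem hasSum_column_star_mul_mul {e : reducedAlgebra G} (he : e ∈ diagonal G)
    (b : reducedAlgebra G) (β γ : G) :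
    HasSum (fun η => coef e (rng η) * (column b β η * star (column b γ η)))
      (column (star b * (e * b)) β γ) := by
  have h1 : column (star b * (e * b)) β γ
      = inner ℂ (column b γ) (e.1 (column b β)) := by
    rw [← inner_basisVec_left γ]
    have : column (star b * (e * b)) β = (star b.1) (e.1 (column b β)) := rfl
    rw [this, ContinuousLinearMap.star_eq_adjoint, ContinuousLinearMap.adjoint_inner_right]
    rfl
  rw [h1]
  refine (lp.hasSum_inner (𝕜 := ℂ) (column b γ) (e.1 (column b β))).congr_fun fun η => ?_
  rw [apply_of_mem_diagonal he]
  simp only [RCLike.inner_apply, RCLike.star_def]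
  ring

/-- At a unit the sum has nonnegative weights, so for `e ≥ 0` no cancellation can occur; the
rigidity argument rests on this. -/
theorem hasSum_coef_star_mul_mul {e : reducedAlgebra G} (he : e ∈ diagonal G)
    (b : reducedAlgebra G) {x : G} (hx : x ∈ units G) :
    HasSum (fun η => coef e (rng η) * ((‖column b x η‖ ^ 2 : ℝ) : ℂ))
      (coef (star b * (e * b)) x) := by
  have hx : dom x = x := hx
  have := hasSum_column_star_mul_mul he b x x
  rw [coef, hx]
  convert this using 3 with η
  rw [RCLike.star_def, Complex.mul_conj, Complex.normSq_eq_norm_sq]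

/-- A function in `C_c(G)` that is supported in an open bisection normalizes the diagonal. -/
theorem star_mul_mul_mem_diagonal [T2Space G] {n d : CompactlySupportedContinuousMap G ℂ}
    (hn : InjOn rng (Function.support n)) (hd : VanishesOffUnits d) :
    star (ofCc n) * (ofCc d * ofCc n) ∈ diagonal G := by
  have h := hasSum_column_star_mul_mul (ofCc_mem_diagonal hd) (ofCc n)
  rw [star_ofCc, ofCc_mul, ofCc_mul] at h ⊢
  refine ofCc_mem_diagonal fun γ hγ => ?_
  rw [← coef_ofCc, coef]
  refine (h _ _).unique ?_
  convert hasSum_zero with η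
  by_contra h0
  have h1 := left_ne_zero_of_mul (right_ne_zero_of_mul h0)
  have h2 := right_ne_zero_of_mul (right_ne_zero_of_mul h0)
  rw [column_ofCc] at h1 h2
  replace h2 := star_ne_zero.1 h2
  have e1 := dom_eq_of_convKernel_ne_zero h1
  have e2 := dom_eq_of_convKernel_ne_zero h2
  rw [convKernel_of_eq _ e2] at h2
  have hd' : dom η = dom γ := e2
  rw [← hd', convKernel_dom] at h1
  -- A nonzero term at `η` puts both `ηγ⁻¹` and `η` in the support of `n`. They have the same range,
  -- so they coincide, and `γ` is a unit.
  have h3 := hn h2 h1 (rng_comp _ _ _)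
  refine hγ ?_
  have h4 : inv γ = dom η := by
    refine comp_left_cancel (e2.trans (rng_inv γ).symm) (rng_dom η).symm ?_
    rw [h3, comp_dom]
  rw [← ArrowGroupoid.inv_inv γ, h4, inv_unit (dom_dom η)]
  exact dom_dom η

end Diagonal

/-! ### Characters of `C_c(X)`. -/

section Characters

variable {X : Type*} [TopologicalSpace X]

/-- A function of compact support is a multiple of every function without zeros on its support. -/
theorem exists_mul_eq_of_ne_zero_on_tsupport (f d : CompactlySupportedContinuousMap X ℂ)
    (hd : ∀ x ∈ tsupport f, d x ≠ 0) : ∃ g, f = d * g := by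
  have hsupp : Function.support (fun x => f x / d x) ⊆ Function.support f := fun x hx hfx =>
    hx (by simp only [hfx, zero_div])
  have hts : tsupport (fun x => f x / d x) ⊆ tsupport f := closure_mono hsupp
  have hc : Continuous fun x => f x / d x := by
    refine continuous_of_tsupport fun x hx => ?_
    exact f.continuous.continuousAt.div d.continuous.continuousAt (hd x (hts hx))
  refine ⟨⟨⟨_, hc⟩, f.hasCompactSupport.of_isClosed_subset (isClosed_tsupport _) hts⟩, ?_⟩
  ext x
  rw [CompactlySupportedContinuousMap.mul_apply]
  change f x = d x * (f x / d x)
  by_cases hx : x ∈ tsupport f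
  · rw [mul_div_cancel₀ _ (hd x hx)]
  · rw [image_eq_zero_of_notMem_tsupport hx, zero_div, mul_zero]

variable [T2Space X] [LocallyCompactSpace X]

theorem exists_compactlySupported_one {x : X} {U : Set X} (hU : IsOpen U) (hx : x ∈ U) :
    ∃ f : CompactlySupportedContinuousMap X ℂ, f x = 1 ∧ tsupport f ⊆ U ∧
      ∀ y, ∃ t : ℝ, 0 ≤ t ∧ f y = t := by
  obtain ⟨f, hf1, hfc, hfU, hf⟩ := exists_continuousMap_one_of_isCompact_subset_isOpen
    (isCompact_singleton (x := x)) hU (singleton_subset_iff.2 hx)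
  have hsub : tsupport (fun y => (f y : ℂ)) ⊆ tsupport f :=
    closure_mono fun y hy h => hy (by simpa using h)
  refine ⟨⟨⟨fun y => (f y : ℂ), Complex.continuous_ofReal.comp f.continuous⟩,
    hfc.of_isClosed_subset (isClosed_tsupport _) hsub⟩, ?_, hsub.trans hfU,
    fun y => ⟨f y, (hf y).1, rfl⟩⟩
  have : f x = 1 := hf1 rfl
  change (f x : ℂ) = 1
  rw [this, Complex.ofReal_one]

/-- A nonzero multiplicative linear functional on `C_c(X)` is the evaluation at a point. -/
theorem exists_eq_eval (χ : CompactlySupportedContinuousMap X ℂ →ₗ[ℂ] ℂ)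
    (hmul : ∀ f g, χ (f * g) = χ f * χ g) (hχ : ∃ f, χ f ≠ 0) : ∃ y, ∀ f, χ f = f y := by
  obtain ⟨f₀, hf₀⟩ := hχ
  -- The kernel of `χ` has a common zero. Otherwise, by compactness, finitely many of its elements
  -- `d y` have no common zero on the support of `f₀`. Then `∑ |d y|²` divides `f₀` and lies in the
  -- kernel, which forces `χ f₀ = 0`.
  have key : ∃ y, ∀ d, χ d = 0 → d y = 0 := by
    by_contra! h
    choose d hχd hd using h
    have hK : IsCompact (tsupport f₀) := f₀.hasCompactSupport
    obtain ⟨t, -, ht⟩ := hK.elim_nhds_subcover (fun y => {x | d y x ≠ 0}) fun y _ =>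
      ((d y).continuous.isOpen_preimage _ isOpen_ne).mem_nhds (hd y)
    obtain ⟨g, hg⟩ := exists_mul_eq_of_ne_zero_on_tsupport f₀ (∑ y ∈ t, star (d y) * d y) (by
      intro x hx h0
      obtain ⟨y, hy, hxy⟩ := mem_iUnion₂.1 (ht hx)
      have h1 : (∑ y ∈ t, star (d y) * d y) x = ((∑ y ∈ t, Complex.normSq (d y x) : ℝ) : ℂ) := by
        rw [CompactlySupportedContinuousMap.sum_apply, Complex.ofReal_sum]
        refine Finset.sum_congr rfl fun y _ => ?_
        rw [CompactlySupportedContinuousMap.mul_apply, CompactlySupportedContinuousMap.star_apply,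
          Complex.normSq_eq_conj_mul_self]
        rfl
      rw [h1, Complex.ofReal_eq_zero,
        Finset.sum_eq_zero_iff_of_nonneg fun _ _ => Complex.normSq_nonneg _] at h0
      exact hxy (Complex.normSq_eq_zero.1 (h0 y hy)))
    refine hf₀ ?_
    rw [hg, hmul, map_sum, Finset.sum_eq_zero, zero_mul]
    intro y _
    rw [hmul, hχd, mul_zero]
  obtain ⟨y, hy⟩ := key
  -- The combination `χ(f₀) f - χ(f) f₀` lies in the kernel, so it vanishes at `y`. Thus `χ` is
  -- proportional to evaluation at `y`.
  have h1 : ∀ f, f y * χ f₀ = χ f * f₀ y := fun f => by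
    have := hy (χ f₀ • f - χ f • f₀) (by
      rw [map_sub, map_smul, map_smul, smul_eq_mul, smul_eq_mul, mul_comm, sub_self])
    rw [CompactlySupportedContinuousMap.sub_apply, CompactlySupportedContinuousMap.smul_apply,
      CompactlySupportedContinuousMap.smul_apply, smul_eq_mul, smul_eq_mul, sub_eq_zero] at this
    rw [mul_comm, this]
  obtain ⟨b, hb, -⟩ := exists_compactlySupported_one isOpen_univ (mem_univ y)
  have h2 := h1 b
  rw [hb, one_mul] at h2
  have hfy : f₀ y ≠ 0 := right_ne_zero_of_mul (h2 ▸ hf₀)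
  have h3 := h1 (f₀ * f₀)
  rw [hmul, CompactlySupportedContinuousMap.mul_apply] at h3
  -- Multiplicativity on `f₀²` forces the factor of proportionality to be `1`.
  have h4 : f₀ y = χ f₀ := by
    have : f₀ y * χ f₀ * f₀ y = f₀ y * χ f₀ * χ f₀ := by linear_combination h3
    exact mul_left_cancel₀ (mul_ne_zero hfy hf₀) this
  refine ⟨y, fun f => ?_⟩
  have := h1 f
  rw [h4] at this
  exact (mul_right_cancel₀ hf₀ this).symm

end Characters

/-! ### The homeomorphism of unit spaces dual to `φ` on the diagonals. -/

section Spectrum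

variable {G : Type*} [TopologicalSpace G] [EtaleGroupoid G]

theorem coef_mul_diagonal {a b : reducedAlgebra G} (ha : a ∈ diagonal G) (hb : b ∈ diagonal G)
    (γ : G) : coef (a * b) γ = coef a γ * coef b γ := by
  rw [coef_mul_of_mem_diagonal ha]
  by_cases h : γ ∈ units G
  · rw [rng_of_unit h]
  · rw [coef_eq_zero_of_notMem_units hb h, mul_zero, mul_zero]

/-- The elements of the diagonal vanish at infinity. -/
theorem exists_isCompact_norm_coef_lt {e : reducedAlgebra G} (he : e ∈ diagonal G) {ε : ℝ}
    (hε : 0 < ε) : ∃ K : Set G, IsCompact K ∧ ∀ x ∉ K, ‖coef e x‖ < ε := by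
  obtain ⟨_, ⟨f, hf, rfl⟩, hd⟩ := Metric.mem_closure_iff.1 he ε hε
  refine ⟨tsupport f, f.hasCompactSupport, fun x hx => ?_⟩
  have : coef e x = coef (e - ofCc f) x := by
    rw [coef_sub, coef_ofCc, image_eq_zero_of_notMem_tsupport hx, sub_zero]
  rw [this]
  refine (norm_coef_le _ _).trans_lt ?_
  rwa [← dist_eq_norm]

variable {H : Type*} [TopologicalSpace H] [EtaleGroupoid H]
  {φ : reducedAlgebra G →⋆ₙₐ[ℂ] reducedAlgebra H}

theorem continuous_starHom (φ : reducedAlgebra G →⋆ₙₐ[ℂ] reducedAlgebra H) : Continuous φ := by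
  have : LipschitzWith 1 φ := by
    refine LipschitzWith.of_dist_le_mul fun a b => ?_
    rw [dist_eq_norm, dist_eq_norm, NNReal.coe_one, one_mul, ← map_sub]
    exact norm_starHom_apply_le _ _
  exact this.continuous

variable [T2Space G]

theorem isClosed_units : IsClosed (units G) := isClosed_eq continuous_dom continuous_id

open scoped Classical in
/-- The restriction of a function to the unit space, extended by `0`. -/
noncomputable def resUnits (f : CompactlySupportedContinuousMap G ℂ) :
    CompactlySupportedContinuousMap G ℂ where
  toFun := (units G).indicator f
  continuous_toFun := f.continuous.indicator (by
    rw [IsClopen.frontier_eq ⟨isClosed_units, isOpen_units⟩]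
    simp)
  hasCompactSupport' := f.hasCompactSupport.mono' (by
    refine (Function.support_subset_iff'.2 fun x hx => ?_)
    rw [indicator_apply, image_eq_zero_of_notMem_tsupport hx, ite_self])

theorem resUnits_apply (f : CompactlySupportedContinuousMap G ℂ) (γ : G) :
    resUnits f γ = (units G).indicator f γ := rfl

theorem resUnits_of_mem (f : CompactlySupportedContinuousMap G ℂ) {γ : G} (h : γ ∈ units G) :
    resUnits f γ = f γ := indicator_of_mem h _

theorem vanishesOffUnits_resUnits (f : CompactlySupportedContinuousMap G ℂ) :
    VanishesOffUnits (resUnits f) := fun _ h => indicator_of_notMem h _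

theorem resUnits_eq_self {f : CompactlySupportedContinuousMap G ℂ} (hf : VanishesOffUnits f) :
    resUnits f = f := by
  ext γ
  by_cases h : γ ∈ units G
  · exact resUnits_of_mem f h
  · rw [hf γ h, vanishesOffUnits_resUnits f γ h]

/-- On the diagonal the product is pointwise. A character of the diagonal thus gives, through
`resUnits`, a multiplicative functional for the pointwise product of `C_c(G)`, as `exists_eq_eval`
requires. -/
theorem ofCc_resUnits_mul (f g : CompactlySupportedContinuousMap G ℂ) :
    ofCc (resUnits (f * g)) = ofCc (resUnits f) * ofCc (resUnits g) := by
  refine ext_coef fun γ => ?_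
  rw [coef_mul_diagonal (ofCc_mem_diagonal (vanishesOffUnits_resUnits f))
    (ofCc_mem_diagonal (vanishesOffUnits_resUnits g)), coef_ofCc, coef_ofCc, coef_ofCc]
  by_cases h : γ ∈ units G
  · simp only [resUnits_of_mem _ h, CompactlySupportedContinuousMap.mul_apply]
  · simp only [vanishesOffUnits_resUnits _ γ h, mul_zero]

variable [LocallyCompactSpace G]

theorem exists_diagonal_one {x : G} (hx : x ∈ units G) {U : Set G} (hU : IsOpen U) (hxU : x ∈ U) :
    ∃ d : CompactlySupportedContinuousMap G ℂ, VanishesOffUnits d ∧ d x = 1 ∧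
      (∀ y ∉ U, d y = 0) ∧ ∀ y, ∃ t : ℝ, 0 ≤ t ∧ d y = t := by
  obtain ⟨d, h1, h2, h3⟩ := exists_compactlySupported_one (hU.inter isOpen_units) ⟨hxU, hx⟩
  have h4 : ∀ y ∉ U ∩ units G, d y = 0 := fun y hy =>
    image_eq_zero_of_notMem_tsupport fun h => hy (h2 h)
  exact ⟨d, fun y hy => h4 y fun h => hy h.2, h1, fun y hy => h4 y fun h => hy h.1, h3⟩

variable [T2Space H] [LocallyCompactSpace H]

/-- The functional `f ↦ φ(f|units)(x)` is multiplicative, and nonzero because `φ` maps onto the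
diagonal of `H`. It is therefore an evaluation at some `y`, and `y` is a unit since the functional
sees only the restriction of `f` to the units. -/
theorem exists_point_of_bijOn_diagonal (hφ : BijOn φ (diagonal G) (diagonal H)) {x : H}
    (hx : x ∈ units H) :
    ∃ y ∈ units G, ∀ e ∈ diagonal G, coef (φ e) x = coef e y := by
  let χ : CompactlySupportedContinuousMap G ℂ →ₗ[ℂ] ℂ :=
    { toFun := fun f => coef (φ (ofCc (resUnits f))) x
      map_add' := fun f g => by
        have : resUnits (f + g) = resUnits f + resUnits g := by
          ext γ
          simp only [resUnits_apply, CompactlySupportedContinuousMap.add_apply,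
            CompactlySupportedContinuousMap.coe_add, indicator_add']
          rfl
        rw [this, ofCc_add, map_add, coef_add]
      map_smul' := fun c f => by
        have : resUnits (c • f) = c • resUnits f := by
          ext γ
          rw [CompactlySupportedContinuousMap.smul_apply, resUnits_apply, resUnits_apply,
            CompactlySupportedContinuousMap.coe_smul]
          exact congrFun (indicator_const_smul (units G) c f) γ
        rw [this, ofCc_smul, map_smul, coef_smul]
        rfl }
  have hχ : ∀ f, χ f = coef (φ (ofCc (resUnits f))) x := fun f => rfl
  have hcont : Continuous fun e => coef (φ e) x :=
    (continuous_coef_left x).comp (continuous_starHom φ)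
  obtain ⟨y, hy⟩ := exists_eq_eval χ (fun f g => by
      have hdiag := fun f : CompactlySupportedContinuousMap G ℂ =>
        hφ.1 (ofCc_mem_diagonal (vanishesOffUnits_resUnits f))
      rw [hχ, hχ, hχ, ofCc_resUnits_mul, map_mul, coef_mul_diagonal (hdiag f) (hdiag g)]) (by
    by_contra! h
    obtain ⟨b, hb, hb1, -⟩ := exists_diagonal_one hx isOpen_univ (mem_univ x)
    obtain ⟨e, he, hbe⟩ := hφ.2.2 (ofCc_mem_diagonal hb)
    have : coef (φ e) x = 0 := by
      refine diagonal_induction (p := fun e => coef (φ e) x = 0)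
        (isClosed_eq hcont continuous_const) (fun f hf => ?_) he
      rw [← resUnits_eq_self hf, ← hχ, h]
    rw [hbe, coef_ofCc, hb1] at this
    exact one_ne_zero this)
  have hyu : y ∈ units G := by
    by_contra h
    obtain ⟨b, hb1, -⟩ := exists_compactlySupported_one isOpen_univ (mem_univ y)
    have h1 : χ b = χ (resUnits b) := by
      rw [hχ, hχ, resUnits_eq_self (vanishesOffUnits_resUnits b)]
    rw [hy, hy, hb1, vanishesOffUnits_resUnits b y h] at h1
    exact one_ne_zero h1
  refine ⟨y, hyu, fun e he => ?_⟩
  refine diagonal_induction (p := fun e => coef (φ e) x = coef e y)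
    (isClosed_eq hcont (continuous_coef_left y)) (fun f hf => ?_) he
  rw [coef_ofCc, ← hy, hχ, resUnits_eq_self hf]

/-- A *-homomorphism that maps the diagonal bijectively onto the diagonal is given there by a
homeomorphism of the unit spaces. -/
theorem exists_homeomorph_units (hφ : BijOn φ (diagonal G) (diagonal H)) :
    ∃ h : units H ≃ₜ units G, ∀ (x : units H), ∀ e ∈ diagonal G,
      coef (φ e) (x : H) = coef e (h x : G) := by
  have hex : ∀ x : units H, ∃ y : units G, ∀ e ∈ diagonal G, coef (φ e) (x : H) = coef e (y : G) :=
    fun x => by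
      obtain ⟨y, hy, h⟩ := exists_point_of_bijOn_diagonal hφ x.2
      exact ⟨⟨y, hy⟩, h⟩
  choose h hh using hex
  -- Preimages under `φ` of bump functions on `H` separate points of the image of `h`. This yields
  -- injectivity and, once `h` is known to be surjective, openness.
  have hsep : ∀ (x : units H) {V : Set H}, IsOpen V → (x : H) ∈ V →
      ∃ d ∈ diagonal G, coef d (h x : G) = 1 ∧ ∀ x' : units H, (x' : H) ∉ V →
        coef d (h x' : G) = 0 := by
    intro x V hV hxV
    obtain ⟨e, he, he1, he0, -⟩ := exists_diagonal_one x.2 hV hxV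
    obtain ⟨d, hd, hde⟩ := hφ.2.2 (ofCc_mem_diagonal he)
    refine ⟨d, hd, ?_, fun x' hx' => ?_⟩
    · rw [← hh x d hd, hde, coef_ofCc, he1]
    · rw [← hh x' d hd, hde, coef_ofCc, he0 _ hx']
  have hinj : Function.Injective h := by
    intro x x' hxx
    by_contra hne
    obtain ⟨d, hd, h1, h0⟩ := hsep x (V := {(x' : H)}ᶜ) isOpen_compl_singleton
      (fun hmem => hne (Subtype.ext hmem))
    rw [hxx, h0 x' (by simp)] at h1
    exact zero_ne_one h1
  have hcont : Continuous h := by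
    rw [continuous_iff_continuousAt]
    intro x
    rw [ContinuousAt, Filter.tendsto_def]
    intro s hs
    obtain ⟨W, hWs, hW, hxW⟩ := mem_nhds_iff.1 hs
    obtain ⟨d, hd, hd1, hd0, -⟩ := exists_diagonal_one (h x).2
      (isOpen_units.isOpenMap_subtype_val W hW) ⟨h x, hxW, rfl⟩
    have hO : IsOpen {x' : units H | coef (φ (ofCc d)) (x' : H) ≠ 0} :=
      ((continuous_coef _).comp continuous_subtype_val).isOpen_preimage _ isOpen_ne
    refine Filter.mem_of_superset (hO.mem_nhds ?_) fun x' hx' => hWs ?_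
    · change coef (φ (ofCc d)) (x : H) ≠ 0
      rw [hh x _ (ofCc_mem_diagonal hd), coef_ofCc, hd1]
      exact one_ne_zero
    · have hx' : coef (φ (ofCc d)) (x' : H) ≠ 0 := hx'
      rw [hh x' _ (ofCc_mem_diagonal hd), coef_ofCc] at hx'
      obtain ⟨w, hw, hwx⟩ := not_imp_comm.1 (hd0 _) hx'
      rwa [← Subtype.ext hwx]
  have hsurj : Function.Surjective h := by
    intro y
    by_contra! hy
    obtain ⟨d, hd, hd1, -⟩ := exists_diagonal_one y.2 isOpen_univ (mem_univ (y : G))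
    -- Suppose `y` is not in the image of `h`. Since `φ(d)` is small off `K`, the image can meet
    -- `{|d| > 1/2}` only inside the compact set `h(K)`, which misses `y`. A bump `d'` at `y`,
    -- supported in `{|d| > 1/2}` and off `h(K)`, vanishes on the whole image. So `φ(d') = 0`,
    -- against injectivity on the diagonal.
    obtain ⟨K, hK, hKd⟩ := exists_isCompact_norm_coef_lt (hφ.1 (ofCc_mem_diagonal hd))
      (show (0 : ℝ) < 1 / 2 by norm_num)
    have hK' : IsClosed ((fun x => (h x : G)) '' (Subtype.val ⁻¹' K)) :=
      ((isClosed_units.isClosedEmbedding_subtypeVal.isCompact_preimage hK).image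
        (continuous_subtype_val.comp hcont)).isClosed
    have hU : IsOpen ({z | 1 / 2 < ‖d z‖} ∩ ((fun x => (h x : G)) '' (Subtype.val ⁻¹' K))ᶜ) :=
      (isOpen_lt continuous_const d.continuous.norm).inter hK'.isOpen_compl
    obtain ⟨d', hd', hd1', hd0', -⟩ := exists_diagonal_one y.2 hU ⟨by
      change 1 / 2 < ‖d y‖
      rw [hd1, norm_one]
      norm_num, by
      rintro ⟨x, -, hx⟩
      exact hy x (Subtype.ext hx)⟩
    have hzero : φ (ofCc d') = φ 0 := by
      rw [map_zero]
      refine ext_diagonal (hφ.1 (ofCc_mem_diagonal hd')) ?_ fun x hx => ?_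
      · have := hφ.1 (ofCc_mem_diagonal
          (f := (0 : CompactlySupportedContinuousMap G ℂ)) fun _ _ => rfl)
        rwa [show ofCc (0 : CompactlySupportedContinuousMap G ℂ) = 0 from
          Subtype.ext regRep_zero, map_zero] at this
      · rw [coef_zero, hh ⟨x, hx⟩ _ (ofCc_mem_diagonal hd'), coef_ofCc]
        refine hd0' _ fun hmem => ?_
        have h1 : 1 / 2 < ‖d (h ⟨x, hx⟩)‖ := hmem.1
        rw [← coef_ofCc d, ← hh ⟨x, hx⟩ _ (ofCc_mem_diagonal hd)] at h1
        refine hmem.2 ⟨⟨x, hx⟩, ?_, rfl⟩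
        by_contra hxK
        exact (hKd x hxK).not_gt h1
    have h0 : (0 : reducedAlgebra G) ∈ diagonal G := by
      rw [← show ofCc (0 : CompactlySupportedContinuousMap G ℂ) = 0 from Subtype.ext regRep_zero]
      exact ofCc_mem_diagonal fun _ _ => rfl
    have := hφ.2.1 (ofCc_mem_diagonal hd') h0 hzero
    rw [← coef_ofCc d', this, coef_zero] at hd1'
    exact zero_ne_one hd1'
  have hopen : IsOpenMap h := by
    intro V hV
    rw [isOpen_iff_mem_nhds]
    rintro _ ⟨x, hx, rfl⟩
    obtain ⟨d, hd, h1, h0⟩ := hsep x (isOpen_units.isOpenMap_subtype_val V hV) ⟨x, hx, rfl⟩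
    have hO : IsOpen {y : units G | coef d (y : G) ≠ 0} :=
      ((continuous_coef _).comp continuous_subtype_val).isOpen_preimage _ isOpen_ne
    refine Filter.mem_of_superset (hO.mem_nhds ?_) fun y hy => ?_
    · change coef d (h x : G) ≠ 0
      rw [h1]
      exact one_ne_zero
    · obtain ⟨x', rfl⟩ := hsurj y
      obtain ⟨w, hw, hwx⟩ := not_imp_comm.1 (h0 x') hy
      exact ⟨x', by rwa [← Subtype.ext hwx], rfl⟩
  exact ⟨(Equiv.ofBijective h ⟨hinj, hsurj⟩).toHomeomorphOfContinuousOpen hcont hopen, hh⟩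

end Spectrum

/-! ### The quotient by the interior of the isotropy as a groupoid of germs. -/

section GermRel

variable {G : Type*} [TopologicalSpace G] [EtaleGroupoid G]
  {H : Type*} [TopologicalSpace H] [EtaleGroupoid H]
  {K : Type*} [TopologicalSpace K] [EtaleGroupoid K]

/-- The domain map with values in the unit space. -/
def udom (γ : G) : units G := ⟨dom γ, dom_mem_units γ⟩

/-- The range map with values in the unit space. -/
def urng (γ : G) : units G := ⟨rng γ, dom_rng γ⟩

theorem udom_eq_urng {α β : G} : udom α = urng β ↔ dom α = rng β := Subtype.ext_iff

theorem udom_comp {α β : G} (h : dom α = rng β) : udom (comp α β h) = udom β :=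
  Subtype.ext (dom_comp α β h)

theorem urng_comp {α β : G} (h : dom α = rng β) : urng (comp α β h) = urng α :=
  Subtype.ext (rng_comp α β h)

theorem udom_of_unit (x : units G) : udom (x : G) = x := Subtype.ext x.2

theorem urng_of_unit (x : units G) : urng (x : G) = x := Subtype.ext (rng_of_unit x.2)

theorem continuous_udom : Continuous (udom : G → units G) := continuous_dom.subtype_mk _

theorem isOpenMap_udom : IsOpenMap (udom : G → units G) :=
  (isLocalHomeomorph_dom (G := G)).isOpenMap

/-- The arrows `γ` and `η` induce the same germ of a partial homeomorphism of the unit spaces, when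
these are identified by `h`. -/
def GermRel (h : units H → units G) (γ : G) (η : H) : Prop :=
  udom γ = h (udom η) ∧
    ∃ A B, IsOpen A ∧ IsOpen B ∧ γ ∈ A ∧ η ∈ B ∧
      ∀ u ∈ A, ∀ v ∈ B, udom u = h (udom v) → urng u = h (urng v)

theorem GermRel.urng_eq {h : units H → units G} {γ : G} {η : H} (hr : GermRel h γ η) :
    urng γ = h (urng η) := by
  obtain ⟨hd, A, B, -, -, hγ, hη, hAB⟩ := hr
  exact hAB γ hγ η hη hd

/-- The products `uv⁻¹` with `u` near `γ`, `v` near `γ'` and `d(u) = d(v)` form a neighbourhood of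
`γγ'⁻¹`. It consists of isotropy exactly when such `u` and `v` always have equal ranges. -/
theorem mk_eq_iff_germRel {γ γ' : G} :
    IsoQuotient.mk γ = IsoQuotient.mk γ' ↔ GermRel id γ γ' := by
  rw [IsoQuotient.mk_eq]
  constructor
  · rintro ⟨hd, hm⟩
    obtain ⟨A, B, hA, hB, hγ, hγ', hAB⟩ := exists_open_comp _ (isOpen_isoInt (G := G)) hm
    refine ⟨Subtype.ext hd, A, inv ⁻¹' B, hA, isOpen_image_inv hB, hγ, hγ', fun u hu v hv huv => ?_⟩
    have hd' : dom u = dom v := congrArg Subtype.val huv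
    have := dom_eq_rng_of_mem (hAB u hu (inv v) hv (hd'.trans (rng_inv v).symm))
    rw [dom_comp, rng_comp, dom_inv] at this
    exact Subtype.ext this.symm
  · rintro ⟨hd, A, B, hA, hB, hγ, hγ', hAB⟩
    have hd' : dom γ = dom γ' := congrArg Subtype.val hd
    refine ⟨hd', interior_maximal ?_ (isOpen_setMul hA (isOpen_image_inv hB))
      ⟨γ, hγ, inv γ', ?_, hd'.trans (rng_inv γ').symm, rfl⟩⟩
    · rintro _ ⟨a, ha, b, hb, h, rfl⟩
      have := hAB a ha (inv b) hb (Subtype.ext (h.trans (dom_inv b).symm))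
      have : rng a = rng (inv b) := congrArg Subtype.val this
      rw [rng_inv] at this
      change dom _ = rng _
      rw [dom_comp, rng_comp, this]
    · change inv (inv γ') ∈ B
      rwa [ArrowGroupoid.inv_inv]

theorem GermRel.comp {h : units H → units G} {k : units K → units H} (hk : Continuous k)
    {γ : G} {η : H} {ζ : K} (hr : GermRel h γ η) (kr : GermRel k η ζ) : GermRel (h ∘ k) γ ζ := by
  obtain ⟨hd, A, B, hA, hB, hγ, hη, hAB⟩ := hr
  obtain ⟨kd, B', C, hB', hC, hη', hζ, hBC⟩ := kr
  -- The neighbourhood of `ζ` is shrunk so that every `w` in it has an intermediate arrow `v ∈ B ∩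
  -- B'` over `k(d(w))`, through which ranges can be compared. It is open because `udom` is an open
  -- map.
  refine ⟨by rw [hd, kd]; rfl, A, C ∩ (k ∘ udom) ⁻¹' (udom '' (B ∩ B')), hA,
    hC.inter ((isOpenMap_udom _ (hB.inter hB')).preimage (hk.comp continuous_udom)), hγ,
    ⟨hζ, η, ⟨hη, hη'⟩, kd⟩, ?_⟩
  rintro u hu w ⟨hw, v, ⟨hv, hv'⟩, hvw⟩ huw
  rw [hAB u hu v hv (huw.trans (congrArg h hvw.symm)), hBC v hv' w hw hvw]
  rfl

theorem GermRel.symm {h : units H ≃ₜ units G} {γ : G} {η : H} (hr : GermRel h γ η) :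
    GermRel h.symm η γ := by
  obtain ⟨hd, A, B, hA, hB, hγ, hη, hAB⟩ := hr
  refine ⟨by rw [hd, h.symm_apply_apply], B, A, hB, hA, hη, hγ, fun u hu v hv huv => ?_⟩
  rw [hAB v hv u hu (by rw [huv, h.apply_symm_apply]), h.symm_apply_apply]

theorem germRel_of_units {h : units H → units G} {x : units G} {y : units H} (hxy : x = h y) :
    GermRel h (x : G) (y : H) := by
  refine ⟨by rw [udom_of_unit, udom_of_unit, hxy], units G, units H, isOpen_units, isOpen_units,
    x.2, y.2, fun u hu v hv huv => ?_⟩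
  have h1 := udom_of_unit ⟨u, hu⟩
  have h2 := udom_of_unit ⟨v, hv⟩
  have h3 := urng_of_unit ⟨u, hu⟩
  have h4 := urng_of_unit ⟨v, hv⟩
  dsimp only at h1 h2 h3 h4
  rw [h3, h4, ← h1, ← h2, huv]

theorem GermRel.dom_eq_rng {h : units H → units G} (hinj : Function.Injective h) {α β : G} {η ζ : H}
    (h₁ : GermRel h α η) (h₂ : GermRel h β ζ) (hc : dom α = rng β) : dom η = rng ζ := by
  rw [← udom_eq_urng] at hc ⊢
  exact hinj (by rw [← h₁.1, hc, h₂.urng_eq])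

theorem GermRel.mul {h : units H → units G} {α β : G} {η ζ : H}
    (h₁ : GermRel h α η) (h₂ : GermRel h β ζ) (hc : dom α = rng β) (hc' : dom η = rng ζ) :
    GermRel h (ArrowGroupoid.comp α β hc) (ArrowGroupoid.comp η ζ hc') := by
  obtain ⟨hd₁, A₁, B₁, hA₁, hB₁, hα, hη, hAB₁⟩ := h₁
  obtain ⟨hd₂, A₂, B₂, hA₂, hB₂, hβ, hζ, hAB₂⟩ := h₂
  refine ⟨by rw [udom_comp, udom_comp, hd₂], setMul A₁ A₂, setMul B₁ B₂, isOpen_setMul hA₁ hA₂,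
    isOpen_setMul hB₁ hB₂, ⟨α, hα, β, hβ, hc, rfl⟩, ⟨η, hη, ζ, hζ, hc', rfl⟩, ?_⟩
  rintro _ ⟨a, ha, b, hb, hab, rfl⟩ _ ⟨a', ha', b', hb', hab', rfl⟩ he
  rw [udom_comp, udom_comp] at he
  rw [urng_comp, urng_comp]
  refine hAB₁ a ha a' ha' ?_
  rw [udom_eq_urng.2 hab, udom_eq_urng.2 hab', hAB₂ b hb b' hb' he]

/-- The map of the quotients that is given by a correspondence of germs. -/
theorem exists_continuous_of_germRel (h : units H ≃ₜ units G)
    (htot : ∀ γ : G, ∃ η : H, GermRel h γ η) :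
    ∃ F : IsoQuotient G → IsoQuotient H, Continuous F ∧
      ∀ γ η, GermRel h γ η → F (IsoQuotient.mk γ) = IsoQuotient.mk η := by
  choose g hg using htot
  -- The class of the partner depends only on the class of `γ`: the germs from `η` to `γ` to `γ'` to
  -- `η'` compose to one over `h⁻¹ ∘ h = id`.
  have key : ∀ γ γ' η η', IsoQuotient.mk γ = IsoQuotient.mk γ' → GermRel h γ η → GermRel h γ' η' →
      IsoQuotient.mk η = IsoQuotient.mk η' := by
    intro γ γ' η η' hγ h1 h2
    rw [mk_eq_iff_germRel] at hγ ⊢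
    have := (h1.symm.comp continuous_id hγ).comp h.continuous h2
    convert this using 1
    funext x
    exact (h.symm_apply_apply x).symm
  let F : IsoQuotient G → IsoQuotient H := fun a =>
    Quotient.lift (s := isoSetoid G) (fun γ : G => IsoQuotient.mk (g γ))
      (fun γ γ' hγ => key γ γ' _ _ (Quotient.sound (s := isoSetoid G) hγ) (hg γ) (hg γ')) a
  have hF : ∀ γ η, GermRel h γ η → F (IsoQuotient.mk γ) = IsoQuotient.mk η :=
    fun γ η hr => key γ γ _ _ rfl (hg γ) hr
  refine ⟨F, ?_, hF⟩
  refine Continuous.quotient_lift (s := isoSetoid G) ?_ _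
  rw [continuous_iff_continuousAt]
  intro γ
  rw [ContinuousAt, Filter.tendsto_def]
  intro W hW
  obtain ⟨V, hVW, hV, hmV⟩ := mem_nhds_iff.1 hW
  obtain ⟨hd, A, B, hA, hB, hγ, hη, hAB⟩ := hg γ
  have hO : IsOpen (A ∩ udom ⁻¹' (h '' (udom '' (B ∩ IsoQuotient.mk ⁻¹' V)))) :=
    hA.inter ((h.isOpenMap _ (isOpenMap_udom _
      (hB.inter (hV.preimage IsoQuotient.continuous_mk)))).preimage continuous_udom)
  refine Filter.mem_of_superset (hO.mem_nhds ⟨hγ, _, ⟨g γ, ⟨hη, hmV⟩, rfl⟩, hd.symm⟩) ?_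
  rintro u ⟨hu, _, ⟨v, ⟨hv, hvV⟩, rfl⟩, huv⟩
  refine hVW ?_
  change IsoQuotient.mk (g u) ∈ V
  -- The sets `A` and `B` that match `γ` with `g γ` also match `u` with `v`. So `v` may replace the
  -- chosen partner `g u`, which need not depend continuously on `u`.
  rw [key u u (g u) v rfl (hg u) ⟨huv.symm, A, B, hA, hB, hu, hv, hAB⟩]
  exact hvV

/-- A correspondence of germs gives an isomorphism of the quotients by the interior of the
isotropy. -/
theorem nonempty_iso_of_germRel (h : units H ≃ₜ units G)
    (htot : ∀ γ : G, ∃ η : H, GermRel h γ η) (hsurj : ∀ η : H, ∃ γ : G, GermRel h γ η) :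
    Nonempty (Iso (IsoQuotient G) (IsoQuotient H)) := by
  obtain ⟨F, hFc, hF⟩ := exists_continuous_of_germRel h htot
  obtain ⟨F', hFc', hF'⟩ := exists_continuous_of_germRel h.symm
    (fun η => (hsurj η).imp fun _ hr => hr.symm)
  have hdom : ∀ a, F (dom a) = dom (F a) := by
    intro a
    obtain ⟨γ, rfl⟩ := IsoQuotient.mk_surjective a
    obtain ⟨η, hr⟩ := htot γ
    rw [hF γ η hr]
    exact hF _ _ (germRel_of_units hr.1)
  have hrng : ∀ a, F (rng a) = rng (F a) := by
    intro a
    obtain ⟨γ, rfl⟩ := IsoQuotient.mk_surjective a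
    obtain ⟨η, hr⟩ := htot γ
    rw [hF γ η hr]
    exact hF _ _ (germRel_of_units hr.urng_eq)
  refine ⟨{ toFun := F, invFun := F', left_inv := ?_, right_inv := ?_, continuous_toFun := hFc,
            continuous_invFun := hFc', map_dom := hdom, map_rng := hrng, map_comp := ?_ }⟩
  · intro a
    obtain ⟨γ, rfl⟩ := IsoQuotient.mk_surjective a
    obtain ⟨η, hr⟩ := htot γ
    rw [hF γ η hr, hF' η γ hr.symm]
  · intro b
    obtain ⟨η, rfl⟩ := IsoQuotient.mk_surjective b
    obtain ⟨γ, hr⟩ := hsurj η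
    rw [hF' η γ hr.symm, hF γ η hr]
  · intro a b hab
    obtain ⟨α, rfl⟩ := IsoQuotient.mk_surjective a
    obtain ⟨β, rfl⟩ := IsoQuotient.mk_surjective b
    have hc := IsoQuotient.composable_of_mk hab
    obtain ⟨η, hη⟩ := htot α
    obtain ⟨ζ, hζ⟩ := htot β
    have hc' := hη.dom_eq_rng h.injective hζ hc
    change F (ArrowGroupoid.comp (IsoQuotient.mk α) (IsoQuotient.mk β) hab)
      = ArrowGroupoid.comp (F (IsoQuotient.mk α)) (F (IsoQuotient.mk β)) _
    rw [IsoQuotient.comp_mk hc, hF _ _ (hη.mul hζ hc hc'),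
      comp_congr _ (hF α η hη) (hF β ζ hζ), IsoQuotient.comp_mk hc']

end GermRel

/-! ### Functions supported in bisections span `C_c(G)`. -/

section Bisections

variable {G : Type*} [TopologicalSpace G] [EtaleGroupoid G]

/-- A function that is supported in a bisection. -/
def IsBisectional (n : G → ℂ) : Prop :=
  InjOn dom (Function.support n) ∧ InjOn rng (Function.support n)

theorem exists_isOpen_bisection (γ : G) :
    ∃ U : Set G, IsOpen U ∧ γ ∈ U ∧ InjOn dom U ∧ InjOn rng U := by
  obtain ⟨U, hU, hγ, h⟩ := exists_injOn_dom γ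
  obtain ⟨V, hV, hγ', h'⟩ := exists_injOn_rng γ
  exact ⟨U ∩ V, hU.inter hV, ⟨hγ, hγ'⟩, h.mono inter_subset_left, h'.mono inter_subset_right⟩

variable [T2Space G] [LocallyCompactSpace G]

theorem exists_isBisectional (γ : G) :
    ∃ n : CompactlySupportedContinuousMap G ℂ, n γ ≠ 0 ∧ IsBisectional n := by
  obtain ⟨U, hU, hγ, h, h'⟩ := exists_isOpen_bisection γ
  obtain ⟨n, h1, hn, -⟩ := exists_compactlySupported_one hU hγ
  have hs : Function.support n ⊆ U := (subset_tsupport n).trans hn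
  exact ⟨n, by rw [h1]; exact one_ne_zero, h.mono hs, h'.mono hs⟩

/-- Multiply `f` by a partition of unity subordinate to a finite cover of its support by open
bisections. -/
theorem exists_sum_isBisectional (f : CompactlySupportedContinuousMap G ℂ) :
    ∃ (k : ℕ) (n : Fin k → CompactlySupportedContinuousMap G ℂ),
      (∀ i, IsBisectional (n i)) ∧ f = ∑ i, n i := by
  choose U hU hγ h h' using exists_isOpen_bisection (G := G)
  have hK : IsCompact (tsupport f) := f.hasCompactSupport
  obtain ⟨t, -, ht⟩ := hK.elim_nhds_subcover U fun γ _ => (hU γ).mem_nhds (hγ γ)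
  obtain ⟨p, hp, hsum, -⟩ := exists_continuous_sum_one_of_isOpen_isCompact
    (s := fun i : Fin t.card => U (t.equivFin.symm i)) (fun i => hU _) hK (by
      refine ht.trans fun x hx => ?_
      obtain ⟨y, hy, hxy⟩ := mem_iUnion₂.1 hx
      refine mem_iUnion.2 ⟨t.equivFin ⟨y, hy⟩, ?_⟩
      rwa [Equiv.symm_apply_apply])
  let n : Fin t.card → CompactlySupportedContinuousMap G ℂ := fun i =>
    ⟨⟨fun x => (p i x : ℂ) * f x, (Complex.continuous_ofReal.comp (p i).continuous).mul
      f.continuous⟩, f.hasCompactSupport.mul_left⟩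
  have hn : ∀ i x, n i x = (p i x : ℂ) * f x := fun i x => rfl
  have hs : ∀ i, Function.support (n i) ⊆ U (t.equivFin.symm i) := fun i x hx => by
    refine hp i (subset_tsupport _ fun h0 => hx ?_)
    rw [hn, h0, Complex.ofReal_zero, zero_mul]
  refine ⟨t.card, n, fun i => ⟨(h _).mono (hs i), (h' _).mono (hs i)⟩, ?_⟩
  ext x
  rw [CompactlySupportedContinuousMap.sum_apply]
  simp only [hn]
  rw [← Finset.sum_mul, ← Complex.ofReal_sum]
  by_cases hx : x ∈ tsupport f
  · have := hsum hx
    rw [Finset.sum_apply, Pi.one_apply] at this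
    rw [this, Complex.ofReal_one, one_mul]
  · rw [image_eq_zero_of_notMem_tsupport hx, mul_zero]

end Bisections

/-! ### `φ` matches germs of `G` with germs of `H`. -/

section Rigidity

variable {G : Type*} [TopologicalSpace G] [EtaleGroupoid G] [T2Space G]
  {H : Type*} [TopologicalSpace H] [EtaleGroupoid H]
  {φ : reducedAlgebra G →⋆ₙₐ[ℂ] reducedAlgebra H} {h : units H → units G}

theorem eq_zero_of_hasSum_zero {ι : Type*} {d : ι → ℂ} (hd : ∀ i, ∃ t : ℝ, 0 ≤ t ∧ d i = t)
    {s : ι → ℝ} (hs : ∀ i, 0 ≤ s i) (h : HasSum (fun i => d i * (s i : ℂ)) 0) (i : ι) :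
    d i * (s i : ℂ) = 0 := by
  choose t ht hdt using hd
  have h' : HasSum (fun i => ((t i * s i : ℝ) : ℂ)) ((0 : ℝ) : ℂ) := by
    refine h.congr_fun fun i => ?_
    rw [hdt, Complex.ofReal_mul]
  have h0 := (hasSum_zero_iff_of_nonneg fun i => mul_nonneg (ht i) (hs i)).1
    (Complex.hasSum_ofReal.1 h')
  rw [hdt, ← Complex.ofReal_mul]
  exact_mod_cast congrFun h0 i

/-- The sums expand `φ(n)* φ(d) φ(n)` at `x` and `n* d n` at `h(x)`. The element `n* d n` is in the
diagonal because `n` is bisectional, so `hh` equates the two values. -/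
theorem hasSum_column_of_isBisectional (hφ : MapsTo φ (diagonal G) (diagonal H))
    (hh : ∀ (x : units H), ∀ e ∈ diagonal G, coef (φ e) (x : H) = coef e (h x : G))
    {n : CompactlySupportedContinuousMap G ℂ} (hn : IsBisectional n)
    {d : CompactlySupportedContinuousMap G ℂ} (hd : VanishesOffUnits d) (x : units H) :
    ∃ z, HasSum (fun η : H => d (h (urng η)) *
        ((‖column (φ (ofCc n)) (x : H) η‖ ^ 2 : ℝ) : ℂ)) z ∧
      HasSum (fun γ : G => d (rng γ) * ((‖column (ofCc n) (h x : G) γ‖ ^ 2 : ℝ) : ℂ)) z := by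
  have hdiag := ofCc_mem_diagonal hd
  refine ⟨coef (star (ofCc n) * (ofCc d * ofCc n)) (h x : G), ?_, ?_⟩
  · rw [← hh x _ (star_mul_mul_mem_diagonal hn.2 hd), map_mul, map_mul, map_star]
    refine (hasSum_coef_star_mul_mul (hφ hdiag) (φ (ofCc n)) x.2).congr_fun fun η => ?_
    rw [← coef_ofCc d, ← hh _ _ hdiag]
    rfl
  · refine (hasSum_coef_star_mul_mul hdiag (ofCc n) (h x).2).congr_fun fun γ => ?_
    rw [coef_ofCc]

theorem column_ofCc_ne_zero {n : CompactlySupportedContinuousMap G ℂ} {x : units G} {γ : G}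
    (hc : column (ofCc n) (x : G) γ ≠ 0) : udom γ = x ∧ n γ ≠ 0 := by
  have hx : dom (x : G) = x := x.2
  have hd : dom γ = x := by
    by_contra hne
    exact hc (column_of_ne _ hx hne)
  rw [column_of_unit _ hd, coef_ofCc] at hc
  exact ⟨Subtype.ext hd, hc⟩

variable [LocallyCompactSpace G]

/-- Otherwise some `d ≥ 0` in the diagonal is `1` at `h(r(η))` and vanishes at the ranges of all
arrows of the support of `n` over `h(d(η))`. The sum over `G` is then `0`, hence so is each term of
the sum over `H`, and the term at `η` gives `φ(n)(η) = 0`. -/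
theorem exists_of_coef_ne_zero [T2Space H] (hφ : MapsTo φ (diagonal G) (diagonal H))
    (hh : ∀ (x : units H), ∀ e ∈ diagonal G, coef (φ e) (x : H) = coef e (h x : G))
    {n : CompactlySupportedContinuousMap G ℂ} (hn : IsBisectional n) {η : H}
    (hη : coef (φ (ofCc n)) η ≠ 0) :
    ∃ γ, n γ ≠ 0 ∧ udom γ = h (udom η) ∧ urng γ = h (urng η) := by
  by_contra! hcon
  -- As `n` is bisectional, there is at most one range to avoid, and a set with at most one point is
  -- closed.
  have hS : (rng '' {γ | n γ ≠ 0 ∧ udom γ = h (udom η)}).Subsingleton := by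
    rintro _ ⟨γ, ⟨h1, h2⟩, rfl⟩ _ ⟨γ', ⟨h1', h2'⟩, rfl⟩
    rw [hn.1 h1 h1' (congrArg Subtype.val (h2.trans h2'.symm))]
  obtain ⟨d, hd, hd1, hd0, hpos⟩ := exists_diagonal_one (h (urng η)).2 hS.isClosed.isOpen_compl (by
    rintro ⟨γ, ⟨h1, h2⟩, h3⟩
    exact hcon γ h1 h2 (Subtype.ext h3))
  obtain ⟨z, hz, hz'⟩ := hasSum_column_of_isBisectional hφ hh hn hd (udom η)
  have hz0 : z = 0 := by
    refine hz'.unique ?_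
    convert hasSum_zero with γ
    by_contra hne
    have hc := column_ofCc_ne_zero fun h0 => right_ne_zero_of_mul hne (by rw [h0]; simp)
    exact left_ne_zero_of_mul hne (hd0 _ fun hmem => hmem ⟨γ, ⟨hc.2, hc.1⟩, rfl⟩)
  rw [hz0] at hz
  have := eq_zero_of_hasSum_zero (fun i => hpos _) (fun i => sq_nonneg _) hz η
  rw [hd1, one_mul, Complex.ofReal_eq_zero, sq_eq_zero_iff, norm_eq_zero] at this
  exact hη this

/-- Take `d ≥ 0` with `d(r(γ)) = 1` in the same identity. If `φ(n)` vanished on the whole fibre over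
`x`, both sums would be `0`, and the term at `γ` would give `n(γ) = 0`. -/
theorem exists_coef_ne_zero [T2Space H] (hφ : MapsTo φ (diagonal G) (diagonal H))
    (hh : ∀ (x : units H), ∀ e ∈ diagonal G, coef (φ e) (x : H) = coef e (h x : G))
    {n : CompactlySupportedContinuousMap G ℂ} (hn : IsBisectional n) {γ : G} (hγ : n γ ≠ 0)
    {x : units H} (hx : udom γ = h x) : ∃ η, udom η = x ∧ coef (φ (ofCc n)) η ≠ 0 := by
  by_contra! hcon
  obtain ⟨d, hd, hd1, -, hpos⟩ := exists_diagonal_one (urng γ).2 isOpen_univ (mem_univ _)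
  obtain ⟨z, hz, hz'⟩ := hasSum_column_of_isBisectional hφ hh hn hd x
  have hz0 : z = 0 := by
    refine hz.unique ?_
    convert hasSum_zero with η
    have hxd : dom (x : H) = x := x.2
    by_cases hη : dom η = x
    · rw [column_of_unit _ hη, hcon η (Subtype.ext hη)]
      simp
    · rw [column_of_ne _ hxd hη]
      simp
  rw [hz0] at hz'
  have := eq_zero_of_hasSum_zero (fun i => hpos _) (fun i => sq_nonneg _) hz' γ
  have hd1 : d (rng γ) = 1 := hd1
  rw [hd1, one_mul, Complex.ofReal_eq_zero, sq_eq_zero_iff, norm_eq_zero,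
    column_of_unit _ (congrArg Subtype.val hx), coef_ofCc] at this
  exact hγ this

/-- The open sets where `n` and `φ(n)` do not vanish witness the germ. Over `h(d(v))` the support of
`n` contains just one arrow, and `exists_of_coef_ne_zero` gives its range. -/
theorem germRel_of_coef_ne_zero [T2Space H] (hφ : MapsTo φ (diagonal G) (diagonal H))
    (hh : ∀ (x : units H), ∀ e ∈ diagonal G, coef (φ e) (x : H) = coef e (h x : G))
    {n : CompactlySupportedContinuousMap G ℂ} (hn : IsBisectional n) {γ : G} {η : H}
    (hγ : n γ ≠ 0) (hη : coef (φ (ofCc n)) η ≠ 0) (hd : udom γ = h (udom η)) :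
    GermRel h γ η := by
  refine ⟨hd, {u | n u ≠ 0}, {v | coef (φ (ofCc n)) v ≠ 0},
    n.continuous.isOpen_preimage _ isOpen_ne, (continuous_coef _).isOpen_preimage _ isOpen_ne,
    hγ, hη, fun u hu v hv huv => ?_⟩
  obtain ⟨u', hu', hd', hr'⟩ := exists_of_coef_ne_zero hφ hh hn hv
  rw [hn.1 hu hu' (congrArg Subtype.val (huv.trans hd'.symm)), hr']

theorem nonempty_iso_isoQuotient [T2Space H] [LocallyCompactSpace H]
    (hs : Function.Surjective φ) (hφ : BijOn φ (diagonal G) (diagonal H)) :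
    Nonempty (Iso (IsoQuotient G) (IsoQuotient H)) := by
  obtain ⟨h, hh⟩ := exists_homeomorph_units hφ
  refine nonempty_iso_of_germRel h (fun γ => ?_) fun η => ?_
  · obtain ⟨n, hγ, hn⟩ := exists_isBisectional γ
    obtain ⟨η, hd, hη⟩ := exists_coef_ne_zero hφ.1 hh hn hγ (h.apply_symm_apply (udom γ)).symm
    refine ⟨η, germRel_of_coef_ne_zero hφ.1 hh hn hγ hη ?_⟩
    rw [hd, h.apply_symm_apply]
  · obtain ⟨e, he, -⟩ := exists_compactlySupported_one isOpen_univ (mem_univ η)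
    obtain ⟨a, ha⟩ := hs (ofCc e)
    -- Vanishing at `η` is a closed condition, so if it held on `φ(C_c(G))` it would hold on all of
    -- `C*_r(H)`, although `e` is `1` at `η`.
    obtain ⟨f, hf⟩ : ∃ f, coef (φ (ofCc f)) η ≠ 0 := by
      by_contra! hcon
      have : coef (φ a) η = 0 := reducedAlgebra_induction (p := fun a => coef (φ a) η = 0)
        (isClosed_eq ((continuous_coef_left η).comp (continuous_starHom φ)) continuous_const)
        hcon a
      rw [ha, coef_ofCc, he] at this
      exact one_ne_zero this
    obtain ⟨k, n, hn, rfl⟩ := exists_sum_isBisectional f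
    rw [ofCc_sum, map_sum, coef_sum] at hf
    obtain ⟨i, -, hi⟩ := Finset.exists_ne_zero_of_sum_ne_zero hf
    obtain ⟨γ, hγ, hd, -⟩ := exists_of_coef_ne_zero hφ.1 hh (hn i) hi
    exact ⟨γ, germRel_of_coef_ne_zero hφ.1 hh (hn i) hγ hi hd⟩

end Rigidity

/-! ### Homomorphisms from asymptotically intertwining isometries. -/

section AsymptoticIntertwining

open Filter

variable {E E' L : Type*} [NormedAddCommGroup E] [InnerProductSpace ℂ E]
  [NormedAddCommGroup E'] [InnerProductSpace ℂ E']
  [NormedAddCommGroup L] [InnerProductSpace ℂ L]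
  {ι : Type*} {F : Filter ι} {ρ : (E →L[ℂ] E) →ₙₐ[ℂ] (L →L[ℂ] L)} {V : ι → E' →ₗᵢ[ℂ] L}

/-- The difference `ρ(a) V - V b`. -/
noncomputable def intertwiningDefect (ρ : (E →L[ℂ] E) →ₙₐ[ℂ] (L →L[ℂ] L)) (V : E' →ₗᵢ[ℂ] L)
    (a : E →L[ℂ] E) (b : E' →L[ℂ] E') : E' →L[ℂ] L :=
  ρ a ∘L V.toContinuousLinearMap - V.toContinuousLinearMap ∘L b

/-- The isometries `V i` intertwine `b` and `ρ(a)` asymptotically. -/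
def AsympIntertwines (F : Filter ι) (ρ : (E →L[ℂ] E) →ₙₐ[ℂ] (L →L[ℂ] L))
    (V : ι → E' →ₗᵢ[ℂ] L) (a : E →L[ℂ] E) (b : E' →L[ℂ] E') : Prop :=
  Tendsto (fun i => intertwiningDefect ρ (V i) a b) F (𝓝 0)

theorem intertwiningDefect_apply (V : E' →ₗᵢ[ℂ] L) (a : E →L[ℂ] E) (b : E' →L[ℂ] E') (ξ : E') :
    intertwiningDefect ρ V a b ξ = ρ a (V ξ) - V (b ξ) := rfl

theorem AsympIntertwines.zero : AsympIntertwines F ρ V 0 0 := by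
  refine tendsto_const_nhds.congr fun i => ?_
  ext ξ
  simp [intertwiningDefect_apply]

theorem AsympIntertwines.add {a a' : E →L[ℂ] E} {b b' : E' →L[ℂ] E'}
    (h : AsympIntertwines F ρ V a b) (h' : AsympIntertwines F ρ V a' b') :
    AsympIntertwines F ρ V (a + a') (b + b') := by
  have := Tendsto.add h h'
  rw [add_zero] at this
  refine this.congr fun i => ?_
  ext ξ
  simp only [intertwiningDefect_apply, map_add, add_apply]
  abel

theorem AsympIntertwines.smul (c : ℂ) {a : E →L[ℂ] E} {b : E' →L[ℂ] E'}
    (h : AsympIntertwines F ρ V a b) : AsympIntertwines F ρ V (c • a) (c • b) := by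
  have := Tendsto.const_smul h c
  rw [smul_zero] at this
  refine this.congr fun i => ?_
  ext ξ
  simp only [intertwiningDefect_apply, map_smul, smul_apply, smul_sub]

theorem AsympIntertwines.mul {a a' : E →L[ℂ] E} {b b' : E' →L[ℂ] E'}
    (h : AsympIntertwines F ρ V a b) (h' : AsympIntertwines F ρ V a' b') :
    AsympIntertwines F ρ V (a * a') (b * b') := by
  -- The defect of a product obeys a Leibniz rule: `ρ(aa')V - Vbb' = ρ(a)(ρ(a')V - Vb') + (ρ(a)V -
  -- Vb)b'`.
  have h1 : Tendsto (fun i => ρ a ∘L intertwiningDefect ρ (V i) a' b') F (𝓝 (ρ a ∘L 0)) :=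
    ((ContinuousLinearMap.compL ℂ E' L L (ρ a)).continuous.tendsto 0).comp h'
  have h2 : Tendsto (fun i => intertwiningDefect ρ (V i) a b ∘L b') F (𝓝 (0 ∘L b')) :=
    (((ContinuousLinearMap.compL ℂ E' E' L).flip b').continuous.tendsto 0).comp h
  have := h1.add h2
  rw [ContinuousLinearMap.comp_zero, ContinuousLinearMap.zero_comp, add_zero] at this
  refine this.congr fun i => ?_
  ext ξ
  simp only [intertwiningDefect_apply, map_mul, add_apply, mul_apply_eq_comp,
    ContinuousLinearMap.comp_apply, map_sub]
  abel

/-- As `V` is isometric, `‖bξ‖ = ‖Vbξ‖`, and `Vbξ` differs from `ρ(a)Vξ` by the defect. This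
contraction estimate gives both the uniqueness of `b` and the extension to norm limits. -/
theorem AsympIntertwines.norm_le [F.NeBot] (hρ : ∀ a, ‖ρ a‖ ≤ ‖a‖) {a : E →L[ℂ] E}
    {b : E' →L[ℂ] E'} (h : AsympIntertwines F ρ V a b) : ‖b‖ ≤ ‖a‖ := by
  have h1 : ∀ i, ‖b‖ ≤ ‖intertwiningDefect ρ (V i) a b‖ + ‖a‖ := fun i => by
    refine b.opNorm_le_bound (by positivity) fun ξ => ?_
    have e : V i (b ξ) = ρ a (V i ξ) - intertwiningDefect ρ (V i) a b ξ := by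
      rw [intertwiningDefect_apply, sub_sub_cancel]
    calc ‖b ξ‖ = ‖V i (b ξ)‖ := ((V i).norm_map _).symm
      _ ≤ ‖ρ a (V i ξ)‖ + ‖intertwiningDefect ρ (V i) a b ξ‖ := by rw [e]; exact norm_sub_le _ _
      _ ≤ ‖a‖ * ‖ξ‖ + ‖intertwiningDefect ρ (V i) a b‖ * ‖ξ‖ := by
        gcongr
        · refine ((ρ a).le_opNorm _).trans ?_
          rw [(V i).norm_map]
          gcongr
          exact hρ a
        · exact ContinuousLinearMap.le_opNorm _ _
      _ = _ := by ring
  have h2 : Tendsto (fun i => ‖intertwiningDefect ρ (V i) a b‖ + ‖a‖) F (𝓝 (0 + ‖a‖)) := by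
    have := (Tendsto.norm h).add_const ‖a‖
    rwa [norm_zero] at this
  rw [zero_add] at h2
  exact ge_of_tendsto' h2 h1

theorem AsympIntertwines.sub {a a' : E →L[ℂ] E} {b b' : E' →L[ℂ] E'}
    (h : AsympIntertwines F ρ V a b) (h' : AsympIntertwines F ρ V a' b') :
    AsympIntertwines F ρ V (a - a') (b - b') := by
  have := h.add (h'.smul (-1))
  rwa [neg_one_smul, neg_one_smul, ← sub_eq_add_neg, ← sub_eq_add_neg] at this

theorem AsympIntertwines.unique [F.NeBot] (hρ : ∀ a, ‖ρ a‖ ≤ ‖a‖) {a : E →L[ℂ] E}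
    {b b' : E' →L[ℂ] E'} (h : AsympIntertwines F ρ V a b) (h' : AsympIntertwines F ρ V a b') :
    b = b' := by
  have := (h.sub h').norm_le hρ
  rw [sub_self, norm_zero, norm_le_zero_iff] at this
  exact sub_eq_zero.1 this

theorem norm_intertwiningDefect_le (hρ : ∀ a, ‖ρ a‖ ≤ ‖a‖) (V : E' →ₗᵢ[ℂ] L) (a : E →L[ℂ] E)
    (b : E' →L[ℂ] E') : ‖intertwiningDefect ρ V a b‖ ≤ ‖a‖ + ‖b‖ := by
  refine ContinuousLinearMap.opNorm_le_bound _ (by positivity) fun ξ => ?_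
  rw [intertwiningDefect_apply, add_mul]
  refine (norm_sub_le _ _).trans (add_le_add ?_ ?_)
  · refine ((ρ a).le_opNorm _).trans ?_
    rw [V.norm_map]
    gcongr
    exact hρ a
  · rw [V.norm_map]
    exact b.le_opNorm _

theorem AsympIntertwines.of_tendsto (hρ : ∀ a, ‖ρ a‖ ≤ ‖a‖) {a : ℕ → E →L[ℂ] E}
    {b : ℕ → E' →L[ℂ] E'} {a₀ : E →L[ℂ] E} {b₀ : E' →L[ℂ] E'}
    (h : ∀ k, AsympIntertwines F ρ V (a k) (b k)) (ha : Tendsto a atTop (𝓝 a₀))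
    (hb : Tendsto b atTop (𝓝 b₀)) : AsympIntertwines F ρ V a₀ b₀ := by
  rw [AsympIntertwines, Metric.tendsto_nhds]
  intro ε hε
  obtain ⟨k, hk, hk'⟩ := ((Metric.tendsto_nhds.1 ha (ε / 3) (by positivity)).and
    (Metric.tendsto_nhds.1 hb (ε / 3) (by positivity))).exists
  filter_upwards [Metric.tendsto_nhds.1 (h k) (ε / 3) (by positivity)] with i hi
  rw [dist_zero_right] at hi ⊢
  have e : intertwiningDefect ρ (V i) a₀ b₀ = intertwiningDefect ρ (V i) (a k) (b k)
      - intertwiningDefect ρ (V i) (a k - a₀) (b k - b₀) := by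
    ext ξ
    simp only [intertwiningDefect_apply, map_sub, sub_apply]
    abel
  rw [dist_eq_norm] at hk hk'
  calc ‖intertwiningDefect ρ (V i) a₀ b₀‖
      ≤ ‖intertwiningDefect ρ (V i) (a k) (b k)‖ + (‖a k - a₀‖ + ‖b k - b₀‖) := by
        rw [e]
        exact (norm_sub_le _ _).trans (by gcongr; exact norm_intertwiningDefect_le hρ _ _ _)
    _ < ε / 3 + (ε / 3 + ε / 3) := by gcongr
    _ = ε := by ring

variable [CompleteSpace E] [CompleteSpace E']

/-- The isometries `V i` intertwine `b` and `ρ(a)`, and also `b*` and `ρ(a*)`, asymptotically. -/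
def StarAsympIntertwines (F : Filter ι) (ρ : (E →L[ℂ] E) →ₙₐ[ℂ] (L →L[ℂ] L))
    (V : ι → E' →ₗᵢ[ℂ] L) (a : E →L[ℂ] E) (b : E' →L[ℂ] E') : Prop :=
  AsympIntertwines F ρ V a b ∧ AsympIntertwines F ρ V (star a) (star b)

theorem StarAsympIntertwines.zero : StarAsympIntertwines F ρ V 0 0 :=
  ⟨.zero, by rw [star_zero, star_zero]; exact .zero⟩

theorem StarAsympIntertwines.add {a a' : E →L[ℂ] E} {b b' : E' →L[ℂ] E'}
    (h : StarAsympIntertwines F ρ V a b) (h' : StarAsympIntertwines F ρ V a' b') :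
    StarAsympIntertwines F ρ V (a + a') (b + b') :=
  ⟨h.1.add h'.1, by rw [star_add, star_add]; exact h.2.add h'.2⟩

theorem StarAsympIntertwines.smul (c : ℂ) {a : E →L[ℂ] E} {b : E' →L[ℂ] E'}
    (h : StarAsympIntertwines F ρ V a b) : StarAsympIntertwines F ρ V (c • a) (c • b) :=
  ⟨h.1.smul c, by rw [star_smul, star_smul]; exact h.2.smul _⟩

theorem StarAsympIntertwines.mul {a a' : E →L[ℂ] E} {b b' : E' →L[ℂ] E'}
    (h : StarAsympIntertwines F ρ V a b) (h' : StarAsympIntertwines F ρ V a' b') :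
    StarAsympIntertwines F ρ V (a * a') (b * b') :=
  ⟨h.1.mul h'.1, by rw [star_mul, star_mul]; exact h'.2.mul h.2⟩

theorem StarAsympIntertwines.star {a : E →L[ℂ] E} {b : E' →L[ℂ] E'}
    (h : StarAsympIntertwines F ρ V a b) : StarAsympIntertwines F ρ V (star a) (star b) :=
  ⟨h.2, by rw [star_star, star_star]; exact h.1⟩

theorem exists_starAsympIntertwines [F.NeBot] (hρ : ∀ a, ‖ρ a‖ ≤ ‖a‖) {s : Set (E →L[ℂ] E)}
    {B : NonUnitalStarSubalgebra ℂ (E' →L[ℂ] E')} (hB : IsClosed (B : Set (E' →L[ℂ] E')))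
    (h : ∀ a ∈ s, ∃ b ∈ B, StarAsympIntertwines F ρ V a b) {a : E →L[ℂ] E}
    (ha : a ∈ (NonUnitalStarAlgebra.adjoin ℂ s).topologicalClosure) :
    ∃ b ∈ B, StarAsympIntertwines F ρ V a b := by
  have hadj : ∀ a ∈ NonUnitalStarAlgebra.adjoin ℂ s,
      ∃ b ∈ B, StarAsympIntertwines F ρ V a b := fun a ha => by
    induction ha using NonUnitalStarAlgebra.adjoin_induction with
    | mem x hx => exact h x hx
    | add x y _ _ hx hy =>
      obtain ⟨b, hb, hxb⟩ := hx
      obtain ⟨c, hc, hyc⟩ := hy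
      exact ⟨b + c, add_mem hb hc, hxb.add hyc⟩
    | zero => exact ⟨0, zero_mem _, .zero⟩
    | mul x y _ _ hx hy =>
      obtain ⟨b, hb, hxb⟩ := hx
      obtain ⟨c, hc, hyc⟩ := hy
      exact ⟨b * c, mul_mem hb hc, hxb.mul hyc⟩
    | smul c x _ hx =>
      obtain ⟨b, hb, hxb⟩ := hx
      exact ⟨c • b, SMulMemClass.smul_mem c hb, hxb.smul c⟩
    | star x _ hx =>
      obtain ⟨b, hb, hxb⟩ := hx
      exact ⟨Star.star b, star_mem hb, hxb.star⟩
  have ha : a ∈ closure (NonUnitalStarAlgebra.adjoin ℂ s : Set (E →L[ℂ] E)) := ha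
  obtain ⟨x, hx, hxa⟩ := mem_closure_iff_seq_limit.1 ha
  choose b hb hxb using fun k => hadj (x k) (hx k)
  -- Differences are intertwined too, so `‖b n - b N‖ ≤ ‖x n - x N‖`.
  have hcau : CauchySeq b := by
    have hx' := hxa.cauchySeq
    rw [Metric.cauchySeq_iff'] at hx' ⊢
    intro ε hε
    obtain ⟨N, hN⟩ := hx' ε hε
    refine ⟨N, fun n hn => ?_⟩
    have h1 := ((hxb n).1.sub (hxb N).1).norm_le hρ
    have h2 := hN n hn
    rw [dist_eq_norm] at h2 ⊢
    exact h1.trans_lt h2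
  obtain ⟨b₀, hb₀⟩ := cauchySeq_tendsto_of_complete hcau
  exact ⟨b₀, hB.mem_of_tendsto hb₀ (Eventually.of_forall hb),
    .of_tendsto hρ (fun k => (hxb k).1) hxa hb₀,
    .of_tendsto hρ (fun k => (hxb k).2) ((continuous_star.tendsto a).comp hxa)
      ((continuous_star.tendsto b₀).comp hb₀)⟩

/-- Asymptotically intertwining isometries define a *-homomorphism. -/
theorem exists_starHom_of_starAsympIntertwines [F.NeBot] (hρ : ∀ a, ‖ρ a‖ ≤ ‖a‖)
    {A : NonUnitalStarSubalgebra ℂ (E →L[ℂ] E)} {B : NonUnitalStarSubalgebra ℂ (E' →L[ℂ] E')}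
    (h : ∀ a ∈ A, ∃ b ∈ B, StarAsympIntertwines F ρ V a b) :
    ∃ ψ : A →⋆ₙₐ[ℂ] B, ∀ (a : A) (b : B), StarAsympIntertwines F ρ V a b → ψ a = b := by
  choose! g hgB hg using h
  -- Uniqueness of the partner turns each closure property of the relation into an axiom of a
  -- *-homomorphism.
  have key : ∀ (a : A) (b : B), StarAsympIntertwines F ρ V a b →
      (⟨g a, hgB a a.2⟩ : B) = b := fun a b hab =>
    Subtype.ext ((hg a a.2).1.unique hρ hab.1)
  refine ⟨{ toFun := fun a => ⟨g a, hgB a a.2⟩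
            map_smul' := fun c a => key _ _ ((hg a a.2).smul c)
            map_zero' := key _ _ .zero
            map_add' := fun a b => key _ _ ((hg a a.2).add (hg b b.2))
            map_mul' := fun a b => key _ _ ((hg a a.2).mul (hg b b.2))
            map_star' := fun a => key _ _ (hg a a.2).star }, key⟩

end AsymptoticIntertwining

/-! ### Reindexing and bounds for sums. -/

section Sums

open scoped ENNReal

theorem memℓp_two_of_tsum_enorm {ι : Type*} {E : ι → Type*} [∀ i, NormedAddCommGroup (E i)]
    {f : ∀ i, E i} (h : ∑' i, ‖f i‖ₑ ^ 2 ≠ ⊤) : Memℓp f 2 := by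
  refine memℓp_gen ?_
  have := ENNReal.summable_toReal h
  simpa using this

theorem enorm_sq_eq_tsum {ι : Type*} {E : ι → Type*} [∀ i, NormedAddCommGroup (E i)]
    (ζ : lp E 2) : ‖ζ‖ₑ ^ 2 = ∑' i, ‖ζ i‖ₑ ^ 2 := by
  have h := lp.hasSum_norm (p := 2) (by norm_num) ζ
  have h' : HasSum (fun i => ‖ζ i‖ ^ 2) (‖ζ‖ ^ 2) := by simpa using h
  have e : ∀ i, ‖ζ i‖ₑ ^ 2 = ENNReal.ofReal (‖ζ i‖ ^ 2) := fun i => by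
    rw [ENNReal.ofReal_pow (norm_nonneg _), ofReal_norm]
  simp only [e]
  rw [← ENNReal.ofReal_tsum_of_nonneg (fun i => sq_nonneg _) h'.summable, h'.tsum_eq,
    ENNReal.ofReal_pow (norm_nonneg _), ofReal_norm]

theorem finsum_eq_finsum_of_equiv {X Y M : Type*} [AddCommMonoid M] {p : X → Prop} {q : Y → Prop}
    (e : {x // p x} ≃ {y // q y}) {f : X → M} {g : Y → M} (hf : ∀ x, f x ≠ 0 → p x)
    (hg : ∀ y, g y ≠ 0 → q y) (h : ∀ x : {x // p x}, f x = g (e x)) :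
    ∑ᶠ x, f x = ∑ᶠ y, g y := by
  have hsf : Function.support f ⊆ {x | p x} := hf
  have hsg : Function.support g ⊆ {y | q y} := hg
  have h1 : ∑ᶠ x, f x = ∑ᶠ x : {x | p x}, f x := by
    rw [finsum_set_coe_eq_finsum_mem, finsum_mem_def, Set.indicator_eq_self.2 hsf]
  have h2 : ∑ᶠ y, g y = ∑ᶠ y : {y | q y}, g y := by
    rw [finsum_set_coe_eq_finsum_mem, finsum_mem_def, Set.indicator_eq_self.2 hsg]
  rw [h1, h2]
  exact (finsum_congr h).trans (finsum_comp_equiv (f := fun y : {y | q y} => g y) e)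

theorem tsum_eq_tsum_of_equiv {X Y : Type*} {p : X → Prop} {q : Y → Prop}
    (e : {x // p x} ≃ {y // q y}) {f : X → ℝ≥0∞} {g : Y → ℝ≥0∞} (hf : ∀ x, f x ≠ 0 → p x)
    (hg : ∀ y, g y ≠ 0 → q y) (h : ∀ x : {x // p x}, f x = g (e x)) :
    ∑' x, f x = ∑' y, g y := by
  have hsf : Function.support f ⊆ {x | p x} := hf
  have hsg : Function.support g ⊆ {y | q y} := hg
  have h1 : ∑' x, f x = ∑' x : {x | p x}, f x := by
    rw [tsum_subtype, Set.indicator_eq_self.2 hsf]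
  have h2 : ∑' y, g y = ∑' y : {y | q y}, g y := by
    rw [tsum_subtype, Set.indicator_eq_self.2 hsg]
  rw [h1, h2]
  exact (tsum_congr h).trans (Equiv.tsum_eq e fun y : {y | q y} => g y)

theorem finsum_finsum_fibre {X Y M : Type*} [AddCommMonoid M] (p : X → Y) {F : X → M}
    (hF : (Function.support F).Finite) : ∑ᶠ y, ∑ᶠ x : {x : X // p x = y}, F x = ∑ᶠ x, F x := by
  classical
  have h1 : ∀ y, ∑ᶠ x : {x : X // p x = y}, F x
      = ∑ x ∈ hF.toFinset with p x = y, F x := fun y => by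
    refine (finsum_set_coe_eq_finsum_mem {x | p x = y}).trans ?_
    refine finsum_mem_eq_sum_of_inter_support_eq F ?_
    ext x
    simp only [mem_inter_iff, mem_ofPred_eq, Finset.coe_filter, Finite.mem_toFinset]
    tauto
  simp only [h1]
  rw [finsum_eq_sum_of_support_subset (s := hF.toFinset.image p), finsum_eq_sum F hF]
  · exact Finset.sum_fiberwise_of_maps_to (fun x hx => Finset.mem_image_of_mem p hx) F
  · intro y hy
    obtain ⟨x, hx, -⟩ := Finset.exists_ne_zero_of_sum_ne_zero hy
    rw [Finset.mem_filter] at hx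
    exact Finset.mem_coe.2 (Finset.mem_image.2 ⟨x, hx.1, hx.2⟩)

/-- The Cauchy-Schwarz inequality for a sum with at most `n` terms. -/
theorem enorm_finsum_sq_le {X : Type*} {F : X → ℂ} {n : ℕ}
    (hn : ∀ S : Finset X, (∀ x ∈ S, F x ≠ 0) → S.card ≤ n) :
    ‖∑ᶠ x, F x‖ₑ ^ 2 ≤ n * ∑' x, ‖F x‖ₑ ^ 2 := by
  have hF : (Function.support F).Finite := by
    by_contra h
    obtain ⟨S, hS, hcard⟩ := Set.Infinite.exists_subset_card_eq h (n + 1)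
    have := hn S fun x hx => hS hx
    omega
  rw [finsum_eq_sum F hF]
  have h1 : ‖∑ x ∈ hF.toFinset, F x‖ ^ 2 ≤ n * ∑ x ∈ hF.toFinset, ‖F x‖ ^ 2 := by
    calc ‖∑ x ∈ hF.toFinset, F x‖ ^ 2 ≤ (∑ x ∈ hF.toFinset, ‖F x‖) ^ 2 := by
          gcongr
          exact norm_sum_le _ _
      _ ≤ hF.toFinset.card * ∑ x ∈ hF.toFinset, ‖F x‖ ^ 2 := sq_sum_le_card_mul_sum_sq
      _ ≤ n * ∑ x ∈ hF.toFinset, ‖F x‖ ^ 2 := by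
          gcongr
          exact_mod_cast hn _ fun x hx => (hF.mem_toFinset.1 hx)
  have e : ∀ z : ℂ, ‖z‖ₑ ^ 2 = ENNReal.ofReal (‖z‖ ^ 2) := fun z => by
    rw [ENNReal.ofReal_pow (norm_nonneg _), ofReal_norm]
  calc ‖∑ x ∈ hF.toFinset, F x‖ₑ ^ 2
      ≤ ENNReal.ofReal (n * ∑ x ∈ hF.toFinset, ‖F x‖ ^ 2) := by
        rw [e]
        exact ENNReal.ofReal_le_ofReal h1
    _ = n * ∑ x ∈ hF.toFinset, ‖F x‖ₑ ^ 2 := by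
        rw [ENNReal.ofReal_mul (by positivity), ENNReal.ofReal_natCast,
          ENNReal.ofReal_sum_of_nonneg fun _ _ => sq_nonneg _]
        simp only [e]
    _ ≤ n * ∑' x, ‖F x‖ₑ ^ 2 := by
        gcongr
        exact ENNReal.sum_le_tsum _

theorem tsum_ite_one_le {X : Type*} {p : X → Prop} [DecidablePred p] {n : ℕ}
    (hn : ∀ S : Finset X, (∀ x ∈ S, p x) → S.card ≤ n) :
    ∑' x, (if p x then 1 else 0 : ℝ≥0∞) ≤ n := by
  rw [ENNReal.tsum_eq_iSup_sum]
  refine iSup_le fun S => ?_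
  rw [Finset.sum_ite, Finset.sum_const_zero, add_zero, Finset.sum_const, nsmul_eq_mul, mul_one]
  exact_mod_cast hn _ fun x hx => (Finset.mem_filter.1 hx).2

end Sums

/-! ### Left translation of functions on a groupoid. -/

section Translation

variable {Q : Type*} [ArrowGroupoid Q]

open scoped Classical in
/-- The translate `ε ↦ ξ(a ε)`, extended by `0`. -/
noncomputable def transl (ξ : Q → ℂ) (a ε : Q) : ℂ :=
  if h : dom a = rng ε then ξ (comp a ε h) else 0

theorem transl_of_eq (ξ : Q → ℂ) {a ε : Q} (h : dom a = rng ε) :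
    transl ξ a ε = ξ (comp a ε h) := dif_pos h

theorem transl_of_ne (ξ : Q → ℂ) {a ε : Q} (h : dom a ≠ rng ε) : transl ξ a ε = 0 := dif_neg h

theorem dom_eq_of_transl_ne_zero {ξ : Q → ℂ} {a ε : Q} (h : transl ξ a ε ≠ 0) :
    dom a = rng ε := by
  by_contra h'
  exact h (transl_of_ne ξ h')

/-- Left multiplication by `a`. -/
def leftMulEquiv (a : Q) : {ε : Q // dom a = rng ε} ≃ {δ : Q // rng δ = rng a} where
  toFun ε := ⟨comp a ε.1 ε.2, rng_comp _ _ _⟩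
  invFun δ := ⟨comp (inv a) δ.1 (by rw [dom_inv, δ.2]), by rw [rng_comp, rng_inv]⟩
  left_inv ε := Subtype.ext (inv_comp_comp ε.2)
  right_inv δ := by
    apply Subtype.ext
    change comp a (comp (inv a) δ.1 _) _ = δ.1
    rw [← comp_assoc _ _ _ (rng_inv a).symm (by rw [dom_inv, δ.2]), comp_congr _ (comp_inv a) rfl]
    exact unit_comp (dom_rng a) _

open scoped Classical ENNReal in
theorem tsum_enorm_transl (ξ : Q → ℂ) (a : Q) :
    ∑' ε, ‖transl ξ a ε‖ₑ ^ 2 = ∑' δ, if rng δ = rng a then ‖ξ δ‖ₑ ^ 2 else 0 := by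
  refine tsum_eq_tsum_of_equiv (leftMulEquiv a) (fun ε h => ?_) (fun δ h => ?_) fun ε => ?_
  · by_contra h'
    exact h (by rw [transl_of_ne ξ h']; simp)
  · by_contra h'
    exact h (if_neg h')
  · rw [transl_of_eq ξ ε.2, if_pos (leftMulEquiv a ε).2]
    rfl

/-- The bijection `β ↦ γ β⁻¹`. -/
def rightDivEquiv (γ : Q) : {β : Q // dom γ = dom β} ≃ {α : Q // dom (inv α) = rng γ} where
  toFun β := ⟨comp γ (inv β.1) (β.2.trans (rng_inv _).symm), by rw [dom_inv, rng_comp]⟩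
  invFun α := ⟨comp (inv α.1) γ α.2, (dom_comp _ _ _).symm⟩
  left_inv β := by
    apply Subtype.ext
    have h : dom γ = rng (inv β.1) := β.2.trans (rng_inv _).symm
    change comp (inv (comp γ (inv β.1) h)) γ _ = β.1
    rw [comp_congr _ (inv_comp_rev h) rfl, comp_congr _ (comp_congr _ (ArrowGroupoid.inv_inv _) rfl)
      rfl, comp_assoc _ _ _ (β.2.symm.trans (rng_inv γ).symm) (dom_inv γ),
      comp_congr _ rfl (inv_comp γ)]
    exact comp_unit (dom_dom γ) _
  right_inv α := by
    apply Subtype.ext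
    change comp γ (inv (comp (inv α.1) γ α.2)) _ = α.1
    rw [comp_congr _ rfl (inv_comp_rev α.2),
      comp_congr _ rfl (comp_congr _ rfl (ArrowGroupoid.inv_inv α.1)),
      ← comp_assoc _ _ _ (rng_inv γ).symm ((dom_inv γ).trans (α.2.symm.trans (dom_inv α.1))),
      comp_congr _ (comp_inv γ) rfl]
    exact unit_comp (dom_rng γ) _

end Translation

/-! ### Convolution by `φ_Q(f)` in terms of translations by arrows of `G`. -/

section Quotient

variable {G : Type*} [TopologicalSpace G] [EtaleGroupoid G]

/-- Substitute `α = γβ⁻¹`. In this form the coefficient `f α` is separated from the translation, so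
`G` and its quotient can be compared term by term. -/
theorem regRep_eq_finsum_transl (f : CompactlySupportedContinuousMap G ℂ) (ξ : Ell2 G) (γ : G) :
    regRep f ξ γ = ∑ᶠ α, f α * transl ξ (inv α) γ := by
  rw [regRep_apply]
  refine finsum_eq_finsum_of_equiv (rightDivEquiv γ)
    (fun β h => dom_eq_of_convKernel_ne_zero (left_ne_zero_of_mul h))
    (fun α h => dom_eq_of_transl_ne_zero (right_ne_zero_of_mul h)) fun β => ?_
  rw [convKernel_of_eq _ β.2, transl_of_eq _ (rightDivEquiv γ β).2]
  congr 2
  exact congrArg (fun β => ξ β) (congrArg Subtype.val ((rightDivEquiv γ).left_inv β)).symm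

theorem exists_card_le_of_rng (f : CompactlySupportedContinuousMap G ℂ) :
    ∃ n : ℕ, ∀ β : G, ∀ S : Finset G, (∀ α ∈ S, f α ≠ 0 ∧ dom (inv α) = rng β) → S.card ≤ n := by
  obtain ⟨n, hn⟩ := exists_card_le_of_injOn (G := G) exists_injOn_rng
    (K := tsupport f) f.hasCompactSupport
  refine ⟨n, fun β S hS => hn S (fun α hα => subset_tsupport f (hS α hα).1) fun α hα α' hα' => ?_⟩
  rw [← dom_inv α, ← dom_inv α', (hS α hα).2, (hS α' hα').2]

theorem finite_support_mul_transl (f : CompactlySupportedContinuousMap G ℂ) (c : G → ℂ) (β : G)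
    (hc : ∀ α, c α ≠ 0 → dom (inv α) = rng β) : (Function.support fun α => f α * c α).Finite := by
  obtain ⟨n, hn⟩ := exists_card_le_of_rng f
  by_contra h
  obtain ⟨S, hS, hcard⟩ := Set.Infinite.exists_subset_card_eq h (n + 1)
  have := hn β S fun α hα => ⟨left_ne_zero_of_mul (hS hα), hc α (right_ne_zero_of_mul (hS hα))⟩
  omega

theorem rng_eq_of_dom_inv_mk {α β : G} {ε : IsoQuotient G}
    (h : dom (IsoQuotient.mk β) = rng ε)
    (h' : dom (inv (IsoQuotient.mk α)) = rng (comp (IsoQuotient.mk β) ε h)) :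
    dom (inv α) = rng β := by
  rw [dom_inv, rng_comp] at h'
  have := IsoQuotient.dom_eq_of_mk_eq (show IsoQuotient.mk (rng α) = IsoQuotient.mk (rng β) from h')
  rwa [dom_rng, dom_rng, ← dom_inv α] at this

/-- This is `[α]⁻¹([β]ε) = [α⁻¹β]ε`. The conditions of composability on the two sides agree because
the quotient map is injective on units. -/
theorem transl_mk_comp (ξ : IsoQuotient G → ℂ) (α β : G) {ε : IsoQuotient G}
    (h : dom (IsoQuotient.mk β) = rng ε) :
    transl ξ (inv (IsoQuotient.mk α)) (comp (IsoQuotient.mk β) ε h)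
      = transl (fun β => transl ξ (IsoQuotient.mk β) ε) (inv α) β := by
  by_cases hα : dom (inv α) = rng β
  · have h1 : dom (inv (IsoQuotient.mk α)) = rng (IsoQuotient.mk β) :=
      congrArg IsoQuotient.mk hα
    have h2 : dom (IsoQuotient.mk (comp (inv α) β hα)) = rng ε :=
      (congrArg IsoQuotient.mk (dom_comp (inv α) β hα)).trans h
    rw [transl_of_eq _ (h1.trans (rng_comp _ _ _).symm), transl_of_eq _ hα, transl_of_eq _ h2,
      ← comp_assoc _ _ _ h1 h]
    exact congrArg ξ (comp_congr _ (IsoQuotient.comp_mk hα h1) rfl)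
  · rw [transl_of_ne _ hα, transl_of_ne]
    exact fun h' => hα (rng_eq_of_dom_inv_mk h h')

variable [T2Space G]

theorem regRep_quotientSum (hG : IsClosed (isoInt G)) (f : CompactlySupportedContinuousMap G ℂ)
    (ξ : Ell2 (IsoQuotient G)) {β : G} {ε : IsoQuotient G}
    (h : dom (IsoQuotient.mk β) = rng ε) :
    regRep (quotientSum hG f) ξ (comp (IsoQuotient.mk β) ε h)
      = ∑ᶠ α, f α * transl ξ (inv (IsoQuotient.mk α)) (comp (IsoQuotient.mk β) ε h) := by
  rw [regRep_eq_finsum_transl, ← finsum_finsum_fibre IsoQuotient.mk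
    (finite_support_mul_transl f _ β fun α hα =>
      rng_eq_of_dom_inv_mk h (dom_eq_of_transl_ne_zero hα))]
  refine finsum_congr fun ρ => ?_
  change (∑ᶠ α : {α : G // IsoQuotient.mk α = ρ}, f α.1) * _ = _
  rw [finsum_mul]
  exact finsum_congr fun α => by rw [α.2]

/-- For fixed `ε`, the map `ξ ↦ (β ↦ ξ([β]ε))` intertwines the two convolutions exactly. It need not
map into `ℓ²(G)`, which is why a density is needed. -/
theorem transl_regRep_quotientSum (hG : IsClosed (isoInt G))
    (f : CompactlySupportedContinuousMap G ℂ) (ξ : Ell2 (IsoQuotient G)) (β : G)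
    (ε : IsoQuotient G) :
    transl (regRep (quotientSum hG f) ξ) (IsoQuotient.mk β) ε
      = ∑ᶠ α, f α * transl (fun β => transl ξ (IsoQuotient.mk β) ε) (inv α) β := by
  by_cases h : dom (IsoQuotient.mk β) = rng ε
  · rw [transl_of_eq _ h, regRep_quotientSum hG f ξ h]
    exact finsum_congr fun α => by rw [transl_mk_comp]
  · rw [transl_of_ne _ h, finsum_eq_zero_of_forall_eq_zero]
    intro α
    by_contra hne
    have h0 := right_ne_zero_of_mul hne
    have hα := dom_eq_of_transl_ne_zero h0
    rw [transl_of_eq _ hα] at h0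
    have h1 := dom_eq_of_transl_ne_zero h0
    exact h ((congrArg IsoQuotient.mk (dom_comp (inv α) β hα)).symm.trans h1)

end Quotient

/-! ### Isometries from probability densities on the range fibres. -/

section Density

open scoped ENNReal

variable {G : Type*} [TopologicalSpace G] [EtaleGroupoid G]

/-- A system of probability densities on the fibres of the range map. -/
def IsDensity (m : G → ℝ) : Prop :=
  (∀ γ, 0 ≤ m γ) ∧ ∀ x ∈ units G, HasSum (fun γ : {γ : G // rng γ = x} => m γ.1) 1

open scoped Classical in
theorem IsDensity.tsum_ofReal {m : G → ℝ} (hm : IsDensity m) (u : IsoQuotient G)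
    (hu : dom u = u) :
    ∑' β, (if u = rng (IsoQuotient.mk β) then ENNReal.ofReal (m β) else 0) = 1 := by
  obtain ⟨α, rfl⟩ := IsoQuotient.mk_surjective u
  have hα : IsoQuotient.mk (dom α) = IsoQuotient.mk α := hu
  have e : ∀ β, (IsoQuotient.mk α = rng (IsoQuotient.mk β)) ↔ rng β = dom α := fun β => by
    constructor
    · intro h
      rw [← hα] at h
      have := IsoQuotient.dom_eq_of_mk_eq
        (show IsoQuotient.mk (dom α) = IsoQuotient.mk (rng β) from h)
      rw [dom_dom, dom_rng] at this
      exact this.symm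
    · intro h
      rw [IsoQuotient.rng_mk, h, hα]
  have h1 := hm.2 (dom α) (dom_dom α)
  simp only [e]
  have h2 : ∑' β : {β | rng β = dom α}, ENNReal.ofReal (m β) = 1 := by
    rw [← ENNReal.ofReal_one, ← h1.tsum_eq]
    exact (ENNReal.ofReal_tsum_of_nonneg (fun β => hm.1 _) h1.summable).symm
  rw [← h2, tsum_subtype {β | rng β = dom α} fun β => ENNReal.ofReal (m β)]
  exact tsum_congr fun β => by simp only [indicator_apply, mem_ofPred_eq]

theorem enorm_sqrt_sq {t : ℝ} (ht : 0 ≤ t) : ‖((√t : ℝ) : ℂ)‖ₑ ^ 2 = ENNReal.ofReal t := by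
  rw [← ofReal_norm, ← ENNReal.ofReal_pow (norm_nonneg _), Complex.norm_real,
    Real.norm_eq_abs, sq_abs, Real.sq_sqrt ht]

/-- Substitute `δ = [β]ε`. Each `‖ξ(δ)‖²` is then weighted by the total mass of `m` on the fibre
over `r(δ)`, which is `1`. -/
theorem IsDensity.tsum_tsum_enorm {m : G → ℝ} (hm : IsDensity m) (ξ : Ell2 (IsoQuotient G)) :
    ∑' (ε : IsoQuotient G) (β : G), ‖((√(m β) : ℝ) : ℂ) * transl ξ (IsoQuotient.mk β) ε‖ₑ ^ 2
      = ‖ξ‖ₑ ^ 2 := by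
  classical
  rw [ENNReal.tsum_comm, enorm_sq_eq_tsum]
  simp only [enorm_mul, mul_pow, enorm_sqrt_sq (hm.1 _), ENNReal.tsum_mul_left,
    tsum_enorm_transl]
  simp only [← ENNReal.tsum_mul_left]
  rw [ENNReal.tsum_comm]
  refine tsum_congr fun δ => ?_
  have : ∀ β, ENNReal.ofReal (m β) * (if rng δ = rng (IsoQuotient.mk β) then ‖ξ δ‖ₑ ^ 2 else 0)
      = (if rng δ = rng (IsoQuotient.mk β) then ENNReal.ofReal (m β) else 0) * ‖ξ δ‖ₑ ^ 2 :=
    fun β => by split_ifs <;> simp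
  simp only [this]
  rw [ENNReal.tsum_mul_right, hm.tsum_ofReal _ (dom_rng δ), one_mul]

/-- The Hilbert space `⨁_{ε} ℓ²(G)`, summed over the arrows `ε` of `G / Iso(G)°`. -/
abbrev AmpSpace (G : Type*) [TopologicalSpace G] [EtaleGroupoid G] : Type _ :=
  lp (fun _ : IsoQuotient G => Ell2 G) 2

/-- The isometry `(V ξ)(ε)(β) = m(β)^{1/2} ξ([β] ε)`. -/
noncomputable def IsDensity.isometry {m : G → ℝ} (hm : IsDensity m) :
    Ell2 (IsoQuotient G) →ₗᵢ[ℂ] AmpSpace G :=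
  have hmem : ∀ (ξ : Ell2 (IsoQuotient G)) (ε : IsoQuotient G),
      Memℓp (fun β : G => ((√(m β) : ℝ) : ℂ) * transl ξ (IsoQuotient.mk β) ε) 2 := fun ξ ε =>
    memℓp_two_of_tsum_enorm (ne_top_of_le_ne_top (ENNReal.pow_ne_top enorm_ne_top)
      ((ENNReal.le_tsum (f := fun ε : IsoQuotient G => ∑' β : G,
        ‖((√(m β) : ℝ) : ℂ) * transl ξ (IsoQuotient.mk β) ε‖ₑ ^ 2) ε).trans_eq
          (hm.tsum_tsum_enorm ξ)))
  have hsum : ∀ ξ : Ell2 (IsoQuotient G), ∑' ε : IsoQuotient G,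
      ‖(⟨fun β : G => ((√(m β) : ℝ) : ℂ) * transl ξ (IsoQuotient.mk β) ε, hmem ξ ε⟩ : Ell2 G)‖ₑ ^ 2
        = ‖ξ‖ₑ ^ 2 := fun ξ => by
    rw [← hm.tsum_tsum_enorm ξ]
    exact tsum_congr fun ε => enorm_sq_eq_tsum _
  have htop : ∀ ξ : Ell2 (IsoQuotient G), ‖ξ‖ₑ ^ 2 ≠ ⊤ := fun ξ =>
    ENNReal.pow_ne_top enorm_ne_top
  { toFun := fun ξ => ⟨fun ε => ⟨fun β : G => ((√(m β) : ℝ) : ℂ) *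
        transl ξ (IsoQuotient.mk β) ε, hmem ξ ε⟩,
      memℓp_two_of_tsum_enorm (by rw [hsum]; exact htop ξ)⟩
    map_add' := fun ξ η => by
      ext ε β
      change _ * transl (ξ + η) _ _ = _ * transl ξ _ _ + _ * transl η _ _
      unfold transl
      split_ifs <;> simp [mul_add]
    map_smul' := fun c ξ => by
      ext ε β
      change _ * transl (c • ξ) _ _ = c * (_ * transl ξ _ _)
      unfold transl
      split_ifs
      · simp only [lp.coeFn_smul, Pi.smul_apply, smul_eq_mul]
        ring
      · simp
    norm_map' := fun ξ => by
      have := (enorm_sq_eq_tsum (ι := IsoQuotient G) (E := fun _ => Ell2 G)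
        ⟨_, memℓp_two_of_tsum_enorm (by rw [hsum]; exact htop ξ)⟩).trans (hsum ξ)
      have := (ENNReal.pow_right_strictMono two_ne_zero).injective this
      rw [← toReal_enorm, ← toReal_enorm ξ, ← this]
      rfl }

theorem IsDensity.isometry_apply {m : G → ℝ} (hm : IsDensity m) (ξ : Ell2 (IsoQuotient G))
    (ε : IsoQuotient G) (β : G) :
    hm.isometry ξ ε β = ((√(m β) : ℝ) : ℂ) * transl ξ (IsoQuotient.mk β) ε := rfl

/-- The diagonal action of an operator on `⨁_{ε} ℓ²(G)`. -/
noncomputable def amplification (G : Type*) [TopologicalSpace G] [EtaleGroupoid G] :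
    (Ell2 G →L[ℂ] Ell2 G) →ₙₐ[ℂ] (AmpSpace G →L[ℂ] AmpSpace G) where
  toFun a := lp.mapCLM 2 (fun _ => a) (norm_nonneg a) fun _ => le_rfl
  map_smul' c a := by ext ζ ε β; rfl
  map_zero' := by ext ζ ε β; rfl
  map_add' a b := by ext ζ ε β; rfl
  map_mul' a b := by ext ζ ε β; rfl

theorem norm_amplification_le (a : Ell2 G →L[ℂ] Ell2 G) : ‖amplification G a‖ ≤ ‖a‖ :=
  lp.norm_mapCLM_le 2 (fun _ => a) (norm_nonneg a) fun _ => le_rfl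

open scoped Classical in
/-- The density `|m(α⁻¹ β) - m(β)|` on the pairs with `r(α) = r(β)`. -/
noncomputable def densityDiff (m : G → ℝ) (α β : G) : ℝ≥0∞ :=
  if h : dom (inv α) = rng β then ENNReal.ofReal |m (comp (inv α) β h) - m β| else 0

/-- This turns the `ℓ¹` almost invariance of `m` into `ℓ²` almost invariance of `√m`. -/
theorem sq_sqrt_sub_sqrt_le {s t : ℝ} (hs : 0 ≤ s) (ht : 0 ≤ t) : (√s - √t) ^ 2 ≤ |s - t| := by
  have h1 : |s - t| = |√s - √t| * (√s + √t) := by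
    rw [← abs_of_nonneg (add_nonneg (Real.sqrt_nonneg s) (Real.sqrt_nonneg t)), ← abs_mul]
    congr 1
    nlinarith [Real.sq_sqrt hs, Real.sq_sqrt ht]
  rw [h1, ← sq_abs, sq]
  gcongr
  rw [abs_le]
  constructor <;> linarith [Real.sqrt_nonneg s, Real.sqrt_nonneg t]

theorem IsDensity.tsum_densityDiff {m : G → ℝ} (hm : IsDensity m) (α : G) :
    ∑' β, densityDiff m α β = ENNReal.ofReal (∑' β : {β : G // rng α = rng β},
      |m (comp (inv α) β.1 ((dom_inv α).trans β.2)) - m β.1|) := by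
  -- Both families are summable, being densities on range fibres. Without summability the real
  -- `tsum` would take the default value `0` and bound nothing.
  have h1 : Summable fun β : {β : G // rng α = rng β} => m β := by
    have := (hm.2 (rng α) (dom_rng α)).summable
    exact (Equiv.summable_iff (Equiv.subtypeEquivRight fun β => eq_comm)).2 this
  have h2 : Summable fun β : {β : G // rng α = rng β} =>
      m (comp (inv α) β.1 ((dom_inv α).trans β.2)) := by
    have := (hm.2 (rng (inv α)) (dom_rng _)).summable
    have h3 := (Equiv.summable_iff (leftMulEquiv (inv α))).2 this
    exact (Equiv.summable_iff (Equiv.subtypeEquivRight fun β => by rw [dom_inv])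
      (f := fun β : {β : G // dom (inv α) = rng β} => m (comp (inv α) β.1 β.2))).2 h3
  rw [ENNReal.ofReal_tsum_of_nonneg (fun β => abs_nonneg _) (h2.sub h1).abs]
  refine (tsum_eq_tsum_of_equiv (p := fun _ : {β : G // rng α = rng β} => True)
    (q := fun β => dom (inv α) = rng β)
    ((Equiv.subtypeUnivEquiv fun _ => trivial).trans
      (Equiv.subtypeEquivRight fun β => by rw [dom_inv])) (fun _ _ => trivial)
    (fun β hβ => ?_) fun β => ?_).symm
  · by_contra h
    exact hβ (dif_neg h)
  · change _ = densityDiff m α β.1.1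
    unfold densityDiff
    rw [dif_pos ((dom_inv α).trans β.1.2)]

end Density

/-! ### Amenability makes the intertwining defect tend to zero. -/

section Amenable

open scoped ENNReal
open Filter

variable {G : Type*} [TopologicalSpace G] [EtaleGroupoid G]

theorem IsDensity.enorm_transl_sub_sq_le {m : G → ℝ} (hm : IsDensity m) (P : G → ℂ) (α β : G) :
    ‖transl (fun β => ((√(m β) : ℝ) : ℂ) * P β) (inv α) β
      - ((√(m β) : ℝ) : ℂ) * transl P (inv α) β‖ₑ ^ 2
      ≤ densityDiff m α β * ‖transl P (inv α) β‖ₑ ^ 2 := by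
  by_cases h : dom (inv α) = rng β
  · rw [transl_of_eq _ h, transl_of_eq _ h, ← sub_mul, enorm_mul, mul_pow, densityDiff, dif_pos h]
    gcongr
    rw [← Complex.ofReal_sub, ← ofReal_norm, ← ENNReal.ofReal_pow (norm_nonneg _),
      Complex.norm_real, Real.norm_eq_abs, sq_abs]
    exact ENNReal.ofReal_le_ofReal (sq_sqrt_sub_sqrt_le (hm.1 _) (hm.1 _))
  · rw [transl_of_ne _ h, transl_of_ne _ h]
    simp

-- Substituting `δ = [α⁻¹β]ε`, whose range is the class of `d(α)`, removes `β` from the inner sum.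
-- The sum over `β` then falls on `densityDiff` alone.
open scoped Classical in
theorem densityDiff_mul_tsum_enorm (m : G → ℝ) (ξ : IsoQuotient G → ℂ) (α β : G) :
    densityDiff m α β *
        ∑' ε, ‖transl (fun β => transl ξ (IsoQuotient.mk β) ε) (inv α) β‖ₑ ^ 2
      = densityDiff m α β *
        ∑' δ, if rng δ = IsoQuotient.mk (dom α) then ‖ξ δ‖ₑ ^ 2 else 0 := by
  by_cases h : dom (inv α) = rng β
  · simp only [transl_of_eq _ h]
    rw [tsum_enorm_transl, IsoQuotient.rng_mk, rng_comp, rng_inv]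
  · rw [densityDiff, dif_neg h, zero_mul, zero_mul]

theorem exists_card_le_of_mk_dom (f : CompactlySupportedContinuousMap G ℂ) :
    ∃ n : ℕ, ∀ u : IsoQuotient G, ∀ S : Finset G,
      (∀ α ∈ S, f α ≠ 0 ∧ u = IsoQuotient.mk (dom α)) → S.card ≤ n := by
  obtain ⟨n, hn⟩ := exists_card_le_of_injOn (G := G) exists_injOn_dom
    (K := tsupport f) f.hasCompactSupport
  refine ⟨n, fun u S hS => hn S (fun α hα => subset_tsupport f (hS α hα).1) fun α hα α' hα' => ?_⟩
  exact IsoQuotient.mk_dom_inj ((hS α hα).2.symm.trans (hS α' hα').2)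

variable [T2Space G]

/-- The unweighted maps intertwine exactly, so only the commutator of translation with
multiplication by `√m` remains. -/
theorem intertwiningDefect_coord (hG : IsClosed (isoInt G))
    (f : CompactlySupportedContinuousMap G ℂ) {m : G → ℝ} (hm : IsDensity m)
    (ξ : Ell2 (IsoQuotient G)) (ε : IsoQuotient G) (β : G) :
    intertwiningDefect (amplification G) hm.isometry (regRep f) (regRep (quotientSum hG f)) ξ ε β
      = ∑ᶠ α, f α * (transl (fun β => ((√(m β) : ℝ) : ℂ) * transl ξ (IsoQuotient.mk β) ε) (inv α) β
        - ((√(m β) : ℝ) : ℂ) * transl (fun β => transl ξ (IsoQuotient.mk β) ε) (inv α) β) := by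
  have h1 : intertwiningDefect (amplification G) hm.isometry (regRep f)
      (regRep (quotientSum hG f)) ξ ε β = regRep f (hm.isometry ξ ε) β
        - hm.isometry (regRep (quotientSum hG f) ξ) ε β := rfl
  rw [h1, hm.isometry_apply, transl_regRep_quotientSum, regRep_eq_finsum_transl, mul_finsum,
    ← finsum_sub_distrib]
  · refine finsum_congr fun α => ?_
    rw [mul_sub, mul_left_comm]
    rfl
  · exact finite_support_mul_transl f _ β fun α h => dom_eq_of_transl_ne_zero h
  · simp only [mul_left_comm _ (f _)]
    exact finite_support_mul_transl f _ β fun α h =>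
      dom_eq_of_transl_ne_zero (right_ne_zero_of_mul h)

/-- The isometry given by an almost invariant density almost intertwines the regular
representations of `G` and of the quotient. -/
theorem exists_enorm_intertwiningDefect_sq_le (hG : IsClosed (isoInt G))
    (f : CompactlySupportedContinuousMap G ℂ) :
    ∃ C : ℝ≥0∞, C ≠ ⊤ ∧ ∀ (m : G → ℝ) (hm : IsDensity m) (η : ℝ≥0∞),
      (∀ α, f α ≠ 0 → ∑' β, densityDiff m α β ≤ η) → ∀ ξ,
      ‖intertwiningDefect (amplification G) hm.isometry (regRep f)
        (regRep (quotientSum hG f)) ξ‖ₑ ^ 2 ≤ C * η * ‖ξ‖ₑ ^ 2 := by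
  classical
  obtain ⟨n, hn⟩ := exists_card_le_of_rng f
  obtain ⟨k, hk⟩ := exists_card_le_of_mk_dom f
  obtain ⟨C₀, hC₀⟩ := f.hasCompactSupport.exists_bound_of_continuous f.continuous
  have hC : ∀ α, ‖f α‖ₑ ≤ ENNReal.ofReal C₀ := fun α => by
    rw [← ofReal_norm]
    exact ENNReal.ofReal_le_ofReal (hC₀ α)
  set C := ENNReal.ofReal C₀ with hCdef
  -- Here `n` comes from the Cauchy-Schwarz inequality over the arrows of the support with the range
  -- of `β`, `C` bounds `|f|`, and `k` counts how often a given `δ` occurs, once for each arrow of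
  -- the support whose domain has the class `r(δ)`.
  refine ⟨n * C ^ 2 * k, by finiteness, fun m hm η hη ξ => ?_⟩
  set P : IsoQuotient G → G → ℂ := fun ε β => transl ξ (IsoQuotient.mk β) ε with hP
  set χ : G → ℝ≥0∞ := fun α => if f α = 0 then 0 else 1 with hχ
  set D := intertwiningDefect (amplification G) hm.isometry (regRep f)
        (regRep (quotientSum hG f)) ξ with hD
  have h1 : ∀ ε β, ‖D ε β‖ₑ ^ 2 ≤ n * C ^ 2 *
      ∑' α, χ α * (densityDiff m α β * ‖transl (P ε) (inv α) β‖ₑ ^ 2) := by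
    intro ε β
    rw [hD, intertwiningDefect_coord]
    refine (enorm_finsum_sq_le fun S hS => hn β S fun α hα =>
      ⟨left_ne_zero_of_mul (hS α hα), ?_⟩).trans ?_
    · by_contra h
      refine right_ne_zero_of_mul (hS α hα) ?_
      rw [transl_of_ne _ h, transl_of_ne _ h, mul_zero, sub_zero]
    · rw [mul_assoc, ← ENNReal.tsum_mul_left (a := C ^ 2)]
      refine mul_le_mul' le_rfl (ENNReal.tsum_le_tsum fun α => ?_)
      rw [enorm_mul, mul_pow]
      by_cases hα : f α = 0
      · simp [hα]
      · simp only [hχ, if_neg hα, one_mul]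
        gcongr
        · exact hC α
        · exact hm.enorm_transl_sub_sq_le _ α β
  have h2 : ∀ α, χ α * ∑' β, densityDiff m α β * ∑' ε, ‖transl (P ε) (inv α) β‖ₑ ^ 2
      ≤ η * ∑' δ, (if f α ≠ 0 ∧ rng δ = IsoQuotient.mk (dom α) then 1 else 0) * ‖ξ δ‖ₑ ^ 2 := by
    intro α
    by_cases hα : f α = 0
    · simp [hχ, hα]
    · simp only [hP, densityDiff_mul_tsum_enorm, ENNReal.tsum_mul_right, hχ, if_neg hα, one_mul]
      refine mul_le_mul' (hη α hα) (le_of_eq (tsum_congr fun δ => ?_))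
      simp [hα]
  rw [enorm_sq_eq_tsum D]
  calc ∑' ε, ‖D ε‖ₑ ^ 2 = ∑' ε, ∑' β, ‖D ε β‖ₑ ^ 2 := tsum_congr fun ε => enorm_sq_eq_tsum _
    _ ≤ ∑' ε, ∑' β, n * C ^ 2 *
        ∑' α, χ α * (densityDiff m α β * ‖transl (P ε) (inv α) β‖ₑ ^ 2) := by
        gcongr with ε β
        exact h1 ε β
    -- The sum over `ε` is moved innermost, where `densityDiff_mul_tsum_enorm` evaluates it.
    _ = n * C ^ 2 * ∑' α, χ α * ∑' β, densityDiff m α β *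
        ∑' ε, ‖transl (P ε) (inv α) β‖ₑ ^ 2 := by
        simp only [ENNReal.tsum_mul_left]
        congr 1
        simp only [← ENNReal.tsum_mul_left]
        rw [ENNReal.tsum_comm]
        simp only [ENNReal.tsum_comm (α := IsoQuotient G) (β := G)]
        rw [ENNReal.tsum_comm]
    _ ≤ n * C ^ 2 * ∑' α, η * ∑' δ,
        (if f α ≠ 0 ∧ rng δ = IsoQuotient.mk (dom α) then 1 else 0) * ‖ξ δ‖ₑ ^ 2 := by
        exact mul_le_mul' le_rfl (ENNReal.tsum_le_tsum h2)
    _ = n * C ^ 2 * (η * ∑' δ, (∑' α,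
        (if f α ≠ 0 ∧ rng δ = IsoQuotient.mk (dom α) then 1 else 0)) * ‖ξ δ‖ₑ ^ 2) := by
        rw [ENNReal.tsum_mul_left, ENNReal.tsum_comm]
        simp only [ENNReal.tsum_mul_right]
    _ ≤ n * C ^ 2 * (η * ∑' δ, k * ‖ξ δ‖ₑ ^ 2) := by
        gcongr with δ
        exact tsum_ite_one_le (hk (rng δ))
    _ = n * C ^ 2 * k * η * ‖ξ‖ₑ ^ 2 := by
        rw [ENNReal.tsum_mul_left, enorm_sq_eq_tsum ξ]
        ring

/-- Inversion maps the fibre over `ρ` bijectively onto the fibre over `ρ⁻¹`. This reduces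
intertwining of adjoints to intertwining of functions in `C_c(G)`. -/
theorem ccStar_quotientSum (hG : IsClosed (isoInt G)) (f : CompactlySupportedContinuousMap G ℂ) :
    ccStar (quotientSum hG f) = quotientSum hG (ccStar f) := by
  ext ρ
  change star (∑ᶠ α : {α : G // IsoQuotient.mk α = inv ρ}, f α.1)
    = ∑ᶠ α : {α : G // IsoQuotient.mk α = ρ}, star (f (inv α.1))
  let e : {α : G // IsoQuotient.mk α = ρ} ≃ {α : G // IsoQuotient.mk α = inv ρ} :=
    { toFun := fun α => ⟨inv α.1, by rw [← IsoQuotient.inv_mk, α.2]⟩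
      invFun := fun α => ⟨inv α.1, by rw [← IsoQuotient.inv_mk, α.2, ArrowGroupoid.inv_inv]⟩
      left_inv := fun α => Subtype.ext (ArrowGroupoid.inv_inv _)
      right_inv := fun α => Subtype.ext (ArrowGroupoid.inv_inv _) }
  rw [← finsum_comp_equiv e]
  exact (starAddEquiv (R := ℂ)).map_finsum _

theorem quotientSumExtends_of_isAmenable (hG : IsClosed (isoInt G)) (hA : IsAmenable G) :
    QuotientSumExtends hG := by
  have hm : ∀ i : TopologicalSpace.Compacts G × ℕ, ∃ m : G → ℝ, IsDensity m ∧
      ∀ α ∈ i.1, ∑' β, densityDiff m α β ≤ ENNReal.ofReal (1 / (i.2 + 1)) := fun i => by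
    obtain ⟨m, -, h0, h1, h2⟩ := hA i.1 i.1.isCompact (1 / (i.2 + 1)) (by positivity)
    have hm : IsDensity m := ⟨h0, h1⟩
    refine ⟨m, hm, fun α hα => ?_⟩
    rw [hm.tsum_densityDiff]
    exact ENNReal.ofReal_le_ofReal (h2 α hα).le
  choose m hm hinv using hm
  let V := fun i => (hm i).isometry
  have h1 : ∀ f, AsympIntertwines atTop (amplification G) V (regRep f)
      (regRep (quotientSum hG f)) := by
    intro f
    obtain ⟨C, hC, hbound⟩ := exists_enorm_intertwiningDefect_sq_le hG f
    -- The densities are indexed by a compact set and a tolerance `1 / (n + 1)`. Once the compact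
    -- set contains the support of `f`, the bound on the squared defect applies.
    have hle : ∀ i : TopologicalSpace.Compacts G × ℕ, (⟨tsupport f, f.hasCompactSupport⟩, 0) ≤ i →
        ‖intertwiningDefect (amplification G) (V i) (regRep f) (regRep (quotientSum hG f))‖
          ≤ √(C.toReal * (1 / (i.2 + 1))) := by
      intro i hi
      refine ContinuousLinearMap.opNorm_le_bound _ (Real.sqrt_nonneg _) fun ξ => ?_
      have := hbound (m i) (hm i) (ENNReal.ofReal (1 / (i.2 + 1)))
        (fun α hα => hinv i α (hi.1 (subset_tsupport f hα))) ξ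
      have := ENNReal.toReal_mono (by finiteness) this
      rw [ENNReal.toReal_mul, ENNReal.toReal_mul, ENNReal.toReal_pow, ENNReal.toReal_pow,
        toReal_enorm, toReal_enorm, ENNReal.toReal_ofReal (by positivity)] at this
      have h3 := Real.sqrt_le_sqrt this
      rwa [Real.sqrt_mul (by positivity), Real.sqrt_sq (norm_nonneg _),
        Real.sqrt_sq (norm_nonneg _)] at h3
    refine squeeze_zero_norm' ((eventually_ge_atTop _).mono hle) ?_
    have h2 : Tendsto (fun i : TopologicalSpace.Compacts G × ℕ => 1 / ((i.2 : ℝ) + 1)) atTop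
        (𝓝 0) := by
      rw [← prod_atTop_atTop_eq]
      exact tendsto_one_div_add_atTop_nhds_zero_nat.comp tendsto_snd
    have := (h2.const_mul C.toReal).sqrt
    rwa [mul_zero, Real.sqrt_zero] at this
  have h2 : ∀ f, StarAsympIntertwines atTop (amplification G) V (regRep f)
      (regRep (quotientSum hG f)) := fun f =>
    ⟨h1 f, by
      rw [star_regRep, star_regRep, ccStar_quotientSum]
      exact h1 _⟩
  obtain ⟨ψ, hψ⟩ := exists_starHom_of_starAsympIntertwines (F := atTop) (V := V)
    norm_amplification_le (A := reducedAlgebra G) (B := reducedAlgebra (IsoQuotient G))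
    fun a ha => exists_starAsympIntertwines norm_amplification_le isClosed_reducedAlgebra
      (by
        rintro _ ⟨f, rfl⟩
        exact ⟨_, (ofCc (quotientSum hG f)).2, h2 f⟩) ha
  exact ⟨ψ, fun f => hψ _ _ (h2 f)⟩

end Amenable

end EtaleGroupoid

theorem mainTheorem3 {G H : Type*}
    [TopologicalSpace G] [T2Space G] [LocallyCompactSpace G] [EtaleGroupoid G]
    [TopologicalSpace H] [T2Space H] [LocallyCompactSpace H] [EtaleGroupoid H]
    (hH : IsClosed (EtaleGroupoid.isoInt H)) :
    (EtaleGroupoid.QuotientSumExtends hH →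
      ∀ φ : EtaleGroupoid.reducedAlgebra G →⋆ₙₐ[ℂ] EtaleGroupoid.reducedAlgebra H,
        Function.Surjective φ →
        Set.BijOn φ (EtaleGroupoid.diagonal G) (EtaleGroupoid.diagonal H) →
        Nonempty (EtaleGroupoid.Iso (EtaleGroupoid.IsoQuotient G) (EtaleGroupoid.IsoQuotient H))) ∧
    (EtaleGroupoid.IsAmenable H → EtaleGroupoid.QuotientSumExtends hH) := by
  exact ⟨fun _ _ hs hφ => EtaleGroupoid.nonempty_iso_isoQuotient hs hφ,
    EtaleGroupoid.quotientSumExtends_of_isAmenable hH⟩
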